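/- Let $H$ be a cocommutative Hopf algebra over a field $k$ with antipode $S$ (so $S^{-1}=S$), let $A$ be a right $H$-comodule algebra with coaction $\rho(a)=a_{[0]}\otimes a_{[1]}$, and put $B=A^{{\rm co}H}=\{a : \rho(a)=a\otimes 1\}$, with center $Z(B)$. Assume that $A$ is a faithfully flat $H$-Galois extension of $B$: the map ${\rm can}: A\otimes_B A\to A\otimes H$, $a\otimes_B a'\mapsto aa'_{[0]}\otimes a'_{[1]}$, is bijective and $A$ is faithfully flat as a left $B$-module. For $h\in H$ write ${\rm can}^{-1}(1\otimes h)=\sum_i l_i(h)\otimes_B r_i(h)$. For $x\in Z(B)$, the left Miyashita–Ulbrich action is $$h\cdot x=\sum_i l_i(S^{-1}(h))\,x\,r_i(S^{-1}(h)).$$ It takes values in $Z(B)$ and makes $Z(B)$ a left $H$-module algebra. Let $A^{\rm op}$ carry the coaction $a\mapsto a_{[0]}\otimes S(a_{[1]})$, let $B^e=B\otimes B^{\rm op}$, and let $A^{\square e}=A\,\square_H A^{\rm op}\subseteq A\otimes A^{\rm op}$ be the algebra of all $\sum_k a_k\otimes a'_k$ with $\sum_k a_{k[0]}\otimes a'_k\otimes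 a_{k[1]}=\sum_k a_k\otimes a'_{k[0]}\otimes S(a'_{k[1]})$; it contains $B^e$. It is an $H$-comodule algebra under $\sum_k a_k\otimes a'_k\mapsto\sum_k (a_{k[0]}\otimes a'_k)\otimes a_{k[1]}$, and for a $B$-bimodule $M$ (over $k$) this induces a coaction on $P_M=A^{\square e}\otimes_{B^e}M$. The bimodule $M$ is called $H$-stable if there is an isomorphism $\varphi: P_M\to M\otimes H$ of $B$-bimodules and right $H$-comodules, where $b(m\otimes h)b'=bmb'\otimes h$ and $\rho(m\otimes h)=m\otimes h_{(1)}\otimes h_{(2)}$. Let $E={}_{A^{\square e}}{\rm END}(P_M)^{\rm op}$ be the algebra (with product opposite to composition) of rational endomorphisms of $P_M$, i.e. those $A^{\square e}$-linear $f$ for which there is $f_{[0]}\otimes f_{[1]}\in{}_{A^{\square e}}{\rm End}(P_M)\otimes H$ with $\rho(f(p))=f_{[0]}(p_{[0]})\otimes p_{[1]}f_{[1]}$ for all $p\in P_M$; this element is the coaction of $f$, and $E^{{\rm co}H}$ consists of the $f$ with coaction $f\otimes 1$. Let $M$ be an $H$-stable invertible $B$-bimodule, i.e. $M$ is $H$-stable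 and there is a strict Morita context $(B,B,M,N,\alpha,\beta)$. Then: 1. $\lambda_x\bigl(y\otimes_{B^e} m\bigr)=y\otimes_{B^e}xm$ defines an isomorphism of algebras $\lambda: Z(B)\to E^{{\rm co}H}$, $x\mapsto\lambda_x$. 2. $E$ is $H$-cleft: for each isomorphism $\varphi$ as above, $t(h)(y\otimes_{B^e}m)=y\,\varphi^{-1}(m\otimes h)$ defines an $H$-colinear map $t:H\to E$ that is invertible for the convolution product; moreover there is a convolution invertible $H$-colinear $t:H\to E$ with $t(1)=1$. 3. For every $H$-colinear $t:H\to E$ with convolution inverse $u$, the induced action $h\bullet e=t(h_{(1)})\,e\,u(h_{(2)})$ (products in $E$) of $H$ on $E^{{\rm co}H}$ is given by $$h\bullet\lambda_x=\lambda_{h\cdot x}\qquad(h\in H,\ x\in Z(B)).$$ Thus the $H$-module algebra structure on $Z(B)$ transported from $E^{{\rm co}H}$ along $\lambda$ is the Miyashita–Ulbrich action; in particular it does not depend on $M$. -/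

import Mathlib

open scoped TensorProduct
open MulOpposite

namespace HopfGalois

noncomputable section

universe u v w w'

/-! ### Tensor products over a noncommutative algebra -/

section Balanced

variable (k : Type*) [CommRing k] (R : Type*) [Ring R]
variable (X : Type*) [AddCommGroup X] [Module k X] [Module Rᵐᵒᵖ X]
variable (Y : Type*) [AddCommGroup Y] [Module k Y] [Module R Y]

/-- The relations `x r ⊗ y = x ⊗ r y` in `X ⊗ₖ Y`, for a right `R`-module `X` (a module over the
opposite ring) and a left `R`-module `Y`. -/
def balancedRel : Submodule k (X ⊗[k] Y) :=
  Submodule.span k {z | ∃ (x : X) (r : R) (y : Y), z = (op r • x) ⊗ₜ[k] y - x ⊗ₜ[k] (r • y)}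

/-- The tensor product `X ⊗_R Y` over a (noncommutative) `k`-algebra `R`. -/
def BTensor : Type _ := (X ⊗[k] Y) ⧸ balancedRel k R X Y

instance : AddCommGroup (BTensor k R X Y) :=
  inferInstanceAs (AddCommGroup ((X ⊗[k] Y) ⧸ balancedRel k R X Y))

instance : Module k (BTensor k R X Y) :=
  inferInstanceAs (Module k ((X ⊗[k] Y) ⧸ balancedRel k R X Y))

namespace BTensor

/-- The canonical projection `X ⊗ₖ Y → X ⊗_R Y`. -/
def mk : X ⊗[k] Y →ₗ[k] BTensor k R X Y := (balancedRel k R X Y).mkQ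

variable {X Y}

/-- The pure tensor `x ⊗_R y`. -/
def tmul (x : X) (y : Y) : BTensor k R X Y := mk k R X Y (x ⊗ₜ[k] y)

variable {k R}

theorem tmul_balanced (x : X) (r : R) (y : Y) :
    tmul k R (op r • x) y = tmul k R x (r • y) :=
  (Submodule.Quotient.eq _).2 (Submodule.subset_span ⟨x, r, y, rfl⟩)

theorem mk_surjective : Function.Surjective (mk k R X Y) := Submodule.mkQ_surjective _

variable {Z : Type*} [AddCommGroup Z] [Module k Z]

/-- A balanced linear map on `X ⊗ₖ Y` factors through `X ⊗_R Y`. -/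
def lift (f : X ⊗[k] Y →ₗ[k] Z)
    (hf : ∀ (x : X) (r : R) (y : Y), f ((op r • x) ⊗ₜ[k] y) = f (x ⊗ₜ[k] (r • y))) :
    BTensor k R X Y →ₗ[k] Z :=
  (balancedRel k R X Y).liftQ f (Submodule.span_le.2 (by
    rintro _ ⟨x, r, y, rfl⟩
    simp [hf]))

theorem lift_mk (f : X ⊗[k] Y →ₗ[k] Z)
    (hf : ∀ (x : X) (r : R) (y : Y), f ((op r • x) ⊗ₜ[k] y) = f (x ⊗ₜ[k] (r • y)))
    (z : X ⊗[k] Y) : lift f hf (mk k R X Y z) = f z := rfl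

theorem lift_tmul (f : X ⊗[k] Y →ₗ[k] Z)
    (hf : ∀ (x : X) (r : R) (y : Y), f ((op r • x) ⊗ₜ[k] y) = f (x ⊗ₜ[k] (r • y)))
    (x : X) (y : Y) : lift f hf (tmul k R x y) = f (x ⊗ₜ[k] y) := rfl

theorem hom_ext {f g : BTensor k R X Y →ₗ[k] Z}
    (h : ∀ x y, f (tmul k R x y) = g (tmul k R x y)) : f = g := by
  refine LinearMap.ext fun z => ?_
  obtain ⟨z, rfl⟩ := mk_surjective z
  exact LinearMap.congr_fun (f := f ∘ₗ mk k R X Y) (g := g ∘ₗ mk k R X Y)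
    (TensorProduct.ext' h) z

/-- The map `f ⊗_R Y`, for a `k`-linear map `f` of right `R`-modules. -/
def rTensor {X' : Type*} [AddCommGroup X'] [Module k X'] [Module Rᵐᵒᵖ X'] (f : X →ₗ[k] X')
    (hf : ∀ (r : R) (x : X), f (op r • x) = op r • f x) :
    BTensor k R X Y →ₗ[k] BTensor k R X' Y :=
  lift (mk k R X' Y ∘ₗ LinearMap.rTensor Y f) (by
    intro x r y
    simp only [LinearMap.comp_apply, LinearMap.rTensor_tmul, hf]
    exact tmul_balanced (k := k) (f x) r y)

theorem rTensor_tmul {X' : Type*} [AddCommGroup X'] [Module k X'] [Module Rᵐᵒᵖ X']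
    (f : X →ₗ[k] X') (hf : ∀ (r : R) (x : X), f (op r • x) = op r • f x) (x : X) (y : Y) :
    rTensor f hf (tmul k R x y) = tmul k R (f x) y := rfl

end BTensor

end Balanced

section Flat

variable (k : Type*) [CommRing k] (R : Type v) [Ring R] [Algebra k R]
variable (Y : Type*) [AddCommGroup Y] [Module k Y] [Module R Y]

/-- The left `R`-module `Y` is faithfully flat: `- ⊗_R Y` preserves injectivity of maps of right
`R`-modules, and kills no nonzero right `R`-module. -/
structure IsFaithfullyFlatLeft : Prop where
  flat : ∀ (X X' : Type v) [AddCommGroup X] [Module k X] [Module Rᵐᵒᵖ X] [IsScalarTower k Rᵐᵒᵖ X]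
    [AddCommGroup X'] [Module k X'] [Module Rᵐᵒᵖ X'] [IsScalarTower k Rᵐᵒᵖ X']
    (f : X →ₗ[k] X') (hf : ∀ (r : R) (x : X), f (op r • x) = op r • f x),
    Function.Injective f →
      Function.Injective (BTensor.rTensor f hf : BTensor k R X Y →ₗ[k] BTensor k R X' Y)
  faithful : ∀ (X : Type v) [AddCommGroup X] [Module k X] [Module Rᵐᵒᵖ X]
    [IsScalarTower k Rᵐᵒᵖ X], Subsingleton (BTensor k R X Y) → Subsingleton X

end Flat

/-! ### Comodule algebras and Hopf-Galois extensions -/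

/-- A right `H`-comodule algebra: an algebra with a coassociative and counital coaction
`a ↦ a₀ ⊗ a₁` that is a morphism of algebras. -/
class RightComoduleAlgebra (k H A : Type*) [Field k] [Ring H] [HopfAlgebra k H] [Ring A]
    [Algebra k A] where
  /-- The coaction `a ↦ a₀ ⊗ a₁`. -/
  coaction : A →ₐ[k] A ⊗[k] H
  coassoc : ∀ a : A, TensorProduct.assoc k A H H (coaction.toLinearMap.rTensor H (coaction a)) =
    (Coalgebra.comul : H →ₗ[k] H ⊗[k] H).lTensor A (coaction a)
  counit : ∀ a : A, (Coalgebra.counit : H →ₗ[k] k).lTensor A (coaction a) = a ⊗ₜ[k] 1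

section Galois

variable (k H A : Type*) [Field k] [Ring H] [HopfAlgebra k H] [Ring A] [Algebra k A]
  [RightComoduleAlgebra k H A]

/-- The coaction of a comodule algebra. -/
abbrev rho : A →ₐ[k] A ⊗[k] H := RightComoduleAlgebra.coaction

/-- The subalgebra `A^{co H}` of coinvariants: all `a` with `ρ(a) = a ⊗ 1`. -/
def coinv : Subalgebra k A :=
  AlgHom.equalizer (rho k H A) (Algebra.TensorProduct.includeLeft : A →ₐ[k] A ⊗[k] H)

variable {k H A} in
theorem rho_coinv (b : coinv k H A) : rho k H A (b : A) = (b : A) ⊗ₜ[k] 1 := b.2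

/-- `A` as a right module over `B = A^{co H}`, by multiplication. -/
instance : Module (coinv k H A)ᵐᵒᵖ A :=
  Module.compHom A (AlgHom.op (coinv k H A).val).toRingHom

variable {k H A} in
theorem op_coinv_smul (b : coinv k H A) (a : A) : op b • a = a * (b : A) := rfl

/-- The canonical map `can : A ⊗_B A → A ⊗ H`, `can (a ⊗ a') = a a'₀ ⊗ a'₁`. -/
def can : BTensor k (coinv k H A) A A →ₗ[k] A ⊗[k] H :=
  BTensor.lift
    (LinearMap.mul' k (A ⊗[k] H) ∘ₗ TensorProduct.map
      (Algebra.TensorProduct.includeLeft : A →ₐ[k] A ⊗[k] H).toLinearMap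
      (rho k H A).toLinearMap) (by
    intro a b a'
    simp only [LinearMap.comp_apply, TensorProduct.map_tmul, LinearMap.mul'_apply,
      AlgHom.toLinearMap_apply, op_coinv_smul, Subalgebra.smul_def, smul_eq_mul, map_mul,
      rho_coinv, Algebra.TensorProduct.includeLeft_apply, mul_assoc])

theorem can_tmul (a a' : A) :
    can k H A (BTensor.tmul k (coinv k H A) a a') = (a ⊗ₜ[k] 1) * rho k H A a' := rfl

/-- `A` is a faithfully flat `H`-Galois extension of `B = A^{co H}`: the canonical map is
bijective and `A` is faithfully flat as a left `B`-module. -/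
structure IsFaithfullyFlatGalois : Prop where
  can_bijective : Function.Bijective (can k H A)
  faithfullyFlat : IsFaithfullyFlatLeft k (coinv k H A) A

variable {k H A}

/-- `γ(h) = can⁻¹(1 ⊗ h) = ∑ lᵢ(h) ⊗_B rᵢ(h)`. -/
def gamma (hA : IsFaithfullyFlatGalois k H A) (h : H) : BTensor k (coinv k H A) A A :=
  (LinearEquiv.ofBijective (can k H A) hA.can_bijective).symm (1 ⊗ₜ[k] h)

/-- For `x ∈ Z(B)`, the map `A ⊗_B A → A`, `a ⊗ a' ↦ a x a'`. -/
def sandwich (x : Subalgebra.center k (coinv k H A)) :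
    BTensor k (coinv k H A) A A →ₗ[k] A :=
  BTensor.lift
    (LinearMap.mul' k A ∘ₗ TensorProduct.map (LinearMap.mulRight k ((x : coinv k H A) : A))
      LinearMap.id) (by
    intro a b a'
    have h : (b : A) * ((x : coinv k H A) : A) = ((x : coinv k H A) : A) * (b : A) :=
      congrArg Subtype.val (Subalgebra.mem_center_iff.1 x.2 b)
    simp only [LinearMap.comp_apply, TensorProduct.map_tmul, LinearMap.mul'_apply,
      LinearMap.mulRight_apply, LinearMap.id_apply, op_coinv_smul, Subalgebra.smul_def,
      smul_eq_mul, mul_assoc]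
    rw [← mul_assoc (b : A), h, mul_assoc])

theorem sandwich_tmul (x : Subalgebra.center k (coinv k H A)) (a a' : A) :
    sandwich x (BTensor.tmul k (coinv k H A) a a') = a * ((x : coinv k H A) : A) * a' := rfl

/-- The right Miyashita-Ulbrich action `x • h = ∑ lᵢ(h) x rᵢ(h)` for `x ∈ Z(B)`, as an
element of `A`. -/
def muRight (hA : IsFaithfullyFlatGalois k H A) (x : Subalgebra.center k (coinv k H A)) (h : H) :
    A :=
  sandwich x (gamma hA h)


/-- The antipode of a cocommutative Hopf algebra is its own inverse. -/
theorem antipode_antipode [Coalgebra.IsCocomm k H] (h : H) :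
    HopfAlgebra.antipode k (HopfAlgebra.antipode k h) = h := by
  let S : H →ₗ[k] H := HopfAlgebra.antipode k
  have h1 : WithConv.toConv (S ∘ₗ S) * WithConv.toConv S = 1 := by
    apply WithConv.ofConv_injective
    refine LinearMap.ext fun x => ?_
    have e1 : ∀ z : H ⊗[k] H, LinearMap.mul' k H (TensorProduct.map (S ∘ₗ S) S z) =
        S (LinearMap.mul' k H (LinearMap.lTensor H S (TensorProduct.comm k H H z))) := by
      intro z
      induction z with
      | zero => simp
      | add a b ha hb => simp only [map_add, ha, hb]
      | tmul a b => simp [S, HopfAlgebra.antipode_mul_antidistrib]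
    have e2 : (WithConv.toConv (S ∘ₗ S) * WithConv.toConv S).ofConv x =
        LinearMap.mul' k H (TensorProduct.map (S ∘ₗ S) S (Coalgebra.comul x)) := rfl
    rw [e2, e1, Coalgebra.comm_comul, HopfAlgebra.mul_antipode_lTensor_comul_apply]
    change S _ = algebraMap k H _
    rw [Algebra.algebraMap_eq_smul_one, map_smul]
    simp [S]
  have h2 : WithConv.toConv S * WithConv.toConv LinearMap.id = 1 := by
    simp [S]
  have h3 : WithConv.toConv (S ∘ₗ S) = WithConv.toConv LinearMap.id := by
    calc WithConv.toConv (S ∘ₗ S)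
        = WithConv.toConv (S ∘ₗ S) * (WithConv.toConv S * WithConv.toConv LinearMap.id) := by
          rw [h2, mul_one]
      _ = _ := by rw [← mul_assoc, h1, one_mul]
  exact LinearMap.congr_fun (congrArg WithConv.ofConv h3) h

/-- The left Miyashita-Ulbrich action `h · x = x • S⁻¹(h) = ∑ lᵢ(S⁻¹(h)) x rᵢ(S⁻¹(h))` for
`x ∈ Z(B)`, as an element of `A`. Here `H` is cocommutative, so that `S⁻¹ = S`. -/
def muLeft [Coalgebra.IsCocomm k H] (hA : IsFaithfullyFlatGalois k H A) (h : H)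
    (x : Subalgebra.center k (coinv k H A)) : A :=
  muRight hA x (HopfAlgebra.antipode k h)

end Galois

/-! ### Equalizers of coactions -/

section Equalizer

/-- Tensoring with a vector space preserves equalizers. -/
theorem mem_range_of_eqLocus {K : Type*} [Field K] (T : Type*) [AddCommMonoid T] [Module K T]
    {U V W : Type*} [AddCommMonoid U] [Module K U] [AddCommMonoid V] [Module K V]
    [AddCommMonoid W] [Module K W] (i : U →ₗ[K] V) (f g : V →ₗ[K] W)
    (h1 : ∀ y, f y = g y → ∃ u, i u = y)
    (h2 : ∀ u, f (i u) = g (i u)) (z : V ⊗[K] T) (hz : f.rTensor T z = g.rTensor T z) :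
    ∃ u, i.rTensor T u = z := by
  let _ : AddCommGroup T := Module.addCommMonoidToAddCommGroup K
  let _ : AddCommGroup U := Module.addCommMonoidToAddCommGroup K
  let _ : AddCommGroup V := Module.addCommMonoidToAddCommGroup K
  let _ : AddCommGroup W := Module.addCommMonoidToAddCommGroup K
  have hex : Function.Exact i (f - g) := by
    intro y
    constructor
    · intro hy
      exact h1 y (sub_eq_zero.1 hy)
    · rintro ⟨y, rfl⟩
      exact sub_eq_zero.2 (h2 y)
  refine (Module.Flat.rTensor_exact T hex z).1 ?_
  rw [LinearMap.rTensor_sub, LinearMap.sub_apply, hz, sub_self]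

variable {k H V U : Type*} [Field k] [Ring H] [HopfAlgebra k H] [Ring V] [Algebra k V]
  [Ring U] [Algebra k U] (i : U →ₐ[k] V) (L : V →ₐ[k] V ⊗[k] H)

variable (H) in
/-- The inclusion `U ⊗ H → V ⊗ H`. -/
def inclTensor : U ⊗[k] H →ₐ[k] V ⊗[k] H := Algebra.TensorProduct.map i (AlgHom.id k H)

theorem inclTensor_injective (hi : Function.Injective i) : Function.Injective (inclTensor H i) :=
  Module.Flat.rTensor_preserves_injective_linearMap (M := H) i.toLinearMap hi

theorem mem_range_inclTensor [Coalgebra.IsCocomm k H] (R : V →ₐ[k] V ⊗[k] H)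
    (hU : ∀ x : V, L x = R x ↔ x ∈ i.range)
    (coassoc : ∀ x : V, TensorProduct.assoc k V H H (L.toLinearMap.rTensor H (L x)) =
      (Coalgebra.comul : H →ₗ[k] H ⊗[k] H).lTensor V (L x))
    (hLR : ∀ x : V, R.toLinearMap.rTensor H (L x) =
      TensorProduct.rightComm k V H H (L.toLinearMap.rTensor H (R x))) (u : U) :
    L (i u) ∈ (inclTensor H i).range := by
  have hu : L (i u) = R (i u) := (hU _).2 ⟨u, rfl⟩
  have h3 : ∀ z : V ⊗[k] (H ⊗[k] H), TensorProduct.rightComm k V H H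
      ((TensorProduct.assoc k V H H).symm z) = (TensorProduct.assoc k V H H).symm
        ((TensorProduct.comm k H H).toLinearMap.lTensor V z) := by
    intro z
    induction z with
    | zero => simp
    | add x y hx hy => simp only [map_add, hx, hy]
    | tmul y w =>
      induction w with
      | zero => simp
      | add x y hx hy => simp only [map_add, TensorProduct.tmul_add, hx, hy]
      | tmul g f => simp
  have h4 : L.toLinearMap.rTensor H (L (i u)) = (TensorProduct.assoc k V H H).symm
      ((Coalgebra.comul : H →ₗ[k] H ⊗[k] H).lTensor V (L (i u))) := by
    rw [← coassoc, LinearEquiv.symm_apply_apply]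
  have hD : L.toLinearMap.rTensor H (L (i u)) = R.toLinearMap.rTensor H (L (i u)) := by
    rw [hLR, ← hu, h4, h3, ← LinearMap.lTensor_comp_apply, Coalgebra.comm_comp_comul]
  obtain ⟨z, hz⟩ := mem_range_of_eqLocus H i.toLinearMap L.toLinearMap R.toLinearMap
    (fun y hy => (hU y).1 hy) (fun y => (hU _).2 ⟨y, rfl⟩) _ hD
  exact ⟨z, hz⟩

variable (hi : Function.Injective i) (hL : ∀ u, L (i u) ∈ (inclTensor H i).range)

/-- The restriction of a coaction to a subcomodule. -/
def restrictCoact : U →ₐ[k] U ⊗[k] H :=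
  (AlgEquiv.ofInjective (inclTensor H i) (inclTensor_injective i hi)).symm.toAlgHom.comp
    ((L.comp i).codRestrict (inclTensor H i).range hL)

theorem inclTensor_restrictCoact (u : U) : inclTensor H i (restrictCoact i L hi hL u) = L (i u) :=
  congrArg Subtype.val ((AlgEquiv.ofInjective (inclTensor H i)
    (inclTensor_injective i hi)).apply_symm_apply ⟨L (i u), hL u⟩)

/-- A subalgebra that is a subcomodule is a comodule algebra. -/
abbrev restrictComoduleAlgebra
    (coassoc : ∀ x : V, TensorProduct.assoc k V H H (L.toLinearMap.rTensor H (L x)) =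
      (Coalgebra.comul : H →ₗ[k] H ⊗[k] H).lTensor V (L x))
    (counit : ∀ x : V, (Coalgebra.counit : H →ₗ[k] k).lTensor V (L x) = x ⊗ₜ[k] 1) :
    RightComoduleAlgebra k H U where
  coaction := restrictCoact i L hi hL
  coassoc u := by
    have hinj : Function.Injective (i.toLinearMap.rTensor (H ⊗[k] H)) :=
      Module.Flat.rTensor_preserves_injective_linearMap _ hi
    apply hinj
    have h1 : ∀ z : U ⊗[k] H, i.toLinearMap.rTensor (H ⊗[k] H) (TensorProduct.assoc k U H H
        ((restrictCoact i L hi hL).toLinearMap.rTensor H z)) =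
        TensorProduct.assoc k V H H (L.toLinearMap.rTensor H (inclTensor H i z)) := by
      intro z
      induction z with
      | zero => simp
      | add x y hx hy => simp only [map_add, hx, hy]
      | tmul y h =>
        have h2 : ∀ w : U ⊗[k] H, i.toLinearMap.rTensor (H ⊗[k] H)
            (TensorProduct.assoc k U H H (w ⊗ₜ[k] h)) =
            TensorProduct.assoc k V H H (inclTensor H i w ⊗ₜ[k] h) := by
          intro w
          induction w with
          | zero => simp
          | add x y hx hy => simp only [map_add, TensorProduct.add_tmul, hx, hy]
          | tmul y g => rfl
        rw [LinearMap.rTensor_tmul, AlgHom.toLinearMap_apply, h2, inclTensor_restrictCoact]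
        rfl
    have h3 : ∀ z : U ⊗[k] H, i.toLinearMap.rTensor (H ⊗[k] H)
        ((Coalgebra.comul : H →ₗ[k] H ⊗[k] H).lTensor U z) =
        (Coalgebra.comul : H →ₗ[k] H ⊗[k] H).lTensor V (inclTensor H i z) := by
      intro z
      induction z with
      | zero => simp
      | add x y hx hy => simp only [map_add, hx, hy]
      | tmul y h => rfl
    rw [h1, h3, inclTensor_restrictCoact, coassoc]
  counit u := by
    have hinj : Function.Injective (i.toLinearMap.rTensor k) :=
      Module.Flat.rTensor_preserves_injective_linearMap _ hi
    apply hinj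
    have h3 : ∀ z : U ⊗[k] H, i.toLinearMap.rTensor k
        ((Coalgebra.counit : H →ₗ[k] k).lTensor U z) =
        (Coalgebra.counit : H →ₗ[k] k).lTensor V (inclTensor H i z) := by
      intro z
      induction z with
      | zero => simp
      | add x y hx hy => simp only [map_add, hx, hy]
      | tmul y h => rfl
    rw [h3, inclTensor_restrictCoact, counit]
    rfl

end Equalizer

/-! ### The cotensor product `A □_H Aᵒᵖ` -/

section Cotensor

variable {k H A C : Type*} [Field k] [Ring H] [HopfAlgebra k H] [Ring A] [Algebra k A]
  [Ring C] [Algebra k C] (σ : C →ₐ[k] C ⊗[k] H)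

variable (A) in
/-- `a ⊗ c ↦ (a ⊗ c₀) ⊗ c₁`, where `σ (c) = c₀ ⊗ c₁`. -/
def coactRight : A ⊗[k] C →ₐ[k] (A ⊗[k] C) ⊗[k] H :=
  (Algebra.TensorProduct.assoc k k k A C H).symm.toAlgHom.comp
    (Algebra.TensorProduct.map (AlgHom.id k A) σ)

theorem coactRight_tmul (a : A) (a' : C) : coactRight A σ (a ⊗ₜ[k] a') =
    (TensorProduct.assoc k A C H).symm (a ⊗ₜ[k] σ a') := rfl

variable [RightComoduleAlgebra k H A]

variable (k H A C) in
/-- `a ⊗ c ↦ (a₀ ⊗ c) ⊗ a₁`. -/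
def coactLeft : A ⊗[k] C →ₐ[k] (A ⊗[k] C) ⊗[k] H :=
  (Algebra.TensorProduct.assoc k k k A C H).symm.toAlgHom.comp
    ((Algebra.TensorProduct.map (AlgHom.id k A) (Algebra.TensorProduct.comm k H C).toAlgHom).comp
      ((Algebra.TensorProduct.assoc k k k A H C).toAlgHom.comp
        (Algebra.TensorProduct.map (rho k H A) (AlgHom.id k C))))

theorem coactLeft_tmul (a : A) (a' : C) : coactLeft k H A C (a ⊗ₜ[k] a') =
    TensorProduct.rightComm k A H C (rho k H A a ⊗ₜ[k] a') := by
  have h : ∀ z : A ⊗[k] H, (TensorProduct.assoc k A C H).symm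
      (TensorProduct.map LinearMap.id (TensorProduct.comm k H C).toLinearMap
        (TensorProduct.assoc k A H C (z ⊗ₜ[k] a'))) =
      TensorProduct.rightComm k A H C (z ⊗ₜ[k] a') := by
    intro z
    induction z with
    | zero => simp
    | add a b ha hb => simp only [map_add, TensorProduct.add_tmul, ha, hb]
    | tmul a b => simp
  exact h _

/-- `A ⊗ C` is a comodule under `a ⊗ a' ↦ (a₀ ⊗ a') ⊗ a₁`. -/
theorem coactLeft_coassoc (x : A ⊗[k] C) :
    TensorProduct.assoc k (A ⊗[k] C) H H
      ((coactLeft k H A C).toLinearMap.rTensor H (coactLeft k H A C x)) =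
    (Coalgebra.comul : H →ₗ[k] H ⊗[k] H).lTensor (A ⊗[k] C) (coactLeft k H A C x) := by
  induction x with
  | zero => simp
  | add x y hx hy => simp only [map_add, hx, hy]
  | tmul a a' =>
    have h1 : ∀ z : A ⊗[k] H, TensorProduct.assoc k (A ⊗[k] C) H H
        ((coactLeft k H A C).toLinearMap.rTensor H
          (TensorProduct.rightComm k A H C (z ⊗ₜ[k] a'))) =
        TensorProduct.rightComm k A (H ⊗[k] H) C
          (TensorProduct.assoc k A H H ((rho k H A).toLinearMap.rTensor H z) ⊗ₜ[k] a') := by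
      intro z
      induction z with
      | zero => simp
      | add x y hx hy => simp only [map_add, TensorProduct.add_tmul, hx, hy]
      | tmul b h =>
        simp only [TensorProduct.rightComm_tmul, LinearMap.rTensor_tmul, AlgHom.toLinearMap_apply,
          coactLeft_tmul]
        generalize rho k H A b = z
        induction z with
        | zero => simp
        | add x y hx hy => simp only [map_add, TensorProduct.add_tmul, hx, hy]
        | tmul c g => simp
    have h2 : ∀ z : A ⊗[k] H, (Coalgebra.comul : H →ₗ[k] H ⊗[k] H).lTensor (A ⊗[k] C)
          (TensorProduct.rightComm k A H C (z ⊗ₜ[k] a')) =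
        TensorProduct.rightComm k A (H ⊗[k] H) C
          ((Coalgebra.comul : H →ₗ[k] H ⊗[k] H).lTensor A z ⊗ₜ[k] a') := by
      intro z
      induction z with
      | zero => simp
      | add x y hx hy => simp only [map_add, TensorProduct.add_tmul, hx, hy]
      | tmul b h => simp
    rw [coactLeft_tmul, h1, h2, RightComoduleAlgebra.coassoc]

theorem coactRight_coactLeft (x : A ⊗[k] C) :
    (coactRight A σ).toLinearMap.rTensor H (coactLeft k H A C x) =
      TensorProduct.rightComm k (A ⊗[k] C) H H
        ((coactLeft k H A C).toLinearMap.rTensor H (coactRight A σ x)) := by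
  induction x with
  | zero => simp
  | add x y hx hy => simp only [map_add, hx, hy]
  | tmul a a' =>
    rw [coactLeft_tmul, coactRight_tmul]
    have h1 : ∀ z : A ⊗[k] H, (coactRight A σ).toLinearMap.rTensor H
        (TensorProduct.rightComm k A H C (z ⊗ₜ[k] a')) =
        TensorProduct.rightComm k (A ⊗[k] C) H H ((TensorProduct.assoc k (A ⊗[k] C) H H).symm
          (TensorProduct.tensorTensorTensorComm k A H C H (z ⊗ₜ[k] σ a'))) := by
      intro z
      induction z with
      | zero => simp
      | add x y hx hy => simp only [map_add, TensorProduct.add_tmul, hx, hy]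
      | tmul b g =>
        simp only [TensorProduct.rightComm_tmul, LinearMap.rTensor_tmul, AlgHom.toLinearMap_apply,
          coactRight_tmul]
        generalize σ a' = w
        induction w with
        | zero => simp
        | add x y hx hy => simp only [map_add, TensorProduct.add_tmul, TensorProduct.tmul_add, hx, hy]
        | tmul c f => simp
    have h2 : ∀ w : C ⊗[k] H, (coactLeft k H A C).toLinearMap.rTensor H
        ((TensorProduct.assoc k A C H).symm (a ⊗ₜ[k] w)) =
        (TensorProduct.assoc k (A ⊗[k] C) H H).symm
          (TensorProduct.tensorTensorTensorComm k A H C H (rho k H A a ⊗ₜ[k] w)) := by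
      intro w
      induction w with
      | zero => simp
      | add x y hx hy => simp only [map_add, TensorProduct.tmul_add, hx, hy]
      | tmul c f =>
        simp only [TensorProduct.assoc_symm_tmul, LinearMap.rTensor_tmul,
          AlgHom.toLinearMap_apply, coactLeft_tmul]
        generalize rho k H A a = z
        induction z with
        | zero => simp
        | add x y hx hy => simp only [map_add, TensorProduct.add_tmul, hx, hy]
        | tmul b g => simp
    rw [h1, h2]

theorem coactLeft_counit (x : A ⊗[k] C) :
    (Coalgebra.counit : H →ₗ[k] k).lTensor (A ⊗[k] C) (coactLeft k H A C x) = x ⊗ₜ[k] 1 := by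
  induction x with
  | zero => simp
  | add x y hx hy => simp only [map_add, hx, hy, TensorProduct.add_tmul]
  | tmul a a' =>
    have h2 : ∀ z : A ⊗[k] H, (Coalgebra.counit : H →ₗ[k] k).lTensor (A ⊗[k] C)
          (TensorProduct.rightComm k A H C (z ⊗ₜ[k] a')) =
        TensorProduct.rightComm k A k C
          ((Coalgebra.counit : H →ₗ[k] k).lTensor A z ⊗ₜ[k] a') := by
      intro z
      induction z with
      | zero => simp
      | add x y hx hy => simp only [map_add, TensorProduct.add_tmul, hx, hy]
      | tmul b h => simp
    rw [coactLeft_tmul, h2, RightComoduleAlgebra.counit, TensorProduct.rightComm_tmul]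

end Cotensor

section Box

variable (k H A : Type*) [Field k] [Ring H] [HopfAlgebra k H] [Ring A] [Algebra k A]
  [RightComoduleAlgebra k H A]

/-- The coaction `a ↦ a₀ ⊗ S(a₁)` of the opposite algebra. -/
def rhoOp : Aᵐᵒᵖ →ₐ[k] Aᵐᵒᵖ ⊗[k] H :=
  (Algebra.TensorProduct.map (AlgHom.id k Aᵐᵒᵖ)
    (AlgHom.opComm (HopfAlgebra.antipodeAlgHomOp k H))).comp
  ((Algebra.TensorProduct.opAlgEquiv k k A H).symm.toAlgHom.comp (AlgHom.op (rho k H A)))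

variable {k H A} in
theorem rhoOp_op (a : A) : rhoOp k H A (op a) =
    TensorProduct.map (opLinearEquiv k).toLinearMap (HopfAlgebra.antipode k) (rho k H A a) := by
  have h : ∀ z : A ⊗[k] H, Algebra.TensorProduct.map (AlgHom.id k Aᵐᵒᵖ)
      (AlgHom.opComm (HopfAlgebra.antipodeAlgHomOp k H))
        ((Algebra.TensorProduct.opAlgEquiv k k A H).symm (op z)) =
      TensorProduct.map (opLinearEquiv k).toLinearMap (HopfAlgebra.antipode k) z := by
    intro z
    induction z with
    | zero => simp
    | add a b ha hb => simp only [map_add, ha, hb, op_add]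
    | tmul a b => simp
  exact h _

/-- The cotensor product `A □_H Aᵒᵖ`, consisting of all `∑ aᵢ ⊗ a'ᵢ` in `A ⊗ Aᵒᵖ` such that
`∑ aᵢ₀ ⊗ a'ᵢ ⊗ aᵢ₁ = ∑ aᵢ ⊗ a'ᵢ₀ ⊗ S(a'ᵢ₁)`. -/
def boxE : Subalgebra k (A ⊗[k] Aᵐᵒᵖ) :=
  AlgHom.equalizer (coactLeft k H A Aᵐᵒᵖ) (coactRight A (rhoOp k H A))

/-- The algebra `A^{□e} = A □_H Aᵒᵖ`, as a type. -/
def BoxE : Type _ := boxE k H A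

instance : Ring (BoxE k H A) := inferInstanceAs (Ring (boxE k H A))

instance : Algebra k (BoxE k H A) := inferInstanceAs (Algebra k (boxE k H A))

/-- The inclusion `A □_H Aᵒᵖ → A ⊗ Aᵒᵖ`. -/
def boxVal : BoxE k H A →ₐ[k] A ⊗[k] Aᵐᵒᵖ := (boxE k H A).val

theorem boxVal_injective : Function.Injective (boxVal k H A) := Subtype.val_injective

/-- The comodule algebra `A^{□e}`, whose coaction is the restriction of
`a ⊗ a' ↦ (a₀ ⊗ a') ⊗ a₁`. -/
instance [Coalgebra.IsCocomm k H] : RightComoduleAlgebra k H (BoxE k H A) :=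
  restrictComoduleAlgebra (boxVal k H A) (coactLeft k H A Aᵐᵒᵖ) (boxVal_injective k H A)
    (mem_range_inclTensor (boxVal k H A) (coactLeft k H A Aᵐᵒᵖ) (coactRight A (rhoOp k H A))
      (fun x => ⟨fun hx => ⟨⟨x, hx⟩, rfl⟩, by rintro ⟨y, rfl⟩; exact y.2⟩)
      coactLeft_coassoc (coactRight_coactLeft _))
    coactLeft_coassoc coactLeft_counit

theorem inclTensor_rho [Coalgebra.IsCocomm k H] (x : BoxE k H A) :
    inclTensor H (boxVal k H A) (rho k H (BoxE k H A) x) = coactLeft k H A Aᵐᵒᵖ (boxVal k H A x) :=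
  inclTensor_restrictCoact _ _ _ _ x

end Box

/-! ### Rational endomorphisms of a relative Hopf module -/

section Rational

variable {k H S P : Type*} [Field k] [Ring H] [HopfAlgebra k H] [Ring S] [Algebra k S]
  [AddCommGroup P] [Module k P] [Module S P] [IsScalarTower k S P] [SMulCommClass S k P]

variable (k H S P) in
/-- An element `∑ fᵢ ⊗ hᵢ` of `End_S(P)ᵒᵖ ⊗ H` acts on `P ⊗ H` by
`p ⊗ h ↦ ∑ fᵢ(p) ⊗ h hᵢ`. -/
def endTensor : (Module.End S P)ᵐᵒᵖ ⊗[k] H →ₗ[k] Module.End k (P ⊗[k] H) :=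
  TensorProduct.lift (LinearMap.mk₂ k
    (fun f h => TensorProduct.map ((unop f).restrictScalars k) (LinearMap.mulRight k h))
    (fun f g h => by
      refine TensorProduct.ext' fun p x => ?_
      simp [TensorProduct.add_tmul])
    (fun c f h => by
      refine TensorProduct.ext' fun p x => ?_
      simp [TensorProduct.smul_tmul'])
    (fun f g h => by
      refine TensorProduct.ext' fun p x => ?_
      simp [mul_add, TensorProduct.tmul_add])
    (fun c f h => by
      refine TensorProduct.ext' fun p x => ?_
      simp))

theorem endTensor_tmul (f : (Module.End S P)ᵐᵒᵖ) (h : H) (p : P) (x : H) :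
    endTensor k H S P (f ⊗ₜ[k] h) (p ⊗ₜ[k] x) = (unop f p) ⊗ₜ[k] (x * h) := rfl

theorem endTensor_mul (v w : (Module.End S P)ᵐᵒᵖ ⊗[k] H) :
    endTensor k H S P (v * w) = endTensor k H S P w ∘ₗ endTensor k H S P v := by
  induction v with
  | zero => rw [zero_mul, map_zero, LinearMap.comp_zero]
  | add x y hx hy => rw [add_mul, map_add, hx, hy, map_add, LinearMap.comp_add]
  | tmul f h =>
    induction w with
    | zero => rw [mul_zero, map_zero, LinearMap.zero_comp]
    | add x y hx hy => rw [mul_add, map_add, hx, hy, map_add, LinearMap.add_comp]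
    | tmul g h' =>
      refine TensorProduct.ext' fun p x => ?_
      simp only [Algebra.TensorProduct.tmul_mul_tmul, LinearMap.comp_apply, endTensor_tmul,
        unop_mul, Module.End.mul_apply, mul_assoc]

/-- Let `P` carry a right `H`-coaction. The element `w = ∑ f₀ ⊗ f₁` of `End_S(P)ᵒᵖ ⊗ H` is the
coaction of the endomorphism `f` if `ρ(f(p)) = ∑ f₀(p₀) ⊗ p₁ f₁` for all `p`. -/
def IsCoactionOf (ρ : P →ₗ[k] P ⊗[k] H) (f : (Module.End S P)ᵐᵒᵖ)
    (w : (Module.End S P)ᵐᵒᵖ ⊗[k] H) : Prop :=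
  ∀ p : P, ρ (unop f p) = endTensor k H S P w (ρ p)

theorem IsCoactionOf.mul {ρ : P →ₗ[k] P ⊗[k] H} {f g : (Module.End S P)ᵐᵒᵖ}
    {v w : (Module.End S P)ᵐᵒᵖ ⊗[k] H} (hf : IsCoactionOf ρ f v) (hg : IsCoactionOf ρ g w) :
    IsCoactionOf ρ (f * g) (v * w) := by
  intro p
  rw [unop_mul, Module.End.mul_apply, hg, hf, endTensor_mul, LinearMap.comp_apply]

theorem IsCoactionOf.add {ρ : P →ₗ[k] P ⊗[k] H} {f g : (Module.End S P)ᵐᵒᵖ}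
    {v w : (Module.End S P)ᵐᵒᵖ ⊗[k] H} (hf : IsCoactionOf ρ f v) (hg : IsCoactionOf ρ g w) :
    IsCoactionOf ρ (f + g) (v + w) := by
  intro p
  rw [unop_add, LinearMap.add_apply, map_add, hg, hf, map_add, LinearMap.add_apply]

theorem isCoactionOf_algebraMap (ρ : P →ₗ[k] P ⊗[k] H) (c : k) :
    IsCoactionOf ρ (algebraMap k (Module.End S P)ᵐᵒᵖ c)
      (algebraMap k (Module.End S P)ᵐᵒᵖ c ⊗ₜ[k] 1) := by
  intro p
  have h1 : ∀ p : P, unop (algebraMap k (Module.End S P)ᵐᵒᵖ c) p = c • p := fun p => rfl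
  have h2 : ∀ z : P ⊗[k] H,
      endTensor k H S P (algebraMap k (Module.End S P)ᵐᵒᵖ c ⊗ₜ[k] 1) z = c • z := by
    intro z
    induction z with
    | zero => simp
    | add x y hx hy => simp only [map_add, smul_add, hx, hy]
    | tmul p x => rw [endTensor_tmul, h1, mul_one, TensorProduct.smul_tmul']
  rw [h1, h2, map_smul]

variable (S) in
/-- The algebra `END_S(P)ᵒᵖ` of rational endomorphisms of `P`, those `f` for which there is an
element `f₀ ⊗ f₁` of `End_S(P) ⊗ H` with `ρ(f(p)) = f₀(p₀) ⊗ p₁ f₁` for all `p`. The product is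
opposite to composition. -/
def rationalEnd (ρ : P →ₗ[k] P ⊗[k] H) : Subalgebra k (Module.End S P)ᵐᵒᵖ where
  carrier := {f | ∃ w, IsCoactionOf ρ f w}
  mul_mem' := by
    rintro f g ⟨v, hv⟩ ⟨w, hw⟩
    exact ⟨v * w, hv.mul hw⟩
  add_mem' := by
    rintro f g ⟨v, hv⟩ ⟨w, hw⟩
    exact ⟨v + w, hv.add hw⟩
  algebraMap_mem' c := ⟨_, isCoactionOf_algebraMap ρ c⟩

variable (S) in
/-- The coinvariants of `END_S(P)ᵒᵖ`: the `f` whose coaction is `f ⊗ 1`. -/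
def rationalCoinv (ρ : P →ₗ[k] P ⊗[k] H) : Subalgebra k (rationalEnd S ρ) where
  carrier := {f | IsCoactionOf ρ (f : (Module.End S P)ᵐᵒᵖ)
    ((f : (Module.End S P)ᵐᵒᵖ) ⊗ₜ[k] 1)}
  mul_mem' := by
    intro f g hf hg
    have h := IsCoactionOf.mul hf hg
    rwa [Algebra.TensorProduct.tmul_mul_tmul, one_mul] at h
  add_mem' := by
    intro f g hf hg
    have h := IsCoactionOf.add hf hg
    rwa [← TensorProduct.add_tmul] at h
  algebraMap_mem' c := isCoactionOf_algebraMap ρ c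

/-- A linear map `t : H → END_S(P)ᵒᵖ` is `H`-colinear: the coaction of `t(h)` is
`t(h₁) ⊗ h₂`. -/
def IsColinear {ρ : P →ₗ[k] P ⊗[k] H} (t : H →ₗ[k] rationalEnd S ρ) : Prop :=
  ∀ h : H, IsCoactionOf ρ (t h : (Module.End S P)ᵐᵒᵖ)
    (((rationalEnd S ρ).val.toLinearMap ∘ₗ t).rTensor H (Coalgebra.comul h))

end Rational

/-! ### Cleavings -/

section Cleft

variable {k H E : Type*} [Field k] [Ring H] [HopfAlgebra k H] [Ring E] [Algebra k E]

/-- `u` is the convolution inverse of `t : H → E`. -/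
def IsConvInverse (t u : H →ₗ[k] E) : Prop :=
  WithConv.toConv t * WithConv.toConv u = 1 ∧ WithConv.toConv u * WithConv.toConv t = 1

/-- `ω_t(h ⊗ e) = t(h₁) e u(h₂)`. -/
def cleftAction (t u : H →ₗ[k] E) (h : H) (e : E) : E :=
  LinearMap.mul' k E (TensorProduct.map (LinearMap.mulRight k e ∘ₗ t) u (Coalgebra.comul h))

/-- A linear map `H → End(Z)`, `h ↦ (z ↦ h · z)`, makes the algebra `Z` a left `H`-module
algebra: it is a module structure with `h · 1 = ε(h) 1` and `h · (z z') = (h₁ · z)(h₂ · z')`. -/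
structure IsModuleAlgebra {Z : Type*} [Ring Z] [Algebra k Z] (act : H →ₗ[k] Module.End k Z) :
    Prop where
  one_act : ∀ z, act 1 z = z
  mul_act : ∀ h h' z, act (h * h') z = act h (act h' z)
  act_one : ∀ h, act h 1 = algebraMap k Z (Coalgebra.counit h)
  act_mul : ∀ h z z', act h (z * z') =
    LinearMap.mul' k Z (TensorProduct.map (act.flip z) (act.flip z') (Coalgebra.comul h))

end Cleft

/-! ### Induced relative Hopf modules -/

section Ind

variable (k H R S M : Type*) [Field k] [Ring H] [HopfAlgebra k H] [Ring S] [Algebra k S]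
  [RightComoduleAlgebra k H S] [Ring R] [Module Rᵐᵒᵖ S] [SMulCommClass S Rᵐᵒᵖ S]
  [AddCommGroup M] [Module k M] [Module R M]

/-- `R` acts on the right of the comodule algebra `S` through coinvariant elements of `S`. -/
class IsCoinvAction : Prop where
  rho_smul_one : ∀ r : R, rho k H S (op r • (1 : S)) = (op r • (1 : S)) ⊗ₜ[k] 1

variable {k R S M} in
/-- Left multiplication by an element of `S` on `S ⊗_R M`. -/
def indMul (s : S) : BTensor k R S M →ₗ[k] BTensor k R S M :=
  BTensor.rTensor (LinearMap.mulLeft k s) (by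
    intro r x
    exact smul_comm s (op r) x)

variable {k R S M} in
theorem indMul_tmul (s x : S) (m : M) :
    indMul s (BTensor.tmul k R x m) = BTensor.tmul k R (s * x) m := rfl

/-- The left `S`-module structure on `S ⊗_R M`. -/
instance indModule : Module S (BTensor k R S M) where
  smul a p := indMul a p
  one_smul p := by
    refine LinearMap.congr_fun (f := indMul 1) (g := LinearMap.id) (BTensor.hom_ext fun x m => ?_) p
    rw [indMul_tmul, one_mul, LinearMap.id_apply]
  mul_smul a b p := by
    refine LinearMap.congr_fun (f := indMul (a * b)) (g := indMul a ∘ₗ indMul b)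
      (BTensor.hom_ext fun x m => ?_) p
    rw [LinearMap.comp_apply, indMul_tmul, indMul_tmul, indMul_tmul, mul_assoc]
  smul_zero a := map_zero (indMul a)
  smul_add a := map_add (indMul a)
  add_smul a b p := by
    refine LinearMap.congr_fun (f := indMul (a + b)) (g := indMul a + indMul b)
      (BTensor.hom_ext fun x m => ?_) p
    rw [LinearMap.add_apply, indMul_tmul, indMul_tmul, indMul_tmul, add_mul]
    simp only [BTensor.tmul, TensorProduct.add_tmul, map_add]
  zero_smul p := by
    refine LinearMap.congr_fun (f := indMul 0) (g := 0) (BTensor.hom_ext fun x m => ?_) p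
    rw [indMul_tmul, zero_mul]
    simp only [BTensor.tmul, TensorProduct.zero_tmul, map_zero, LinearMap.zero_apply]

variable {k R S M} in
theorem ind_smul_tmul (s x : S) (m : M) :
    s • BTensor.tmul k R x m = BTensor.tmul k R (s * x) m := rfl

instance : IsScalarTower k S (BTensor k R S M) where
  smul_assoc c a p := by
    refine LinearMap.congr_fun (f := indMul (c • a)) (g := c • indMul a)
      (BTensor.hom_ext fun x m => ?_) p
    rw [LinearMap.smul_apply, indMul_tmul, indMul_tmul, smul_mul_assoc]
    simp only [BTensor.tmul, ← TensorProduct.smul_tmul', map_smul]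

instance : SMulCommClass S k (BTensor k R S M) where
  smul_comm a c p := (indMul a).map_smul c p

/-- The coaction `x ⊗ m ↦ (x₀ ⊗ m) ⊗ x₁` on `S ⊗_R M`. -/
def indCoact [IsCoinvAction k H R S] : BTensor k R S M →ₗ[k] BTensor k R S M ⊗[k] H :=
  BTensor.lift
    ((BTensor.mk k R S M).rTensor H ∘ₗ (TensorProduct.rightComm k S H M).toLinearMap ∘ₗ
      (rho k H S).toLinearMap.rTensor M) (by
    intro x r m
    have hx : ∀ y : S, op r • y = y * (op r • (1 : S)) := by
      intro y
      have h := smul_comm y (op r) (1 : S)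
      rw [smul_eq_mul, smul_eq_mul, mul_one] at h
      exact h.symm
    simp only [LinearMap.comp_apply, LinearMap.rTensor_tmul, AlgHom.toLinearMap_apply,
      hx x, map_mul, IsCoinvAction.rho_smul_one, LinearEquiv.coe_coe]
    generalize rho k H S x = z
    induction z with
    | zero => simp
    | add x y hx hy => simp only [add_mul, map_add, TensorProduct.add_tmul, hx, hy]
    | tmul y h =>
      simp only [Algebra.TensorProduct.tmul_mul_tmul, mul_one, TensorProduct.rightComm_tmul,
        LinearMap.rTensor_tmul, ← hx]
      exact congrArg (· ⊗ₜ[k] h) (BTensor.tmul_balanced y r m))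

theorem indCoact_tmul [IsCoinvAction k H R S] (x : S) (m : M) :
    indCoact k H R S M (BTensor.tmul k R x m) = (BTensor.mk k R S M).rTensor H
      (TensorProduct.rightComm k S H M (rho k H S x ⊗ₜ[k] m)) := rfl

end Ind

/-! ### Bimodules over `B = A^{co H}` -/

section Env

variable (k H A : Type*) [Field k] [Ring H] [HopfAlgebra k H] [Ring A] [Algebra k A]
  [RightComoduleAlgebra k H A]

/-- The enveloping algebra `B^e = B ⊗ Bᵒᵖ` of `B = A^{co H}`. -/
def Env : Type _ := coinv k H A ⊗[k] (coinv k H A)ᵐᵒᵖ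

instance : Ring (Env k H A) := inferInstanceAs (Ring (coinv k H A ⊗[k] (coinv k H A)ᵐᵒᵖ))

instance : Algebra k (Env k H A) :=
  inferInstanceAs (Algebra k (coinv k H A ⊗[k] (coinv k H A)ᵐᵒᵖ))

/-- A `B`-bimodule is a left `B^e`-module by `(b ⊗ b') m = b m b'`. -/
instance (M : Type*) [AddCommGroup M] [Module k M]
    [Module (coinv k H A) M] [Module (coinv k H A)ᵐᵒᵖ M]
    [IsScalarTower k (coinv k H A) M] [IsScalarTower k (coinv k H A)ᵐᵒᵖ M]
    [SMulCommClass (coinv k H A) (coinv k H A)ᵐᵒᵖ M] : Module (Env k H A) M :=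
  (TensorProduct.Algebra.module : Module (coinv k H A ⊗[k] (coinv k H A)ᵐᵒᵖ) M)

/-- The map `B^e → A ⊗ Aᵒᵖ`, `b ⊗ b' ↦ b ⊗ b'`. -/
def envVal : Env k H A →ₐ[k] A ⊗[k] Aᵐᵒᵖ :=
  Algebra.TensorProduct.map (coinv k H A).val (AlgHom.op (coinv k H A).val)

theorem coactLeft_envVal (e : Env k H A) :
    coactLeft k H A Aᵐᵒᵖ (envVal k H A e) = envVal k H A e ⊗ₜ[k] 1 := by
  have h : ∀ e : coinv k H A ⊗[k] (coinv k H A)ᵐᵒᵖ,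
      (coactLeft k H A Aᵐᵒᵖ).comp (Algebra.TensorProduct.map (coinv k H A).val
        (AlgHom.op (coinv k H A).val)) e = Algebra.TensorProduct.map (coinv k H A).val
        (AlgHom.op (coinv k H A).val) e ⊗ₜ[k] 1 := by
    intro e
    induction e with
    | zero => rw [map_zero, map_zero, TensorProduct.zero_tmul]
    | add x y hx hy => rw [map_add, hx, hy, map_add, TensorProduct.add_tmul]
    | tmul b b' =>
      rw [AlgHom.comp_apply, Algebra.TensorProduct.map_tmul, coactLeft_tmul, Subalgebra.val_apply,
        rho_coinv, TensorProduct.rightComm_tmul]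
  exact h e

theorem coactRight_envVal (e : Env k H A) :
    coactRight A (rhoOp k H A) (envVal k H A e) = envVal k H A e ⊗ₜ[k] 1 := by
  have h : ∀ e : coinv k H A ⊗[k] (coinv k H A)ᵐᵒᵖ,
      (coactRight A (rhoOp k H A)).comp (Algebra.TensorProduct.map (coinv k H A).val
        (AlgHom.op (coinv k H A).val)) e = Algebra.TensorProduct.map (coinv k H A).val
        (AlgHom.op (coinv k H A).val) e ⊗ₜ[k] 1 := by
    intro e
    induction e with
    | zero => rw [map_zero, map_zero, TensorProduct.zero_tmul]
    | add x y hx hy => rw [map_add, hx, hy, map_add, TensorProduct.add_tmul]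
    | tmul b b' =>
      obtain ⟨b', rfl⟩ := op_surjective b'
      have hb : rhoOp k H A (op (b' : A)) = op (b' : A) ⊗ₜ[k] 1 := by
        rw [rhoOp_op, rho_coinv, TensorProduct.map_tmul, HopfAlgebra.antipode_one]
        rfl
      rw [AlgHom.comp_apply, Algebra.TensorProduct.map_tmul, coactRight_tmul,
        AlgHom.op_apply_apply, unop_op, Subalgebra.val_apply, Subalgebra.val_apply, hb,
        TensorProduct.assoc_symm_tmul]
  exact h e

variable {k H A} in
/-- The pure tensor `b ⊗ b'` in `B^e`. -/
def Env.tmul (b b' : coinv k H A) : Env k H A := b ⊗ₜ[k] op b'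

/-- The inclusion `B^e → A^{□e}`, `b ⊗ b' ↦ b ⊗ b'`. -/
def envIncl : Env k H A →ₐ[k] BoxE k H A :=
  (envVal k H A).codRestrict (boxE k H A) (fun e =>
    (coactLeft_envVal k H A e).trans (coactRight_envVal k H A e).symm)

theorem boxVal_envIncl (e : Env k H A) : boxVal k H A (envIncl k H A e) = envVal k H A e := rfl

/-- `A^{□e}` as a right `B^e`-module, by multiplication. -/
instance : Module (Env k H A)ᵐᵒᵖ (BoxE k H A) :=
  Module.compHom (BoxE k H A) (AlgHom.op (envIncl k H A)).toRingHom

variable {k H A} in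
theorem op_env_smul (e : Env k H A) (x : BoxE k H A) : op e • x = x * envIncl k H A e := rfl

instance : SMulCommClass (BoxE k H A) (Env k H A)ᵐᵒᵖ (BoxE k H A) where
  smul_comm a e x := by
    obtain ⟨e, rfl⟩ := op_surjective e
    rw [op_env_smul, op_env_smul, smul_eq_mul, smul_eq_mul, mul_assoc]

instance [Coalgebra.IsCocomm k H] : IsCoinvAction k H (Env k H A) (BoxE k H A) where
  rho_smul_one e := by
    rw [op_env_smul, one_mul]
    apply inclTensor_injective (boxVal k H A) (boxVal_injective k H A)
    rw [inclTensor_rho, boxVal_envIncl, coactLeft_envVal]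
    rfl

end Env

/-- A strict Morita context `(R, R, M, N, α, β)`: two `R`-bimodules `M`, `N` and isomorphisms of
bimodules `α : M ⊗_R N → R` and `β : N ⊗_R M → R` with `α(m ⊗ n) m' = m β(n ⊗ m')` and
`β(n ⊗ m) n' = n α(m ⊗ n')`. Such an `M` is an invertible `R`-bimodule. -/
structure StrictMoritaContext (k R M N : Type*) [CommRing k] [Ring R] [Algebra k R]
    [AddCommGroup M] [Module k M] [Module R M] [Module Rᵐᵒᵖ M]
    [AddCommGroup N] [Module k N] [Module R N] [Module Rᵐᵒᵖ N] where
  α : BTensor k R M N ≃ₗ[k] R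
  β : BTensor k R N M ≃ₗ[k] R
  α_left : ∀ (r : R) (m : M) (n : N),
    α (BTensor.tmul k R (r • m) n) = r * α (BTensor.tmul k R m n)
  α_right : ∀ (r : R) (m : M) (n : N),
    α (BTensor.tmul k R m (op r • n)) = α (BTensor.tmul k R m n) * r
  β_left : ∀ (r : R) (n : N) (m : M),
    β (BTensor.tmul k R (r • n) m) = r * β (BTensor.tmul k R n m)
  β_right : ∀ (r : R) (n : N) (m : M),
    β (BTensor.tmul k R n (op r • m)) = β (BTensor.tmul k R n m) * r
  α_smul : ∀ (m : M) (n : N) (m' : M),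
    α (BTensor.tmul k R m n) • m' = op (β (BTensor.tmul k R n m')) • m
  β_smul : ∀ (n : N) (m : M) (n' : N),
    β (BTensor.tmul k R n m) • n' = op (α (BTensor.tmul k R m n')) • n

section Stable

variable (k H A : Type*) [Field k] [Ring H] [HopfAlgebra k H] [Coalgebra.IsCocomm k H]
  [Ring A] [Algebra k A] [RightComoduleAlgebra k H A]
variable (M : Type*) [AddCommGroup M] [Module k M]
  [Module (coinv k H A) M] [Module (coinv k H A)ᵐᵒᵖ M]
  [IsScalarTower k (coinv k H A) M] [IsScalarTower k (coinv k H A)ᵐᵒᵖ M]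
  [SMulCommClass (coinv k H A) (coinv k H A)ᵐᵒᵖ M]

/-- The relative Hopf module `A^{□e} ⊗_{B^e} M`. -/
abbrev BoxInd : Type _ := BTensor k (Env k H A) (BoxE k H A) M

/-- The coaction of `A^{□e} ⊗_{B^e} M`. -/
abbrev boxIndCoact : BoxInd k H A M →ₗ[k] BoxInd k H A M ⊗[k] H :=
  indCoact k H (Env k H A) (BoxE k H A) M

/-- The comodule algebra `E = END_{A^{□e}}(A^{□e} ⊗_{B^e} M)ᵒᵖ`. -/
abbrev EndBox : Subalgebra k (Module.End (BoxE k H A) (BoxInd k H A M))ᵐᵒᵖ :=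
  rationalEnd (BoxE k H A) (boxIndCoact k H A M)

/-- The subalgebra `E^{co H}` of `E`. -/
abbrev EndBoxCoinv : Subalgebra k (EndBox k H A M) :=
  rationalCoinv (BoxE k H A) (boxIndCoact k H A M)

variable {k H A M}

/-- `φ : A^{□e} ⊗_{B^e} M → M ⊗ H` is an isomorphism of `B`-bimodules and right `H`-comodules,
where `b (m ⊗ h) b' = b m b' ⊗ h` and `ρ(m ⊗ h) = m ⊗ h₁ ⊗ h₂`. -/
structure IsStabilityIso (φ : BoxInd k H A M ≃ₗ[k] M ⊗[k] H) : Prop where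
  bilinear : ∀ (b b' : coinv k H A) (p : BoxInd k H A M),
    φ (envIncl k H A (Env.tmul b b') • p) = b • op b' • φ p
  colinear : ∀ p : BoxInd k H A M,
    TensorProduct.assoc k M H H (φ.toLinearMap.rTensor H (boxIndCoact k H A M p)) =
      (Coalgebra.comul : H →ₗ[k] H ⊗[k] H).lTensor M (φ p)

variable (k H A M) in
/-- The `B`-bimodule `M` is `H`-stable. -/
def IsHStable : Prop := ∃ φ : BoxInd k H A M ≃ₗ[k] M ⊗[k] H, IsStabilityIso φ

end Stable

end

end HopfGalois

open HopfGalois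

open scoped TensorProduct
open MulOpposite
open HopfGalois

/-! Write `l(h) ⊗ r(h) = can⁻¹(1 ⊗ h)` and `x • h = l(h) x r(h)`. Since `can` is left `A`-linear and
`can(1 ⊗ a) = a₀ ⊗ a₁`, one has `a₀ l(a₁) ⊗ r(a₁) = 1 ⊗ a`. Hence `h ↦ x • h` is the only linear map
with `a₀ (x • a₁) = x a` for all `a` (`convAct_mu_rho`, `mu_eq_of_convAct_rho`), and the properties
of the Miyashita–Ulbrich action are identities that can be checked after pairing with `ρ(a)`. With
`h · x = x • S(h)` this yields `a x = (a₁ · x) a₀` (`mul_center_eq`), hence `y (x ⊗ 1) = ((y₁ · x) ⊗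
1) y₀` in `A^{□e}` and `λ_x(p) = (p₁ · x) p₀` on `P_M` (`unop_centerEnd`).

The last formula gives the third assertion. If `t` is colinear, then `λ_x(t(h)(p)) = (p₁ h₂ · x)
t(h₁)(p₀) = t(h₁)(λ_{h₂ · x}(p))`. In `E`, with its opposite product and by cocommutativity, this
reads `t(h) λ_x = λ_{h₁ · x} t(h₂)` (`mulRight_centerEnd_comp`). Convolution with `u` on the right
leaves `λ_{h · x}`, whatever `t` and `M` are.

For cleftness, `(t * f)(h)(1 ⊗ m) = f(p₁)(p₀)` with `p = φ⁻¹(m ⊗ h)`, so a convolution inverse `u`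
of `t` has to satisfy `u(p₁)(p₀) = 1 ⊗ (M ⊗ ε)φ(p)`. If `A^{□e}` is a Galois extension of `B^e`,
this has exactly one solution, built from the inverse of the canonical map of `A^{□e}`
(`cocleaving`).

The bulk of the work is therefore `canBox_bijective`. The space `A ⊗ Aᵒᵖ` with the codiagonal
coaction is a Hopf module over `A` whose coinvariants are `A^{□e}` (`codiag_eq_iff`), so the
structure theorem `coinvMul_bijective` gives `A^{□e} ⊗_B A ≅ A ⊗ Aᵒᵖ`. After `- ⊗_B A` the canonical
map of `A^{□e}` becomes that of `A`, tensored with `Aᵒᵖ`; this is bijective, and faithful flatness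
descends the bijectivity.

For the first assertion, injectivity of `t(1)` forces the coinvariants of `P_M` to be `1 ⊗ M`. A
coinvariant endomorphism therefore comes from a bimodule endomorphism of `M`, and the Morita context
makes the latter multiplication by a unique central element. -/

namespace HopfGalois

noncomputable section

universe v

/-! ### Testing maps on `H` against a coaction -/

section ConvAct

variable {k H S W : Type*} [Field k] [Ring H] [HopfAlgebra k H] [Ring S] [Algebra k S]
  [AddCommGroup W] [Module k W]

/-- `s ⊗ h ↦ s · f(h)`, for an algebra `S` acting on `W` through `π`. -/
def convAct (π : S →ₐ[k] Module.End k W) (f : H →ₗ[k] W) : S ⊗[k] H →ₗ[k] W :=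
  TensorProduct.lift (LinearMap.compl₂ π.toLinearMap f)

theorem convAct_tmul (π : S →ₐ[k] Module.End k W) (f : H →ₗ[k] W) (s : S) (h : H) :
    convAct π f (s ⊗ₜ[k] h) = π s (f h) := rfl

theorem convAct_tmul_one_mul (π : S →ₐ[k] Module.End k W) (f : H →ₗ[k] W) (s : S)
    (z : S ⊗[k] H) : convAct π f ((s ⊗ₜ[k] 1) * z) = π s (convAct π f z) := by
  induction z with
  | zero => simp
  | add x y hx hy => simp only [mul_add, map_add, hx, hy]
  | tmul a h => simp [convAct_tmul]

variable [RightComoduleAlgebra k H S] {R : Type*} [Ring R] [Module Rᵐᵒᵖ S] [Module R S]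

/-- A map on `H` is determined by the values `s₀ · f(s₁)` if the canonical map is surjective. -/
theorem eq_of_convAct_rho (c : BTensor k R S S →ₗ[k] S ⊗[k] H)
    (hc : ∀ s s', c (BTensor.tmul k R s s') = (s ⊗ₜ[k] 1) * rho k H S s')
    (hsurj : Function.Surjective c) (π : S →ₐ[k] Module.End k W) {f g : H →ₗ[k] W}
    (hfg : ∀ s, convAct π f (rho k H S s) = convAct π g (rho k H S s)) : f = g := by
  have key : ∀ z, convAct π f (c z) = convAct π g (c z) := by
    intro z
    refine LinearMap.congr_fun (f := convAct π f ∘ₗ c) (g := convAct π g ∘ₗ c)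
      (BTensor.hom_ext fun s s' => ?_) z
    simp only [LinearMap.comp_apply, hc, convAct_tmul_one_mul, hfg]
  refine LinearMap.ext fun h => ?_
  obtain ⟨z, hz⟩ := hsurj (1 ⊗ₜ[k] h)
  have := key z
  rw [hz, convAct_tmul, convAct_tmul, map_one] at this
  exact this

/-- An `S`-linear map `L` on `S ⊗_R S` induces a map `v` on `H` with `s₀ · v(s₁) = L(1 ⊗ s)`
if the canonical map is bijective. -/
theorem convAct_rho_of_equiv (e : BTensor k R S S ≃ₗ[k] S ⊗[k] H)
    (he : ∀ s s', e (BTensor.tmul k R s s') = (s ⊗ₜ[k] 1) * rho k H S s')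
    (π : S →ₐ[k] Module.End k W) (L : BTensor k R S S →ₗ[k] W)
    (hL : ∀ s s' s'', L (BTensor.tmul k R (s * s') s'') = π s (L (BTensor.tmul k R s' s'')))
    (s : S) :
    convAct π (L ∘ₗ e.symm.toLinearMap ∘ₗ TensorProduct.mk k S H 1) (rho k H S s) =
      L (BTensor.tmul k R 1 s) := by
  have h1 : ∀ (a : S) (z : S ⊗[k] H), L (e.symm ((a ⊗ₜ[k] 1) * z)) = π a (L (e.symm z)) := by
    intro a z
    obtain ⟨w, rfl⟩ := e.surjective z
    obtain ⟨w, rfl⟩ := BTensor.mk_surjective w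
    induction w with
    | zero => simp
    | add x y hx hy => simp only [map_add, mul_add, hx, hy]
    | tmul x y =>
      change L (e.symm (_ * e (BTensor.tmul k R x y))) = π a (L (e.symm (e (BTensor.tmul k R x y))))
      rw [e.symm_apply_apply, ← hL, he, ← mul_assoc, Algebra.TensorProduct.tmul_mul_tmul, one_mul,
        ← he, e.symm_apply_apply]
  have h2 : ∀ z : S ⊗[k] H,
      convAct π (L ∘ₗ e.symm.toLinearMap ∘ₗ TensorProduct.mk k S H 1) z = L (e.symm z) := by
    intro z
    induction z with
    | zero => simp
    | add x y hx hy => simp only [map_add, hx, hy]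
    | tmul a h =>
      rw [convAct_tmul]
      change π a (L (e.symm (1 ⊗ₜ h))) = _
      rw [← h1, Algebra.TensorProduct.tmul_mul_tmul, mul_one, one_mul]
  rw [h2, ← one_mul (rho k H S s), Algebra.TensorProduct.one_def, ← he, e.symm_apply_apply]

end ConvAct

/-! ### Coassociativity and cocommutativity -/

section Coassoc

variable {k H A : Type*} [Field k] [Ring H] [HopfAlgebra k H]
  [Ring A] [Algebra k A] [RightComoduleAlgebra k H A]

theorem rho_rho (a : A) :
    (rho k H A).toLinearMap.rTensor H (rho k H A a) = (TensorProduct.assoc k A H H).symm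
      ((Coalgebra.comul : H →ₗ[k] H ⊗[k] H).lTensor A (rho k H A a)) := by
  rw [← RightComoduleAlgebra.coassoc, LinearEquiv.symm_apply_apply]

variable [Coalgebra.IsCocomm k H]

/-- By coassociativity the last two legs of `a₀ ⊗ a₁ ⊗ a₂` come from a comultiplication, which
cocommutativity makes symmetric. -/
theorem rho_rho_symm (a : A) :
    TensorProduct.rightComm k A H H ((rho k H A).toLinearMap.rTensor H (rho k H A a)) =
      (rho k H A).toLinearMap.rTensor H (rho k H A a) := by
  have h3 : ∀ z : A ⊗[k] (H ⊗[k] H), TensorProduct.rightComm k A H H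
      ((TensorProduct.assoc k A H H).symm z) = (TensorProduct.assoc k A H H).symm
        ((TensorProduct.comm k H H).toLinearMap.lTensor A z) := by
    intro z
    induction z with
    | zero => simp
    | add x y hx hy => simp only [map_add, hx, hy]
    | tmul y w =>
      induction w with
      | zero => simp
      | add x y hx hy => simp only [map_add, TensorProduct.tmul_add, hx, hy]
      | tmul g f => simp
  rw [rho_rho, h3, ← LinearMap.lTensor_comp_apply, Coalgebra.comm_comp_comul]

/-- `S(h₂) h₁ = ε(h)`, by cocommutativity. -/
theorem mul_antipode_comm_comul (h : H) :
    LinearMap.mul' k H ((HopfAlgebra.antipode k : H →ₗ[k] H).rTensor H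
      (TensorProduct.comm k H H (Coalgebra.comul h))) = algebraMap k H (Coalgebra.counit h) := by
  rw [Coalgebra.comm_comul, HopfAlgebra.mul_antipode_rTensor_comul_apply]

end Coassoc

/-! ### The Miyashita–Ulbrich action -/

section MiyashitaUlbrich

variable {k H A : Type*} [Field k] [Ring H] [HopfAlgebra k H]
  [Ring A] [Algebra k A] [RightComoduleAlgebra k H A]

/-- The canonical isomorphism `A ⊗_B A ≃ A ⊗ H` of a Galois extension. -/
def canEquiv (hA : IsFaithfullyFlatGalois k H A) :
    BTensor k (coinv k H A) A A ≃ₗ[k] A ⊗[k] H :=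
  LinearEquiv.ofBijective (can k H A) hA.can_bijective

theorem canEquiv_tmul (hA : IsFaithfullyFlatGalois k H A) (a a' : A) :
    canEquiv hA (BTensor.tmul k (coinv k H A) a a') = (a ⊗ₜ[k] 1) * rho k H A a' := rfl

/-- `h ↦ ∑ lᵢ(h) x rᵢ(h)`. -/
def mu (hA : IsFaithfullyFlatGalois k H A) (x : Subalgebra.center k (coinv k H A)) : H →ₗ[k] A :=
  sandwich x ∘ₗ (canEquiv hA).symm.toLinearMap ∘ₗ TensorProduct.mk k A H 1

variable (hA : IsFaithfullyFlatGalois k H A)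

/-- The element `a₀ ⊗ a₁` is `can(1 ⊗ a)`, and the sandwich map sends `1 ⊗ a` to `x a`. This
identity characterises `mu` and is all that is used about it from here on. -/
theorem convAct_mu_rho (x : Subalgebra.center k (coinv k H A)) (a : A) :
    convAct (Algebra.lmul k A) (mu hA x) (rho k H A a) = ((x : coinv k H A) : A) * a := by
  have := convAct_rho_of_equiv (canEquiv hA) (canEquiv_tmul hA) (Algebra.lmul k A) (sandwich x)
    (by intro s s' s''; simp [sandwich_tmul, mul_assoc]) a
  rw [sandwich_tmul, one_mul] at this
  exact this

theorem eq_of_convAct_rho_galois (hA : IsFaithfullyFlatGalois k H A) {W : Type*} [AddCommGroup W] [Module k W]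
    (π : A →ₐ[k] Module.End k W) {f g : H →ₗ[k] W}
    (hfg : ∀ a, convAct π f (rho k H A a) = convAct π g (rho k H A a)) : f = g :=
  eq_of_convAct_rho (canEquiv hA).toLinearMap (canEquiv_tmul hA) (canEquiv hA).surjective π hfg

/-- Uniqueness in the characterisation; it replaces computations with representatives of `can⁻¹(1 ⊗
h)`. -/
theorem mu_eq_of_convAct_rho (x : Subalgebra.center k (coinv k H A)) {f : H →ₗ[k] A}
    (hf : ∀ a, convAct (Algebra.lmul k A) f (rho k H A a) = ((x : coinv k H A) : A) * a) :
    f = mu hA x :=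
  eq_of_convAct_rho_galois hA (Algebra.lmul k A) fun a => by rw [hf, convAct_mu_rho]

/-- Paired with `ρ(a)`, both sides become `x a b`: one directly, the other because `a₀ b ⊗ a₁ = ρ(a
b)` for coinvariant `b`. -/
theorem mu_mem_center (x : Subalgebra.center k (coinv k H A)) (h : H) (b : coinv k H A) :
    (b : A) * mu hA x h = mu hA x h * (b : A) := by
  have h1 : LinearMap.mulRight k (b : A) ∘ₗ mu hA x = LinearMap.mulLeft k (b : A) ∘ₗ mu hA x := by
    refine eq_of_convAct_rho_galois hA (Algebra.lmul k A) fun a => ?_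
    have e1 : ∀ z : A ⊗[k] H, convAct (Algebra.lmul k A) (LinearMap.mulRight k (b : A) ∘ₗ mu hA x) z
        = convAct (Algebra.lmul k A) (mu hA x) z * b := by
      intro z
      induction z with
      | zero => simp
      | add x y hx hy => simp only [map_add, add_mul, hx, hy]
      | tmul a h => simp [convAct_tmul, mul_assoc]
    have e2 : ∀ z : A ⊗[k] H, convAct (Algebra.lmul k A) (LinearMap.mulLeft k (b : A) ∘ₗ mu hA x) z
        = convAct (Algebra.lmul k A) (mu hA x) (z * (b : A) ⊗ₜ[k] 1) := by
      intro z
      induction z with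
      | zero => simp
      | add x y hx hy => simp only [map_add, add_mul, hx, hy]
      | tmul a h => simp [convAct_tmul, mul_assoc]
    rw [e1, e2, ← rho_coinv, ← map_mul, convAct_mu_rho, convAct_mu_rho, mul_assoc]
  exact (LinearMap.congr_fun h1 h).symm

theorem mu_one_right (x : Subalgebra.center k (coinv k H A)) : mu hA x 1 = (x : coinv k H A) := by
  have h := convAct_mu_rho hA x 1
  rwa [map_one, Algebra.TensorProduct.one_def, convAct_tmul, map_one, mul_one] at h

theorem mu_one_left (h : H) : mu hA 1 h = algebraMap k A (Coalgebra.counit h) := by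
  have h1 : Algebra.linearMap k A ∘ₗ Coalgebra.counit = mu hA 1 := by
    refine mu_eq_of_convAct_rho hA 1 fun a => ?_
    have e : ∀ z : A ⊗[k] H, convAct (Algebra.lmul k A)
        (Algebra.linearMap k A ∘ₗ Coalgebra.counit) z =
        TensorProduct.rid k A ((Coalgebra.counit : H →ₗ[k] k).lTensor A z) := by
      intro z
      induction z with
      | zero => simp
      | add x y hx hy => simp only [map_add, hx, hy]
      | tmul a h => simp [convAct_tmul, Algebra.smul_def, Algebra.commutes]
    rw [e, RightComoduleAlgebra.counit]
    simp
  exact (LinearMap.congr_fun h1 h).symm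

/-- By coassociativity `a₀ (x • a₁)(y • a₂) = x a₀ (y • a₁) = x y a`, so the convolution product
passes the test for `x y`. -/
theorem mu_mul_left (x y : Subalgebra.center k (coinv k H A)) (h : H) :
    mu hA (x * y) h =
      LinearMap.mul' k A (TensorProduct.map (mu hA x) (mu hA y) (Coalgebra.comul h)) := by
  have h1 : LinearMap.mul' k A ∘ₗ TensorProduct.map (mu hA x) (mu hA y) ∘ₗ Coalgebra.comul =
      mu hA (x * y) := by
    refine mu_eq_of_convAct_rho hA _ fun a => ?_
    have e1 : ∀ z : A ⊗[k] H, convAct (Algebra.lmul k A)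
        (LinearMap.mul' k A ∘ₗ TensorProduct.map (mu hA x) (mu hA y) ∘ₗ Coalgebra.comul) z =
        LinearMap.mul' k A (TensorProduct.map (convAct (Algebra.lmul k A) (mu hA x)) (mu hA y)
          ((TensorProduct.assoc k A H H).symm
            ((Coalgebra.comul : H →ₗ[k] H ⊗[k] H).lTensor A z))) := by
      intro z
      induction z with
      | zero => simp
      | add x y hx hy => simp only [map_add, hx, hy]
      | tmul a h =>
        rw [convAct_tmul, LinearMap.lTensor_tmul]
        simp only [LinearMap.comp_apply]
        generalize (Coalgebra.comul h : H ⊗[k] H) = w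
        induction w with
        | zero => simp
        | add x y hx hy => simp only [map_add, TensorProduct.tmul_add, hx, hy]
        | tmul g f => simp [convAct_tmul, mul_assoc]
    have e2 : ∀ z : A ⊗[k] H, LinearMap.mul' k A (TensorProduct.map
        (convAct (Algebra.lmul k A) (mu hA x)) (mu hA y)
          ((rho k H A).toLinearMap.rTensor H z)) =
        ((x : coinv k H A) : A) * convAct (Algebra.lmul k A) (mu hA y) z := by
      intro z
      induction z with
      | zero => simp
      | add x y hx hy => simp only [map_add, mul_add, hx, hy]
      | tmul a h => simp [convAct_tmul, convAct_mu_rho, mul_assoc]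
    rw [e1, ← rho_rho, e2, convAct_mu_rho, ← mul_assoc]
    rfl
  exact (LinearMap.congr_fun h1 h).symm

/-- `x • h` commutes past `a` as `(x • h) a = a₀ (x • (h a₁))`. -/
theorem convAct_mu_mulLeft_rho (x : Subalgebra.center k (coinv k H A)) (h : H) (a : A) :
    convAct (Algebra.lmul k A) (mu hA x ∘ₗ LinearMap.mulLeft k h) (rho k H A a) =
      mu hA x h * a := by
  -- Both sides are functions of `h`. Paired with `ρ(a')` they become `(a' a)₀ (x • (a' a)₁) = x a'
  -- a` and `a'₀ (x • a'₁) a = x a' a`.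
  have h1 : convAct (Algebra.lmul k A) (mu hA x) ∘ₗ LinearMap.mulRight k (rho k H A a) ∘ₗ
      (Algebra.TensorProduct.includeRight : H →ₐ[k] A ⊗[k] H).toLinearMap =
      LinearMap.mulRight k a ∘ₗ mu hA x := by
    refine eq_of_convAct_rho_galois hA (Algebra.lmul k A) fun a' => ?_
    have e1 : ∀ z : A ⊗[k] H, convAct (Algebra.lmul k A) (convAct (Algebra.lmul k A) (mu hA x) ∘ₗ
        LinearMap.mulRight k (rho k H A a) ∘ₗ
        (Algebra.TensorProduct.includeRight : H →ₐ[k] A ⊗[k] H).toLinearMap) z =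
        convAct (Algebra.lmul k A) (mu hA x) (z * rho k H A a) := by
      intro z
      induction z with
      | zero => simp
      | add x y hx hy => simp only [map_add, add_mul, hx, hy]
      | tmul a h =>
        rw [convAct_tmul, ← mul_one a, ← one_mul h, ← Algebra.TensorProduct.tmul_mul_tmul,
          mul_assoc (a ⊗ₜ[k] (1 : H)), convAct_tmul_one_mul]
        simp
    have e2 : ∀ z : A ⊗[k] H, convAct (Algebra.lmul k A) (LinearMap.mulRight k a ∘ₗ mu hA x) z =
        convAct (Algebra.lmul k A) (mu hA x) z * a := by
      intro z
      induction z with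
      | zero => simp
      | add x y hx hy => simp only [map_add, add_mul, hx, hy]
      | tmul a h => simp [convAct_tmul, mul_assoc]
    rw [e1, e2, ← map_mul, convAct_mu_rho, convAct_mu_rho, mul_assoc]
  have h2 : ∀ z : A ⊗[k] H, convAct (Algebra.lmul k A) (mu hA x ∘ₗ LinearMap.mulLeft k h) z =
      convAct (Algebra.lmul k A) (mu hA x) ((1 ⊗ₜ[k] h) * z) := by
    intro z
    induction z with
    | zero => simp
    | add x y hx hy => simp only [map_add, mul_add, hx, hy]
    | tmul a h => simp [convAct_tmul]
  rw [h2]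
  exact LinearMap.congr_fun h1 h

variable [Coalgebra.IsCocomm k H]

/-- The test is carried out in `A ⊗ H`, on which `A` acts through `ρ`. On one side `ρ(a₀ (x • a₁)) =
ρ(x a) = (x ⊗ 1) ρ(a)`; on the other `a₀ (x • a₂) ⊗ a₁`, which by cocommutativity is `a₀ (x • a₁) ⊗
a₂ = x a₀ ⊗ a₁`. -/
theorem mu_mem_coinv (x : Subalgebra.center k (coinv k H A)) (h : H) :
    mu hA x h ∈ coinv k H A := by
  have h1 : (rho k H A).toLinearMap ∘ₗ mu hA x =
      (Algebra.TensorProduct.includeLeft : A →ₐ[k] A ⊗[k] H).toLinearMap ∘ₗ mu hA x := by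
    refine eq_of_convAct_rho_galois hA ((Algebra.lmul k (A ⊗[k] H)).comp (rho k H A)) fun a => ?_
    have e1 : ∀ z : A ⊗[k] H, convAct ((Algebra.lmul k (A ⊗[k] H)).comp (rho k H A))
        ((rho k H A).toLinearMap ∘ₗ mu hA x) z =
        rho k H A (convAct (Algebra.lmul k A) (mu hA x) z) := by
      intro z
      induction z with
      | zero => simp
      | add x y hx hy => simp only [map_add, hx, hy]
      | tmul a h => simp [convAct_tmul]
    have e2 : ∀ z : A ⊗[k] H, convAct ((Algebra.lmul k (A ⊗[k] H)).comp (rho k H A))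
        ((Algebra.TensorProduct.includeLeft : A →ₐ[k] A ⊗[k] H).toLinearMap ∘ₗ mu hA x) z =
        (convAct (Algebra.lmul k A) (mu hA x)).rTensor H
          (TensorProduct.rightComm k A H H ((rho k H A).toLinearMap.rTensor H z)) := by
      intro z
      induction z with
      | zero => simp
      | add x y hx hy => simp only [map_add, hx, hy]
      | tmul a h =>
        simp only [convAct_tmul, AlgHom.comp_apply, LinearMap.comp_apply, LinearMap.rTensor_tmul,
          AlgHom.toLinearMap_apply, Algebra.TensorProduct.includeLeft_apply]
        generalize rho k H A a = w
        induction w with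
        | zero => simp
        | add x y hx hy => simp only [map_add, TensorProduct.add_tmul, LinearMap.add_apply, hx, hy]
        | tmul b g => simp [convAct_tmul]
    have e3 : ∀ z : A ⊗[k] H, (convAct (Algebra.lmul k A) (mu hA x)).rTensor H
          ((rho k H A).toLinearMap.rTensor H z) = (((x : coinv k H A) : A) ⊗ₜ[k] 1) * z := by
      intro z
      induction z with
      | zero => simp
      | add x y hx hy => simp only [map_add, mul_add, hx, hy]
      | tmul a h => simp [convAct_mu_rho]
    rw [e1, e2, rho_rho_symm, e3, convAct_mu_rho, map_mul, rho_coinv]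
  exact LinearMap.congr_fun h1 h

/-- The right Miyashita-Ulbrich action on the center. -/
def muCenter (h : H) : Subalgebra.center k (coinv k H A) →ₗ[k] Subalgebra.center k (coinv k H A) where
  toFun x := ⟨⟨mu hA x h, mu_mem_coinv hA x h⟩,
    Subalgebra.mem_center_iff.2 fun b => Subtype.ext (mu_mem_center hA x h b)⟩
  map_add' x y := by
    refine Subtype.ext (Subtype.ext ?_)
    have h1 : mu hA x + mu hA y = mu hA (x + y) := by
      refine mu_eq_of_convAct_rho hA _ fun a => ?_
      have e : ∀ z : A ⊗[k] H, convAct (Algebra.lmul k A) (mu hA x + mu hA y) z =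
          convAct (Algebra.lmul k A) (mu hA x) z + convAct (Algebra.lmul k A) (mu hA y) z := by
        intro z
        induction z with
        | zero => simp
        | add x y hx hy => simp only [map_add, hx, hy]; abel
        | tmul a h => simp [convAct_tmul, mul_add]
      rw [e, convAct_mu_rho, convAct_mu_rho, ← add_mul]
      rfl
    exact (LinearMap.congr_fun h1 h).symm
  map_smul' c x := by
    refine Subtype.ext (Subtype.ext ?_)
    have h1 : c • mu hA x = mu hA (c • x) := by
      refine mu_eq_of_convAct_rho hA _ fun a => ?_
      have e : ∀ z : A ⊗[k] H, convAct (Algebra.lmul k A) (c • mu hA x) z =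
          c • convAct (Algebra.lmul k A) (mu hA x) z := by
        intro z
        induction z with
        | zero => simp
        | add x y hx hy => simp only [map_add, hx, hy, smul_add]
        | tmul a h => simp [convAct_tmul]
      rw [e, convAct_mu_rho, ← smul_mul_assoc]
      rfl
    exact (LinearMap.congr_fun h1 h).symm

theorem coe_muCenter (h : H) (x : Subalgebra.center k (coinv k H A)) :
    ((muCenter hA h x : coinv k H A) : A) = mu hA x h := rfl

/-- The map `h' ↦ x • (h h')` passes the test that characterises the action on `x • h`, by
`convAct_mu_mulLeft_rho`. -/
theorem mu_mul_right (x : Subalgebra.center k (coinv k H A)) (h h' : H) :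
    mu hA x (h * h') = mu hA (muCenter hA h x) h' := by
  have h1 : mu hA x ∘ₗ LinearMap.mulLeft k h = mu hA (muCenter hA h x) :=
    mu_eq_of_convAct_rho hA _ fun a => convAct_mu_mulLeft_rho hA x h a
  exact LinearMap.congr_fun h1 h'

/-- In the convolution algebra of maps `H → H ⊗ H`, `Δ ∘ S` is a left inverse of `Δ` because `Δ` is
an algebra map, and `(S ⊗ S) ∘ Δ` is a right inverse because, `H` being cocommutative, `Δ` is a
coalgebra map. -/
theorem comul_antipode (h : H) :
    (Coalgebra.comul (HopfAlgebra.antipode k h) : H ⊗[k] H) =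
      TensorProduct.map (HopfAlgebra.antipode k) (HopfAlgebra.antipode k) (Coalgebra.comul h) := by
  have h1 : WithConv.toConv ((Coalgebra.comul : H →ₗ[k] H ⊗[k] H) ∘ₗ HopfAlgebra.antipode k) *
      WithConv.toConv (Coalgebra.comul : H →ₗ[k] H ⊗[k] H) = 1 := by
    have := (LinearMap.algHom_comp_convMul_distrib
      (Bialgebra.comulAlgHom k H)
      (WithConv.toConv (HopfAlgebra.antipode k (A := H))) (WithConv.toConv LinearMap.id))
    rw [LinearMap.antipode_mul_id] at this
    apply WithConv.ofConv_injective
    refine Eq.trans this.symm (LinearMap.ext fun x => ?_)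
    simp
  have h2 : WithConv.toConv (Coalgebra.comul : H →ₗ[k] H ⊗[k] H) *
      WithConv.toConv ((HopfAlgebra.antipode k (A := H ⊗[k] H)) ∘ₗ Coalgebra.comul) = 1 := by
    have := (LinearMap.convMul_comp_coalgHom_distrib
      (WithConv.toConv LinearMap.id) (WithConv.toConv (HopfAlgebra.antipode k (A := H ⊗[k] H)))
      (Bialgebra.comulBialgHom k H).toCoalgHom)
    rw [LinearMap.id_mul_antipode] at this
    apply WithConv.ofConv_injective
    refine Eq.trans this.symm (LinearMap.ext fun x => ?_)
    simp
  have h3 := left_inv_eq_right_inv h1 h2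
  exact LinearMap.congr_fun (congrArg WithConv.ofConv h3) h

/-- The left Miyashita-Ulbrich action on the center. -/
def muAct : H →ₗ[k] Module.End k (Subalgebra.center k (coinv k H A)) where
  toFun h := muCenter hA (HopfAlgebra.antipode k h)
  map_add' g h := by
    refine LinearMap.ext fun x => Subtype.ext (Subtype.ext ?_)
    simp [coe_muCenter]
  map_smul' c h := by
    refine LinearMap.ext fun x => Subtype.ext (Subtype.ext ?_)
    simp [coe_muCenter]

theorem coe_muAct (h : H) (x : Subalgebra.center k (coinv k H A)) :
    ((muAct hA h x : coinv k H A) : A) = mu hA x (HopfAlgebra.antipode k h) := rfl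

/-- The antipode reverses products and, by cocommutativity, preserves coproducts, so it turns the
right action `x • h` into a left module algebra structure. -/
theorem isModuleAlgebra_muAct : IsModuleAlgebra (muAct hA) where
  one_act x := Subtype.ext (Subtype.ext (by
    rw [coe_muAct, HopfAlgebra.antipode_one, mu_one_right]))
  mul_act h h' x := Subtype.ext (Subtype.ext (by
    rw [coe_muAct, HopfAlgebra.antipode_mul_antidistrib, mu_mul_right]
    rfl))
  act_one h := Subtype.ext (Subtype.ext (by
    rw [coe_muAct, mu_one_left, HopfAlgebra.counit_antipode]
    rfl))
  act_mul h x y := Subtype.ext (Subtype.ext (by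
    rw [coe_muAct, mu_mul_left, comul_antipode]
    generalize (Coalgebra.comul h : H ⊗[k] H) = w
    induction w with
    | zero => simp
    | add x y hx hy => simp only [map_add, hx, hy]; rfl
    | tmul g f => rfl))

/-- `a x = (a₁ · x) a₀`. -/
theorem mul_center_eq (x : Subalgebra.center k (coinv k H A)) (a : A) :
    LinearMap.mul' k A (TensorProduct.comm k A A
      ((mu hA x ∘ₗ HopfAlgebra.antipode k).lTensor A (rho k H A a))) =
    a * ((x : coinv k H A) : A) := by
  -- `J` sends `a ⊗ g ⊗ h` to `a (x • (S(h) g))`. Moving `a₀` to the left of `x • S(a₁)` produces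
  -- `a₀ (x • (S(a₂) a₁))`, and `S(a₂) a₁` collapses by cocommutativity.
  let J : (A ⊗[k] H) ⊗[k] H →ₗ[k] A := LinearMap.mul' k A ∘ₗ LinearMap.lTensor A (mu hA x ∘ₗ
    LinearMap.mul' k H ∘ₗ (HopfAlgebra.antipode k : H →ₗ[k] H).rTensor H ∘ₗ
    (TensorProduct.comm k H H).toLinearMap) ∘ₗ (TensorProduct.assoc k A H H).toLinearMap
  have e1 : ∀ z : A ⊗[k] H, LinearMap.mul' k A (TensorProduct.comm k A A
      ((mu hA x ∘ₗ HopfAlgebra.antipode k).lTensor A z)) =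
      J ((rho k H A).toLinearMap.rTensor H z) := by
    intro z
    induction z with
    | zero => simp
    | add x y hx hy => simp only [map_add, hx, hy]
    | tmul a h =>
      simp only [LinearMap.lTensor_tmul, TensorProduct.comm_tmul, LinearMap.mul'_apply,
        LinearMap.comp_apply, LinearMap.rTensor_tmul, AlgHom.toLinearMap_apply,
        ← convAct_mu_mulLeft_rho]
      generalize rho k H A a = w
      induction w with
      | zero => simp
      | add x y hx hy => simp only [map_add, TensorProduct.add_tmul, hx, hy]
      | tmul b g => simp [J, convAct_tmul]
  have e2 : ∀ z : A ⊗[k] H, J ((TensorProduct.assoc k A H H).symm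
      ((Coalgebra.comul : H →ₗ[k] H ⊗[k] H).lTensor A z)) =
      LinearMap.mulRight k ((x : coinv k H A) : A)
        (TensorProduct.rid k A ((Coalgebra.counit : H →ₗ[k] k).lTensor A z)) := by
    intro z
    induction z with
    | zero => simp
    | add x y hx hy => simp only [map_add, hx, hy]
    | tmul a h =>
      simp only [J, LinearMap.lTensor_tmul, LinearMap.comp_apply, LinearEquiv.coe_coe,
        LinearEquiv.apply_symm_apply, mul_antipode_comm_comul, LinearMap.mul'_apply,
        Algebra.algebraMap_eq_smul_one, map_smul, mu_one_right]
      simp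
  rw [e1, rho_rho, e2, RightComoduleAlgebra.counit]
  simp

end MiyashitaUlbrich

/-! ### Balanced tensor products and right exactness -/

section Balanced

variable {k : Type*} [CommRing k] {R : Type*} [Ring R]

theorem BTensor.rTensor_rTensor {X X' X'' Y : Type*} [AddCommGroup X] [Module k X]
    [Module Rᵐᵒᵖ X] [AddCommGroup X'] [Module k X'] [Module Rᵐᵒᵖ X'] [AddCommGroup X'']
    [Module k X''] [Module Rᵐᵒᵖ X''] [AddCommGroup Y] [Module k Y] [Module R Y]
    (f : X →ₗ[k] X') (hf : ∀ (r : R) (x : X), f (op r • x) = op r • f x)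
    (g : X' →ₗ[k] X'') (hg : ∀ (r : R) (x : X'), g (op r • x) = op r • g x)
    (z : BTensor k R X Y) :
    rTensor g hg (rTensor f hf z) =
      rTensor (g ∘ₗ f) (fun r x => by simp only [LinearMap.comp_apply, hf, hg]) z := by
  refine LinearMap.congr_fun (f := rTensor g hg ∘ₗ rTensor f hf) (BTensor.hom_ext fun x y => ?_) z
  rfl

theorem BTensor.rTensor_eq_self {X Y : Type*} [AddCommGroup X] [Module k X]
    [Module Rᵐᵒᵖ X] [AddCommGroup Y] [Module k Y] [Module R Y]
    (f : X →ₗ[k] X) (hf : ∀ (r : R) (x : X), f (op r • x) = op r • f x) (h : ∀ x, f x = x)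
    (z : BTensor k R X Y) : rTensor f hf z = z := by
  refine LinearMap.congr_fun (g := LinearMap.id) (BTensor.hom_ext fun x y => ?_) z
  rw [rTensor_tmul, h]
  rfl

theorem BTensor.tmul_add {X Y : Type*} [AddCommGroup X] [Module k X]
    [Module Rᵐᵒᵖ X] [AddCommGroup Y] [Module k Y] [Module R Y] (x : X) (y y' : Y) :
    tmul k R x (y + y') = tmul k R x y + tmul k R x y' := by
  simp only [tmul, TensorProduct.tmul_add, map_add]

theorem BTensor.add_tmul {X Y : Type*} [AddCommGroup X] [Module k X]
    [Module Rᵐᵒᵖ X] [AddCommGroup Y] [Module k Y] [Module R Y] (x x' : X) (y : Y) :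
    tmul k R (x + x') y = tmul k R x y + tmul k R x' y := by
  simp only [tmul, TensorProduct.add_tmul, map_add]

theorem BTensor.smul_tmul' {X Y : Type*} [AddCommGroup X] [Module k X]
    [Module Rᵐᵒᵖ X] [AddCommGroup Y] [Module k Y] [Module R Y] (c : k) (x : X) (y : Y) :
    tmul k R (c • x) y = c • tmul k R x y := by
  simp only [tmul, ← TensorProduct.smul_tmul', map_smul]

theorem BTensor.tmul_smul {X Y : Type*} [AddCommGroup X] [Module k X]
    [Module Rᵐᵒᵖ X] [AddCommGroup Y] [Module k Y] [Module R Y] (c : k) (x : X) (y : Y) :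
    tmul k R x (c • y) = c • tmul k R x y := by
  simp only [tmul, TensorProduct.tmul_smul, map_smul]

/-- Right exactness of `- ⊗_R Y`. -/
theorem BTensor.exists_rTensor_eq {K X X' Y : Type*} [AddCommGroup K] [Module k K]
    [Module Rᵐᵒᵖ K] [AddCommGroup X] [Module k X]
    [Module Rᵐᵒᵖ X] [AddCommGroup X'] [Module k X'] [Module Rᵐᵒᵖ X']
    [AddCommGroup Y] [Module k Y] [Module R Y]
    (i : K →ₗ[k] X) (hi : ∀ (r : R) (x : K), i (op r • x) = op r • i x)
    (q : X →ₗ[k] X') (hq : ∀ (r : R) (x : X), q (op r • x) = op r • q x)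
    (hex : Function.Exact i q) (hsurj : Function.Surjective q) (z : BTensor k R X Y)
    (hz : rTensor q hq z = 0) : ∃ z' : BTensor k R K Y, rTensor i hi z' = z := by
  obtain ⟨z, rfl⟩ := mk_surjective z
  have h1 : q.rTensor Y z ∈ balancedRel k R X' Y :=
    (Submodule.Quotient.mk_eq_zero _).1 hz
  -- Every relation over `X'` lifts to a relation over `X`, as `q` is surjective. So `z` can be
  -- corrected by relations to lie in the kernel of `q ⊗ Y` over `k`, where right exactness is
  -- known.
  have h2 : balancedRel k R X' Y ≤ (balancedRel k R X Y).map (q.rTensor Y) := by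
    refine Submodule.span_le.2 ?_
    rintro _ ⟨x, r, y, rfl⟩
    obtain ⟨x, rfl⟩ := hsurj x
    refine ⟨(op r • x) ⊗ₜ[k] y - x ⊗ₜ[k] (r • y), Submodule.subset_span ⟨x, r, y, rfl⟩, ?_⟩
    simp [hq]
  obtain ⟨s, hs, hsz⟩ := h2 h1
  obtain ⟨t, ht⟩ := (rTensor_exact Y hex hsurj (z - s)).1 (by rw [map_sub, hsz, sub_self])
  refine ⟨mk k R K Y t, ?_⟩
  change mk k R X Y (i.rTensor Y t) = _
  rw [ht, map_sub, sub_eq_self]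
  exact (Submodule.Quotient.mk_eq_zero _).2 hs

end Balanced

/-! ### Faithful flatness for modules in other universes -/

section FlatSmall

variable {k : Type*} [CommRing k] {R : Type v} [Ring R]
variable {Y : Type*} [AddCommGroup Y] [Module k Y] [Module R Y]

theorem shrinkEquiv_op_smul {X : Type*} [AddCommGroup X] [Module k X] [Module Rᵐᵒᵖ X]
    [Small.{w} X] (r : R) (x : Shrink.{w} X) :
    Shrink.linearEquiv k X (op r • x) = op r • Shrink.linearEquiv k X x :=
  (Shrink.linearEquiv Rᵐᵒᵖ X).map_smul _ _

theorem shrinkEquiv_symm_op_smul {X : Type*} [AddCommGroup X] [Module k X] [Module Rᵐᵒᵖ X]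
    [Small.{w} X] (r : R) (x : X) :
    (Shrink.linearEquiv.{w} k X).symm (op r • x) = op r • (Shrink.linearEquiv.{w} k X).symm x :=
  (Shrink.linearEquiv.{w} Rᵐᵒᵖ X).symm.map_smul _ _

variable [Algebra k R]

instance {X : Type*} [AddCommGroup X] [Module k X] [Module Rᵐᵒᵖ X] [IsScalarTower k Rᵐᵒᵖ X]
    [Small.{w} X] : IsScalarTower k Rᵐᵒᵖ (Shrink.{w} X) where
  smul_assoc c r x := (Shrink.linearEquiv k X).injective (by
    have h : ∀ (r : Rᵐᵒᵖ) (x : Shrink.{w} X), Shrink.linearEquiv k X (r • x) =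
      r • Shrink.linearEquiv k X x := (Shrink.linearEquiv Rᵐᵒᵖ X).map_smul
    rw [h, LinearEquiv.map_smul, h, smul_assoc])

/-- Flatness is only assumed for modules in the universe of `R`, whereas modules such as `Q ⊗ H` may
live elsewhere. Transport along `Shrink` extends it to all modules that are small for that universe.
-/
theorem IsFaithfullyFlatLeft.rTensor_injective (hY : IsFaithfullyFlatLeft k R Y) {X X' : Type*}
    [AddCommGroup X] [Module k X]
    [Module Rᵐᵒᵖ X] [IsScalarTower k Rᵐᵒᵖ X] [AddCommGroup X'] [Module k X'] [Module Rᵐᵒᵖ X']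
    [IsScalarTower k Rᵐᵒᵖ X'] [Small.{v} X] [Small.{v} X']
    (f : X →ₗ[k] X') (hf : ∀ (r : R) (x : X), f (op r • x) = op r • f x)
    (hinj : Function.Injective f) :
    Function.Injective (BTensor.rTensor f hf : BTensor k R X Y →ₗ[k] BTensor k R X' Y) := by
  let e := Shrink.linearEquiv.{v} k X
  let e' := Shrink.linearEquiv.{v} k X'
  have hs := hY.flat (Shrink.{v} X) (Shrink.{v} X') (e'.symm.toLinearMap ∘ₗ f ∘ₗ e.toLinearMap)
    (fun r x => by
      simp only [LinearMap.comp_apply, LinearEquiv.coe_coe, e, e', shrinkEquiv_op_smul, hf,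
        shrinkEquiv_symm_op_smul])
    (by
      simp only [LinearMap.coe_comp, LinearEquiv.coe_coe]
      exact e'.symm.injective.comp (hinj.comp e.injective))
  have h1 : ∀ z : BTensor k R X Y, BTensor.rTensor e.toLinearMap shrinkEquiv_op_smul
      (BTensor.rTensor e.symm.toLinearMap shrinkEquiv_symm_op_smul z) = z := by
    intro z
    rw [BTensor.rTensor_rTensor]
    exact BTensor.rTensor_eq_self _ _ (fun x => by simp) z
  intro z w hzw
  rw [← h1 z, ← h1 w]
  refine congrArg _ (hs ?_)
  have h2 : ∀ z : BTensor k R X Y, BTensor.rTensor (e'.symm.toLinearMap ∘ₗ f ∘ₗ e.toLinearMap)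
      (fun r x => by
        simp only [LinearMap.comp_apply, LinearEquiv.coe_coe, e, e', shrinkEquiv_op_smul, hf,
          shrinkEquiv_symm_op_smul])
      (BTensor.rTensor e.symm.toLinearMap shrinkEquiv_symm_op_smul z) =
      BTensor.rTensor e'.symm.toLinearMap shrinkEquiv_symm_op_smul (BTensor.rTensor f hf z) := by
    intro z
    rw [BTensor.rTensor_rTensor, BTensor.rTensor_rTensor]
    congr 2
    refine LinearMap.ext fun x => ?_
    simp only [LinearMap.comp_apply, LinearEquiv.coe_coe, LinearEquiv.apply_symm_apply]
  rw [h2, h2, hzw]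

theorem IsFaithfullyFlatLeft.subsingleton (hY : IsFaithfullyFlatLeft k R Y) (X : Type*)
    [AddCommGroup X] [Module k X]
    [Module Rᵐᵒᵖ X] [IsScalarTower k Rᵐᵒᵖ X] [Small.{v} X]
    (h : ∀ z : BTensor k R X Y, z = 0) (x : X) : x = 0 := by
  let e := Shrink.linearEquiv.{v} k X
  have h1 : ∀ z : BTensor k R (Shrink.{v} X) Y, z = 0 := by
    intro z
    have h2 : BTensor.rTensor e.symm.toLinearMap shrinkEquiv_symm_op_smul
        (BTensor.rTensor e.toLinearMap shrinkEquiv_op_smul z) = z := by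
      rw [BTensor.rTensor_rTensor]
      exact BTensor.rTensor_eq_self _ _ (fun x => by simp) z
    rw [← h2, h (BTensor.rTensor _ _ z), map_zero]
  have h3 := hY.faithful (Shrink.{v} X) ⟨fun a b => by rw [h1 a, h1 b]⟩
  have h4 : e.symm x = 0 := Subsingleton.elim _ _
  simpa using h4

/-- `- ⊗_R Y` preserves kernels. -/
theorem IsFaithfullyFlatLeft.exists_rTensor_eq (hY : IsFaithfullyFlatLeft k R Y)
    {K X X' : Type*} [AddCommGroup K] [Module k K] [Module Rᵐᵒᵖ K]
    [AddCommGroup X] [Module k X] [Module Rᵐᵒᵖ X] [IsScalarTower k Rᵐᵒᵖ X]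
    [AddCommGroup X'] [Module k X'] [Module Rᵐᵒᵖ X'] [IsScalarTower k Rᵐᵒᵖ X']
    [Small.{v} X] [Small.{v} X']
    (i : K →ₗ[k] X) (hi : ∀ (r : R) (x : K), i (op r • x) = op r • i x)
    (d : X →ₗ[k] X') (hd : ∀ (r : R) (x : X), d (op r • x) = op r • d x)
    (hex : Function.Exact i d) (z : BTensor k R X Y)
    (hz : BTensor.rTensor d hd z = 0) : ∃ z' : BTensor k R K Y, BTensor.rTensor i hi z' = z := by
  let dR : X →ₗ[Rᵐᵒᵖ] X' := { d with map_smul' := fun r x => hd (unop r) x }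
  let N : Submodule Rᵐᵒᵖ X := LinearMap.ker dR
  let q : X →ₗ[k] X ⧸ N := N.mkQ.restrictScalars k
  -- `d` factors as a surjection `q` followed by an injection `f`. Flatness cancels `f`, and right
  -- exactness applies to `q`.
  let f : X ⧸ N →ₗ[k] X' := (N.liftQ dR le_rfl).restrictScalars k
  have hf : Function.Injective f := by
    refine (injective_iff_map_eq_zero f).2 fun x hx => ?_
    obtain ⟨x, rfl⟩ := N.mkQ_surjective x
    exact (Submodule.Quotient.mk_eq_zero N).2 hx
  have hfq : ∀ x, f (q x) = d x := fun x => rfl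
  have hq : ∀ (r : R) (x : X), q (op r • x) = op r • q x := fun r x => rfl
  have hsm : Small.{v} (X ⧸ N) := small_of_surjective N.mkQ_surjective
  have hfl : ∀ (r : R) (x : X ⧸ N), f (op r • x) = op r • f x :=
    fun r x => (N.liftQ dR le_rfl).map_smul (op r) x
  refine BTensor.exists_rTensor_eq i hi q hq ?_ N.mkQ_surjective z ?_
  · intro x
    rw [← hex x, ← hfq x]
    exact ⟨fun h => by rw [h, map_zero], fun h => hf (by rw [h, map_zero])⟩
  · apply hY.rTensor_injective f hfl hf
    rw [BTensor.rTensor_rTensor, map_zero]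
    exact hz

end FlatSmall

/-! ### The structure theorem for Hopf modules -/

section Structure

variable {k H : Type*} {A : Type v} [Field k] [Ring H] [HopfAlgebra k H]
  [Ring A] [Algebra k A] [RightComoduleAlgebra k H A]
variable {Q : Type w} [AddCommGroup Q] [Module k Q] (r : Aᵐᵒᵖ →ₐ[k] Module.End k Q)

/-- The right action of `A ⊗ H` on `Q ⊗ H`. -/
def tensorRightAct : (A ⊗[k] H)ᵐᵒᵖ →ₐ[k] Module.End k (Q ⊗[k] H) :=
  (Module.endTensorEndAlgHom (R := k) (S := k) (A := k) (M := Q) (N := H)).comp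
    ((Algebra.TensorProduct.map r
(Algebra.lsmul (A := Hᵐᵒᵖ) k k H)).comp
      (Algebra.TensorProduct.opAlgEquiv k k A H).symm.toAlgHom)

omit [RightComoduleAlgebra k H A] in
theorem tensorRightAct_op_tmul (a : A) (g : H) (q : Q) (h : H) :
    tensorRightAct r (op (a ⊗ₜ[k] g)) (q ⊗ₜ[k] h) = r (op a) q ⊗ₜ[k] (h * g) := rfl

/-- The codiagonal right action of `A` on `Q ⊗ H`. -/
def codiagAct : Aᵐᵒᵖ →ₐ[k] Module.End k (Q ⊗[k] H) :=
  (tensorRightAct r).comp (AlgHom.op (rho k H A))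

theorem codiagAct_op (a : A) :
    codiagAct r (op a) = tensorRightAct (H := H) r (op (rho k H A a)) := rfl

variable [Module (coinv k H A)ᵐᵒᵖ Q] (hr : ∀ (b : coinv k H A) (q : Q), op b • q = r (op (b : A)) q)

/-- The map `a ↦ q a`, for a right `A`-module with structure map `r`. -/
def orbit (q : Q) : A →ₗ[k] Q :=
  (LinearMap.flip r.toLinearMap q) ∘ₗ (opLinearEquiv k).toLinearMap

theorem orbit_apply (q : Q) (a : A) : orbit r q a = r (op a) q := rfl

theorem mulLeft_op_coinv_smul (a : A) (b : coinv k H A) (x : A) :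
    LinearMap.mulLeft k a (op b • x) = op b • LinearMap.mulLeft k a x := by
  rw [op_coinv_smul, op_coinv_smul, LinearMap.mulLeft_apply, LinearMap.mulLeft_apply, mul_assoc]

include hr in
theorem orbit_op_smul (q : Q) (b : coinv k H A) (a : A) :
    orbit r q (op b • a) = op b • orbit r q a := by
  rw [hr, orbit_apply, orbit_apply, op_coinv_smul, op_mul, map_mul]
  rfl

/-- The map `Q ⊗_B A → Q ⊗ H`, `q ⊗ a ↦ q a₀ ⊗ a₁`. -/
def galMap : BTensor k (coinv k H A) Q A →ₗ[k] Q ⊗[k] H :=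
  BTensor.lift
    ((TensorProduct.lift (LinearMap.flip (r.toLinearMap ∘ₗ
      (opLinearEquiv k : A ≃ₗ[k] Aᵐᵒᵖ).toLinearMap))).rTensor H ∘ₗ
      (TensorProduct.assoc k Q A H).symm.toLinearMap ∘ₗ (rho k H A).toLinearMap.lTensor Q) (by
    intro q b a
    simp only [LinearMap.comp_apply, LinearMap.lTensor_tmul, AlgHom.toLinearMap_apply,
      Subalgebra.smul_def, smul_eq_mul, map_mul, rho_coinv, hr]
    generalize rho k H A a = z
    induction z with
    | zero => simp
    | add x y hx hy => simp only [map_add, mul_add, TensorProduct.tmul_add, hx, hy]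
    | tmul x h => simp)

theorem galMap_tmul (q : Q) (a : A) :
    galMap r hr (BTensor.tmul k (coinv k H A) q a) = (orbit r q).rTensor H (rho k H A a) := by
  rw [galMap, BTensor.lift_tmul]
  simp only [LinearMap.comp_apply, LinearMap.lTensor_tmul, AlgHom.toLinearMap_apply]
  generalize rho k H A a = z
  induction z with
  | zero => simp
  | add x y hx hy => simp only [map_add, TensorProduct.tmul_add, hx, hy]
  | tmul x h => simp [orbit_apply]

/-- The orbit map `A → Q` is right `A`-linear, and the Galois map is natural in the module; for `Q =
A` it is `can`. -/
theorem galMap_rTensor_orbit (q : Q) (w : BTensor k (coinv k H A) A A) :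
    galMap r hr (BTensor.rTensor (orbit r q) (orbit_op_smul r hr q) w) =
      (orbit r q).rTensor H (can k H A w) := by
  refine LinearMap.congr_fun (f := galMap r hr ∘ₗ BTensor.rTensor _ _)
    (g := (orbit r q).rTensor H ∘ₗ can k H A) (BTensor.hom_ext fun a a' => ?_) w
  simp only [LinearMap.comp_apply, BTensor.rTensor_tmul, galMap_tmul, can_tmul]
  generalize rho k H A a' = z
  induction z with
  | zero => simp
  | add x y hx hy => simp only [map_add, mul_add, hx, hy]
  | tmul x h => simp [orbit_apply]

/-- The inverse is `q ⊗ h ↦ q l(h) ⊗ r(h)`. Bijectivity of `can` suffices for every right `A`-module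
`Q`; flatness plays no role yet. -/
theorem galMap_bijective (hA : IsFaithfullyFlatGalois k H A) :
    Function.Bijective (galMap r hr) := by
  let e := canEquiv hA
  have he : ∀ w, can k H A w = e w := fun w => rfl
  let G : Q ⊗[k] H →ₗ[k] BTensor k (coinv k H A) Q A := TensorProduct.lift (LinearMap.mk₂ k
    (fun q h => BTensor.rTensor (orbit r q) (orbit_op_smul r hr q) (e.symm (1 ⊗ₜ h)))
    (fun q q' h => by
      generalize e.symm (1 ⊗ₜ[k] h) = w
      refine LinearMap.congr_fun (g := BTensor.rTensor (orbit r q) (orbit_op_smul r hr q) +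
        BTensor.rTensor (orbit r q') (orbit_op_smul r hr q')) (BTensor.hom_ext fun a a' => ?_) w
      rw [LinearMap.add_apply]
      simp only [BTensor.rTensor_tmul, orbit_apply, map_add, BTensor.add_tmul])
    (fun c q h => by
      generalize e.symm (1 ⊗ₜ[k] h) = w
      refine LinearMap.congr_fun (g := c • BTensor.rTensor (orbit r q) (orbit_op_smul r hr q))
        (BTensor.hom_ext fun a a' => ?_) w
      rw [LinearMap.smul_apply]
      simp only [BTensor.rTensor_tmul, orbit_apply, map_smul, BTensor.smul_tmul'])
    (fun q h h' => by simp only [TensorProduct.tmul_add, map_add])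
    (fun c q h => by simp only [TensorProduct.tmul_smul, map_smul]))
  have hG : ∀ (q : Q) (h : H), G (q ⊗ₜ h) =
    BTensor.rTensor (orbit r q) (orbit_op_smul r hr q) (e.symm (1 ⊗ₜ h)) := fun q h => rfl
  have hleft : ∀ (a : A) (w : BTensor k (coinv k H A) A A),
      e.symm ((a ⊗ₜ 1) * e w) = BTensor.rTensor (LinearMap.mulLeft k a)
        (mulLeft_op_coinv_smul a) w := by
    intro a w
    rw [LinearEquiv.symm_apply_eq]
    refine LinearMap.congr_fun (f := LinearMap.mulLeft k (a ⊗ₜ[k] (1 : H)) ∘ₗ e.toLinearMap)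
      (g := e.toLinearMap ∘ₗ BTensor.rTensor _ _) (BTensor.hom_ext fun x y => ?_) w
    simp only [LinearMap.comp_apply, BTensor.rTensor_tmul, LinearEquiv.coe_coe,
      LinearMap.mulLeft_apply, e, canEquiv_tmul, ← mul_assoc, Algebra.TensorProduct.tmul_mul_tmul,
      mul_one]
  have h1 : ∀ (q : Q) (z : A ⊗[k] H), G ((orbit r q).rTensor H z) =
      BTensor.rTensor (orbit r q) (orbit_op_smul r hr q) (e.symm z) := by
    intro q z
    induction z with
    | zero => simp
    | add x y hx hy => simp only [map_add, hx, hy]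
    | tmul a h =>
      have h2 : a ⊗ₜ[k] h = (a ⊗ₜ[k] (1 : H)) * e (e.symm (1 ⊗ₜ[k] h)) := by simp
      rw [LinearMap.rTensor_tmul, hG, h2, hleft, BTensor.rTensor_rTensor]
      congr 2
      refine LinearMap.ext fun x => ?_
      simp [orbit_apply]
  constructor
  · refine Function.LeftInverse.injective (g := G) fun z => ?_
    refine LinearMap.congr_fun (f := G ∘ₗ galMap r hr) (g := LinearMap.id)
      (BTensor.hom_ext fun q a => ?_) z
    rw [LinearMap.comp_apply, galMap_tmul, h1, ← one_mul (rho k H A a),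
      Algebra.TensorProduct.one_def, ← can_tmul, he, e.symm_apply_apply, BTensor.rTensor_tmul,
      orbit_apply]
    simp
  · intro z
    induction z with
    | zero => exact ⟨0, map_zero _⟩
    | add x y hx hy =>
      obtain ⟨x', rfl⟩ := hx
      obtain ⟨y', rfl⟩ := hy
      exact ⟨x' + y', map_add _ _ _⟩
    | tmul q h =>
      refine ⟨G (q ⊗ₜ h), ?_⟩
      rw [hG, galMap_rTensor_orbit, he, e.apply_symm_apply]
      simp [orbit_apply]

variable [IsScalarTower k (coinv k H A)ᵐᵒᵖ Q]

include hr in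
theorem codiagAct_op_coinv (b : coinv k H A) (z : Q ⊗[k] H) :
    op b • z = codiagAct r (op (b : A)) z := by
  rw [codiagAct_op, rho_coinv]
  induction z with
  | zero => rw [smul_zero, map_zero]
  | add x y hx hy => rw [smul_add, map_add, hx, hy]
  | tmul q h => rw [tensorRightAct_op_tmul, mul_one, TensorProduct.smul_tmul', hr]

/-- A Hopf module structure on a right `A`-module. -/
structure IsHopfCoaction (δ : Q →ₗ[k] Q ⊗[k] H) : Prop where
  map_act : ∀ (a : A) (q : Q), δ (r (op a) q) = codiagAct r (op a) (δ q)
  coassoc : ∀ q, δ.rTensor H (δ q) = (TensorProduct.assoc k Q H H).symm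
    ((Coalgebra.comul : H →ₗ[k] H ⊗[k] H).lTensor Q (δ q))
  counit : ∀ q, (Coalgebra.counit : H →ₗ[k] k).lTensor Q (δ q) = q ⊗ₜ[k] 1

variable {K : Type v} [AddCommGroup K] [Module k K] [Module (coinv k H A)ᵐᵒᵖ K]
  [IsScalarTower k (coinv k H A)ᵐᵒᵖ K]
  (i : K →ₗ[k] Q) (hi : ∀ (b : coinv k H A) (x : K), i (op b • x) = op b • i x)

/-- The map `K ⊗_B A → Q`, `x ⊗ a ↦ x a`, for a `B`-submodule `K` of an `A`-module `Q`. -/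
def coinvMul : BTensor k (coinv k H A) K A →ₗ[k] Q :=
  BTensor.lift (TensorProduct.lift ((LinearMap.flip (r.toLinearMap ∘ₗ
      (opLinearEquiv k : A ≃ₗ[k] Aᵐᵒᵖ).toLinearMap)) ∘ₗ i)) (by
    intro x b a
    change r (op a) (i (op b • x)) = r (op ((b : A) * a)) (i x)
    rw [hi, hr, op_mul, map_mul]
    rfl)

omit [IsScalarTower k (coinv k H A)ᵐᵒᵖ Q] [IsScalarTower k (coinv k H A)ᵐᵒᵖ K] in
theorem coinvMul_tmul (x : K) (a : A) :
    coinvMul r hr i hi (BTensor.tmul k (coinv k H A) x a) = r (op a) (i x) := rfl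

variable {r}

/-- The structure theorem for Hopf modules over a faithfully flat Galois extension. -/
theorem coinvMul_bijective [Small.{v} Q] (hA : IsFaithfullyFlatGalois k H A)
    {δ : Q →ₗ[k] Q ⊗[k] H}
    (hδ : IsHopfCoaction r δ) (hinj : Function.Injective i)
    (hmem : ∀ q, δ q = q ⊗ₜ[k] 1 ↔ ∃ x, i x = q) :
    Function.Bijective (coinvMul r hr i hi) := by
  let e : BTensor k (coinv k H A) Q A ≃ₗ[k] Q ⊗[k] H :=
    LinearEquiv.ofBijective (galMap r hr) (galMap_bijective r hr hA)
  have hδB : ∀ (b : coinv k H A) (q : Q), δ (op b • q) = op b • δ q := by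
    intro b q
    rw [hr, hδ.map_act, codiagAct_op_coinv r hr]
  let ι : Q →ₗ[k] Q ⊗[k] H := (TensorProduct.mk k Q H).flip 1
  have hιB : ∀ (b : coinv k H A) (q : Q), ι (op b • q) = op b • ι q := fun b q => rfl
  have hι : ∀ q, ι q = q ⊗ₜ[k] 1 := fun q => rfl
  -- Under the Galois isomorphism `Q ⊗_B A ≅ Q ⊗ H`, the map to be inverted, followed by `δ`, is
  -- just `i ⊗_B A`. So injectivity follows from flatness, and surjectivity amounts to `δ(q)` lying
  -- in the image of `K ⊗_B A`.
  have h1 : ∀ z, δ (coinvMul r hr i hi z) = e (BTensor.rTensor i hi z) := by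
    intro z
    refine LinearMap.congr_fun (f := δ ∘ₗ coinvMul r hr i hi)
      (g := galMap r hr ∘ₗ BTensor.rTensor i hi) (BTensor.hom_ext fun x a => ?_) z
    rw [LinearMap.comp_apply, LinearMap.comp_apply, coinvMul_tmul, BTensor.rTensor_tmul,
      galMap_tmul, hδ.map_act, (hmem _).2 ⟨x, rfl⟩, codiagAct_op]
    generalize rho k H A a = w
    induction w with
    | zero => simp
    | add x y hx hy => simp only [map_add, op_add, LinearMap.add_apply, hx, hy]
    | tmul y h => rw [tensorRightAct_op_tmul, one_mul, LinearMap.rTensor_tmul, orbit_apply]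
  have hδinj : Function.Injective δ := by
    intro q q' h
    have h2 : q ⊗ₜ[k] (1 : k) = q' ⊗ₜ[k] 1 := by rw [← hδ.counit, ← hδ.counit, h]
    simpa using congrArg (TensorProduct.rid k Q) h2
  constructor
  · intro z w hzw
    refine hA.faithfullyFlat.rTensor_injective i hi hinj (e.injective ?_)
    rw [← h1, ← h1, hzw]
  · intro q
    -- With `Q ⊗ H` as a codiagonal `A`-module, the two maps `δ, ι : Q → Q ⊗ H` become, after `- ⊗_B
    -- A`, the maps `δ ⊗ H` and `Q ⊗ Δ`. These agree on `δ(q)` by coassociativity.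
    have h2 : ∀ z, galMap (codiagAct r) (codiagAct_op_coinv r hr) (BTensor.rTensor δ hδB z) =
        δ.rTensor H (galMap r hr z) := by
      intro z
      refine LinearMap.congr_fun (f := galMap (codiagAct r) (codiagAct_op_coinv r hr) ∘ₗ
        BTensor.rTensor δ hδB) (g := δ.rTensor H ∘ₗ galMap r hr) (BTensor.hom_ext fun x a => ?_) z
      rw [LinearMap.comp_apply, LinearMap.comp_apply, BTensor.rTensor_tmul, galMap_tmul,
        galMap_tmul, ← LinearMap.rTensor_comp_apply]
      congr 2
      refine LinearMap.ext fun a => ?_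
      rw [LinearMap.comp_apply, orbit_apply, orbit_apply, hδ.map_act]
    have h3 : ∀ z, galMap (codiagAct r) (codiagAct_op_coinv r hr) (BTensor.rTensor ι hιB z) =
        (TensorProduct.assoc k Q H H).symm
          ((Coalgebra.comul : H →ₗ[k] H ⊗[k] H).lTensor Q (galMap r hr z)) := by
      intro z
      refine LinearMap.congr_fun (f := galMap (codiagAct r) (codiagAct_op_coinv r hr) ∘ₗ
        BTensor.rTensor ι hιB) (g := (TensorProduct.assoc k Q H H).symm.toLinearMap ∘ₗ
          (Coalgebra.comul : H →ₗ[k] H ⊗[k] H).lTensor Q ∘ₗ galMap r hr)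
        (BTensor.hom_ext fun x a => ?_) z
      simp only [LinearMap.comp_apply, LinearEquiv.coe_coe]
      rw [BTensor.rTensor_tmul, galMap_tmul, galMap_tmul]
      have h4 : orbit (codiagAct r) (ι x) = (orbit r x).rTensor H ∘ₗ (rho k H A).toLinearMap := by
        refine LinearMap.ext fun a => ?_
        rw [orbit_apply, codiagAct_op, LinearMap.comp_apply, AlgHom.toLinearMap_apply, hι]
        generalize rho k H A a = w
        induction w with
        | zero => simp
        | add x y hx hy => simp only [map_add, op_add, LinearMap.add_apply, hx, hy]
        | tmul y h => rw [tensorRightAct_op_tmul, one_mul, LinearMap.rTensor_tmul, orbit_apply]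
      rw [h4, LinearMap.rTensor_comp_apply, rho_rho]
      generalize rho k H A a = w
      induction w with
      | zero => simp
      | add x y hx hy => simp only [map_add, hx, hy]
      | tmul y h =>
        simp only [LinearMap.lTensor_tmul, LinearMap.rTensor_tmul]
        generalize (Coalgebra.comul h : H ⊗[k] H) = w
        induction w with
        | zero => simp
        | add x y hx hy => simp only [map_add, TensorProduct.tmul_add, hx, hy]
        | tmul g f => simp
    have hdB : ∀ (b : coinv k H A) (q : Q), (δ - ι) (op b • q) = op b • (δ - ι) q := by
      intro b q
      rw [LinearMap.sub_apply, LinearMap.sub_apply, hδB, hιB, smul_sub]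
    -- Whatever the universe of `H`, `Q ⊗ H` is isomorphic to `Q ⊗_B A`, a quotient of the small
    -- space `Q ⊗ A`.
    have hsm : Small.{v} (Q ⊗[k] H) := by
      have : Small.{v} (BTensor k (coinv k H A) Q A) := by
        have h5 : Small.{v} (Q ⊗[k] A) := by
          exact small_map (TensorProduct.congr (Shrink.linearEquiv.{v} k Q).symm
            (LinearEquiv.refl k A)).toEquiv
        exact small_of_surjective (BTensor.mk_surjective (k := k) (R := coinv k H A))
      exact small_map e.symm.toEquiv
    have hex : Function.Exact i (δ - ι) := by
      intro q
      rw [LinearMap.sub_apply, sub_eq_zero, hι, hmem]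
      rfl
    -- Coinvariants are the kernel of `δ - ι`, and flatness preserves this kernel.
    obtain ⟨z, hz⟩ := hA.faithfullyFlat.exists_rTensor_eq i hi (δ - ι) hdB hex (e.symm (δ q)) (by
      apply (galMap_bijective (codiagAct r) (codiagAct_op_coinv r hr) hA).1
      have h6 : ∀ z : BTensor k (coinv k H A) Q A, BTensor.rTensor (δ - ι) hdB z =
          BTensor.rTensor δ hδB z - BTensor.rTensor ι hιB z := by
        intro z
        refine LinearMap.congr_fun (g := BTensor.rTensor δ hδB - BTensor.rTensor ι hιB)
          (BTensor.hom_ext fun x a => ?_) z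
        rw [LinearMap.sub_apply, eq_sub_iff_add_eq]
        simp only [BTensor.rTensor_tmul, ← BTensor.add_tmul, LinearMap.sub_apply, sub_add_cancel]
      have h7 : galMap r hr (e.symm (δ q)) = δ q := e.apply_symm_apply _
      rw [h6, map_sub, h2, h3, h7, hδ.coassoc, sub_self, map_zero])
    refine ⟨z, hδinj ?_⟩
    rw [h1, hz, e.apply_symm_apply]

end Structure

/-! ### `A ⊗ Aᵒᵖ` as a Hopf module over `A` -/

section TwoSided

variable (k : Type*) {H : Type*} (A : Type v) [Field k] [Ring H] [HopfAlgebra k H]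
  [Ring A] [Algebra k A] [RightComoduleAlgebra k H A]

/-- The algebra `A ⊗ Aᵒᵖ`, as a right `A`-module by `(a ⊗ a') c = a ⊗ a' c`. -/
def TwoSided : Type _ := A ⊗[k] Aᵐᵒᵖ

instance : Ring (TwoSided k A) := inferInstanceAs (Ring (A ⊗[k] Aᵐᵒᵖ))

instance : Algebra k (TwoSided k A) := inferInstanceAs (Algebra k (A ⊗[k] Aᵐᵒᵖ))

/-- The right action `(a ⊗ a') c = a ⊗ a' c`. -/
def outerAct : Aᵐᵒᵖ →ₐ[k] Module.End k (TwoSided k A) :=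
  (Algebra.lmul k (TwoSided k A)).comp
    (Algebra.TensorProduct.includeRight : Aᵐᵒᵖ →ₐ[k] A ⊗[k] Aᵐᵒᵖ)

instance : Module (coinv k H A)ᵐᵒᵖ (TwoSided k A) :=
  Module.compHom (TwoSided k A)
    ((outerAct k A).comp (AlgHom.op (coinv k H A).val)).toRingHom

instance : IsScalarTower k (coinv k H A)ᵐᵒᵖ (TwoSided k A) where
  smul_assoc c b x := by
    change (outerAct k A) (AlgHom.op (coinv k H A).val (c • b)) x =
      c • (outerAct k A) (AlgHom.op (coinv k H A).val b) x
    rw [map_smul, map_smul, LinearMap.smul_apply]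

theorem outerAct_op_coinv (b : coinv k H A) (q : TwoSided k A) :
    op b • q = outerAct k A (op (b : A)) q := rfl

/-- The pure tensor `a ⊗ a'` in `A ⊗ Aᵒᵖ`. -/
def TwoSided.tmul : A ⊗[k] A →ₗ[k] TwoSided k A :=
  TensorProduct.map LinearMap.id (opLinearEquiv k).toLinearMap

variable {A}

theorem TwoSided.induction {p : TwoSided k A → Prop} (x : TwoSided k A) (zero : p 0)
    (tmul : ∀ a a' : A, p (TwoSided.tmul k A (a ⊗ₜ a'))) (add : ∀ x y, p x → p y → p (x + y)) :
    p x :=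
  TensorProduct.induction_on (motive := p) x zero (fun a a' => tmul a (unop a')) add

variable {k}

theorem outerAct_tmul (a a' c : A) : outerAct k A (op c) (TwoSided.tmul k A (a ⊗ₜ a')) =
    TwoSided.tmul k A (a ⊗ₜ (a' * c)) := by
  change ((1 : A) ⊗ₜ[k] op c) * (a ⊗ₜ[k] op a') = a ⊗ₜ[k] op (a' * c)
  rw [Algebra.TensorProduct.tmul_mul_tmul, one_mul, op_mul]

theorem TwoSided.tmul_mul_tmul (a a' c c' : A) :
    TwoSided.tmul k A (a ⊗ₜ a') * TwoSided.tmul k A (c ⊗ₜ c') =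
      TwoSided.tmul k A ((a * c) ⊗ₜ (c' * a')) := by
  change (a ⊗ₜ[k] op a') * (c ⊗ₜ[k] op c') = (a * c) ⊗ₜ[k] op (c' * a')
  rw [Algebra.TensorProduct.tmul_mul_tmul, op_mul]

variable (k H A) in
/-- `(a ⊗ g) ⊗ (a' ⊗ h) ↦ (a ⊗ a') ⊗ g h`. -/
def collect : (A ⊗[k] H) ⊗[k] (A ⊗[k] H) →ₗ[k] TwoSided k A ⊗[k] H :=
  TensorProduct.map (TwoSided.tmul k A) (LinearMap.mul' k H) ∘ₗ
    (TensorProduct.tensorTensorTensorComm k A H A H).toLinearMap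

omit [RightComoduleAlgebra k H A] in
theorem collect_tmul (a a' : A) (g h : H) : collect k H A ((a ⊗ₜ g) ⊗ₜ (a' ⊗ₜ h)) =
    TwoSided.tmul k A (a ⊗ₜ a') ⊗ₜ (g * h) := rfl

variable (k H A) in
/-- The codiagonal coaction `a ⊗ a' ↦ (a₀ ⊗ a'₀) ⊗ a₁ a'₁`. -/
def codiag : TwoSided k A →ₗ[k] TwoSided k A ⊗[k] H :=
  collect k H A ∘ₗ TensorProduct.map (rho k H A).toLinearMap
    ((rho k H A).toLinearMap ∘ₗ (opLinearEquiv k).symm.toLinearMap)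

theorem codiag_tmul (a a' : A) : codiag k H A (TwoSided.tmul k A (a ⊗ₜ a')) =
    collect k H A (rho k H A a ⊗ₜ rho k H A a') := rfl

-- Only the second factor is acted upon by `A`, and it stands on the right in `a₁ a'₁`; therefore
-- `a'₁ c₁` appears in the correct order for the codiagonal action.
variable (k H A) in
theorem isHopfCoaction_codiag : IsHopfCoaction (outerAct k A) (codiag k H A) where
  map_act c q := by
    induction q using TwoSided.induction with
    | zero => simp
    | add x y hx hy => simp only [map_add, hx, hy]
    | tmul a a' =>
      rw [outerAct_tmul, codiag_tmul, codiag_tmul, map_mul, codiagAct_op]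
      generalize rho k H A a = z
      generalize rho k H A a' = w
      generalize rho k H A c = y
      induction z with
      | zero => simp
      | add x y hx hy => simp only [map_add, TensorProduct.add_tmul, hx, hy]
      | tmul x g =>
      induction w with
      | zero => simp
      | add x y hx hy => simp only [map_add, TensorProduct.tmul_add, add_mul, hx, hy]
      | tmul x' g' =>
      induction y with
      | zero => simp
      | add x y hx hy =>
        simp only [map_add, TensorProduct.tmul_add, mul_add, op_add, hx, hy, LinearMap.add_apply]
      | tmul y h =>
        rw [Algebra.TensorProduct.tmul_mul_tmul, collect_tmul, collect_tmul, tensorRightAct_op_tmul,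
          outerAct_tmul, mul_assoc]
  coassoc q := by
    induction q using TwoSided.induction with
    | zero => simp
    | add x y hx hy => simp only [map_add, hx, hy]
    | tmul a a' =>
      let X : ((A ⊗[k] H) ⊗[k] H) ⊗[k] ((A ⊗[k] H) ⊗[k] H) →ₗ[k] (TwoSided k A ⊗[k] H) ⊗[k] H :=
        TensorProduct.map (collect k H A) (LinearMap.mul' k H) ∘ₗ
          (TensorProduct.tensorTensorTensorComm k (A ⊗[k] H) H (A ⊗[k] H) H).toLinearMap
      have h1 : ∀ z w : A ⊗[k] H, (codiag k H A).rTensor H (collect k H A (z ⊗ₜ w)) =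
          X ((rho k H A).toLinearMap.rTensor H z ⊗ₜ (rho k H A).toLinearMap.rTensor H w) := by
        intro z w
        induction z with
        | zero => simp
        | add x y hx hy => simp only [map_add, TensorProduct.add_tmul, hx, hy]
        | tmul x g =>
        induction w with
        | zero => simp
        | add x y hx hy => simp only [map_add, TensorProduct.tmul_add, hx, hy]
        | tmul x' g' => rfl
      have h2 : ∀ z w : A ⊗[k] H, (TensorProduct.assoc k (TwoSided k A) H H).symm
          ((Coalgebra.comul : H →ₗ[k] H ⊗[k] H).lTensor _ (collect k H A (z ⊗ₜ w))) =
          X ((TensorProduct.assoc k A H H).symm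
            ((Coalgebra.comul : H →ₗ[k] H ⊗[k] H).lTensor A z) ⊗ₜ
            (TensorProduct.assoc k A H H).symm
            ((Coalgebra.comul : H →ₗ[k] H ⊗[k] H).lTensor A w)) := by
        intro z w
        induction z with
        | zero => simp
        | add x y hx hy => simp only [map_add, TensorProduct.add_tmul, hx, hy]
        | tmul x g =>
        induction w with
        | zero => simp
        | add x y hx hy => simp only [map_add, TensorProduct.tmul_add, hx, hy]
        | tmul x' g' =>
          rw [collect_tmul, LinearMap.lTensor_tmul, LinearMap.lTensor_tmul, LinearMap.lTensor_tmul,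
            Bialgebra.comul_mul]
          generalize (Coalgebra.comul g : H ⊗[k] H) = w
          generalize (Coalgebra.comul g' : H ⊗[k] H) = w'
          induction w with
          | zero => simp
          | add x y hx hy => simp only [map_add, TensorProduct.tmul_add, TensorProduct.add_tmul,
              add_mul, hx, hy]
          | tmul f g =>
          induction w' with
          | zero => simp
          | add x y hx hy => simp only [map_add, TensorProduct.tmul_add,
              mul_add, hx, hy]
          | tmul f' g' => rw [Algebra.TensorProduct.tmul_mul_tmul]; rfl
      rw [codiag_tmul, h1, rho_rho, rho_rho, h2]
  counit q := by
    induction q using TwoSided.induction with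
    | zero => simp
    | add x y hx hy => simp only [map_add, TensorProduct.add_tmul, hx, hy]
    | tmul a a' =>
      have h1 : ∀ z w : A ⊗[k] H,
          (Coalgebra.counit : H →ₗ[k] k).lTensor _ (collect k H A (z ⊗ₜ w)) =
          TensorProduct.map (TwoSided.tmul k A) (LinearMap.mul' k k)
            (TensorProduct.tensorTensorTensorComm k A k A k
            ((Coalgebra.counit : H →ₗ[k] k).lTensor A z ⊗ₜ
              (Coalgebra.counit : H →ₗ[k] k).lTensor A w)) := by
        intro z w
        induction z with
        | zero => simp
        | add x y hx hy => simp only [map_add, TensorProduct.add_tmul, hx, hy]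
        | tmul x g =>
        induction w with
        | zero => simp
        | add x y hx hy => simp only [map_add, TensorProduct.tmul_add, hx, hy]
        | tmul x' g' => simp [collect_tmul]
      rw [codiag_tmul, h1, RightComoduleAlgebra.counit, RightComoduleAlgebra.counit]
      simp

end TwoSided

/-! ### The cotensor product as codiagonal coinvariants -/

section Box

variable {k : Type*} {H : Type*} {A : Type v} [Field k] [Ring H] [HopfAlgebra k H]
  [Ring A] [Algebra k A] [RightComoduleAlgebra k H A]

/-- `a ⊗ a' ↦ (a ⊗ a'₀) ⊗ s(a'₁)`. -/
def rightTwist (s : H →ₗ[k] H) : TwoSided k A →ₗ[k] TwoSided k A ⊗[k] H :=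
  TensorProduct.map (TwoSided.tmul k A) LinearMap.id ∘ₗ
    (TensorProduct.assoc k A A H).symm.toLinearMap ∘ₗ
    TensorProduct.map LinearMap.id (s.lTensor A ∘ₗ (rho k H A).toLinearMap ∘ₗ
      (opLinearEquiv k).symm.toLinearMap)

theorem rightTwist_tmul (s : H →ₗ[k] H) (a a' : A) :
    rightTwist s (TwoSided.tmul k A (a ⊗ₜ a')) =
      TensorProduct.map (TwoSided.tmul k A) LinearMap.id
        ((TensorProduct.assoc k A A H).symm (a ⊗ₜ s.lTensor A (rho k H A a'))) := rfl

/-- `(a ⊗ a') ⊗ h ↦ (a ⊗ a'₀) ⊗ h s(a'₁)`. -/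
def rightTwistMul (s : H →ₗ[k] H) : TwoSided k A ⊗[k] H →ₗ[k] TwoSided k A ⊗[k] H :=
  (LinearMap.mul' k H ∘ₗ (TensorProduct.comm k H H).toLinearMap).lTensor (TwoSided k A) ∘ₗ
    (TensorProduct.assoc k (TwoSided k A) H H).toLinearMap ∘ₗ (rightTwist s).rTensor H

theorem rightTwistMul_tmul (s : H →ₗ[k] H) (a a' : A) (h : H) :
    rightTwistMul s (TwoSided.tmul k A (a ⊗ₜ a') ⊗ₜ h) =
      collect k H A ((a ⊗ₜ h) ⊗ₜ (s.lTensor A (rho k H A a'))) := by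
  simp only [rightTwistMul, LinearMap.comp_apply, LinearMap.rTensor_tmul, rightTwist_tmul]
  generalize rho k H A a' = z
  induction z with
  | zero => simp
  | add x y hx hy => simp only [map_add, TensorProduct.add_tmul, TensorProduct.tmul_add, hx, hy]
  | tmul x g => rfl

theorem rightTwistMul_one (s : H →ₗ[k] H) (q : TwoSided k A) :
    rightTwistMul s (q ⊗ₜ 1) = rightTwist s q := by
  induction q using TwoSided.induction with
  | zero => simp
  | add x y hx hy => simp only [map_add, TensorProduct.add_tmul, hx, hy]
  | tmul a a' =>
    rw [rightTwistMul_tmul, rightTwist_tmul]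
    generalize rho k H A a' = z
    induction z with
    | zero => simp
    | add x y hx hy => simp only [map_add, TensorProduct.tmul_add, hx, hy]
    | tmul x g => rw [LinearMap.lTensor_tmul, collect_tmul, one_mul]; rfl

theorem coactRight_eq_rightTwist (q : TwoSided k A) :
    coactRight A (rhoOp k H A) q = rightTwist (HopfAlgebra.antipode k) q := by
  induction q using TwoSided.induction with
  | zero => exact (map_zero _).trans (map_zero _).symm
  | add x y hx hy => rw [map_add, ← hx, ← hy]; exact map_add _ _ _
  | tmul a a' =>
    rw [rightTwist_tmul]
    change coactRight A (rhoOp k H A) (a ⊗ₜ[k] op a') = _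
    rw [coactRight_tmul, rhoOp_op]
    generalize rho k H A a' = z
    induction z with
    | zero => simp; rfl
    | add x y hx hy => simp only [map_add, TensorProduct.tmul_add, hx, hy]; rfl
    | tmul x g => rfl

variable (k H A) in
/-- The coaction `a ⊗ a' ↦ (a₀ ⊗ a') ⊗ a₁`. -/
def leftCoact : TwoSided k A →ₗ[k] TwoSided k A ⊗[k] H := (coactLeft k H A Aᵐᵒᵖ).toLinearMap

theorem leftCoact_tmul (a a' : A) : leftCoact k H A (TwoSided.tmul k A (a ⊗ₜ a')) =
    TensorProduct.map (TwoSided.tmul k A) LinearMap.id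
      (TensorProduct.rightComm k A H A (rho k H A a ⊗ₜ a')) := by
  refine (coactLeft_tmul a (op a')).trans ?_
  generalize rho k H A a = z
  induction z with
  | zero => simp; rfl
  | add x y hx hy => simp only [map_add, TensorProduct.add_tmul, hx, hy]; rfl
  | tmul x g => rfl

theorem rightTwistMul_leftCoact (q : TwoSided k A) :
    rightTwistMul LinearMap.id (leftCoact k H A q) = codiag k H A q := by
  induction q using TwoSided.induction with
  | zero => simp
  | add x y hx hy => simp only [map_add, hx, hy]
  | tmul a a' =>
    rw [leftCoact_tmul, codiag_tmul]
    generalize rho k H A a = z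
    induction z with
    | zero => simp
    | add x y hx hy => simp only [map_add, TensorProduct.add_tmul, hx, hy]
    | tmul x g =>
      rw [TensorProduct.rightComm_tmul, TensorProduct.map_tmul, LinearMap.id_apply,
        rightTwistMul_tmul, LinearMap.lTensor_id, LinearMap.id_apply]

variable [Coalgebra.IsCocomm k H]

/-- The `H`-component that arises is `S(a'₂) a'₁`, which is `ε(a'₁)` because `H` is cocommutative.
-/
theorem rightTwistMul_rightTwist (q : TwoSided k A) :
    rightTwistMul LinearMap.id (rightTwist (HopfAlgebra.antipode k) q) = q ⊗ₜ (1 : H) := by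
  induction q using TwoSided.induction with
  | zero => simp
  | add x y hx hy => simp only [map_add, TensorProduct.add_tmul, hx, hy]
  | tmul a a' =>
    let T : (A ⊗[k] H) ⊗[k] H →ₗ[k] TwoSided k A ⊗[k] H :=
      TensorProduct.map (TwoSided.tmul k A ∘ₗ TensorProduct.mk k A A a)
        (LinearMap.mul' k H ∘ₗ (HopfAlgebra.antipode k : H →ₗ[k] H).rTensor H ∘ₗ
          (TensorProduct.comm k H H).toLinearMap) ∘ₗ (TensorProduct.assoc k A H H).toLinearMap
    have h1 : ∀ z : A ⊗[k] H, rightTwistMul LinearMap.id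
        (TensorProduct.map (TwoSided.tmul k A) LinearMap.id
        ((TensorProduct.assoc k A A H).symm (a ⊗ₜ (HopfAlgebra.antipode k).lTensor A z))) =
        T ((rho k H A).toLinearMap.rTensor H z) := by
      intro z
      induction z with
      | zero => simp
      | add x y hx hy => simp only [map_add, TensorProduct.tmul_add, hx, hy]
      | tmul x g =>
        rw [LinearMap.lTensor_tmul, TensorProduct.assoc_symm_tmul, TensorProduct.map_tmul,
          LinearMap.id_apply, rightTwistMul_tmul, LinearMap.lTensor_id, LinearMap.id_apply,
          LinearMap.rTensor_tmul, AlgHom.toLinearMap_apply]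
        generalize rho k H A x = w
        induction w with
        | zero => simp
        | add x y hx hy => simp only [map_add, TensorProduct.tmul_add, TensorProduct.add_tmul, hx, hy]
        | tmul y h => rfl
    have h2 : ∀ z : A ⊗[k] H, T ((TensorProduct.assoc k A H H).symm
        ((Coalgebra.comul : H →ₗ[k] H ⊗[k] H).lTensor A z)) =
        TensorProduct.map (TwoSided.tmul k A ∘ₗ TensorProduct.mk k A A a) (Algebra.linearMap k H)
        ((Coalgebra.counit : H →ₗ[k] k).lTensor A z) := by
      intro z
      induction z with
      | zero => simp
      | add x y hx hy => simp only [map_add, hx, hy]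
      | tmul x g =>
        simp only [T, LinearMap.comp_apply, LinearEquiv.coe_coe, LinearEquiv.apply_symm_apply,
          LinearMap.lTensor_tmul, TensorProduct.map_tmul, mul_antipode_comm_comul,
          Algebra.linearMap_apply]
    rw [rightTwist_tmul, h1, rho_rho, h2, RightComoduleAlgebra.counit]
    simp

/-- The `H`-component that arises is `a₁ a'₂ S(a'₁)`, and the last two factors cancel by
cocommutativity. Twisting by the antipode thus undoes `rightTwistMul_leftCoact`. -/
theorem rightTwistMul_codiag (q : TwoSided k A) :
    rightTwistMul (HopfAlgebra.antipode k) (codiag k H A q) = leftCoact k H A q := by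
  induction q using TwoSided.induction with
  | zero => simp
  | add x y hx hy => simp only [map_add, hx, hy]
  | tmul a a' =>
    have h1 : ∀ (x : A) (g : H) (w : A ⊗[k] H), rightTwistMul (HopfAlgebra.antipode k)
        (collect k H A ((x ⊗ₜ g) ⊗ₜ w)) = (TensorProduct.map (TwoSided.tmul k A ∘ₗ
          TensorProduct.mk k A A x) (LinearMap.mulLeft k g ∘ₗ LinearMap.mul' k H ∘ₗ
          (HopfAlgebra.antipode k : H →ₗ[k] H).lTensor H ∘ₗ (TensorProduct.comm k H H).toLinearMap))
          (TensorProduct.assoc k A H H ((rho k H A).toLinearMap.rTensor H w)) := by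
      intro x g w
      induction w with
      | zero => simp
      | add x y hx hy => simp only [map_add, TensorProduct.tmul_add, hx, hy]
      | tmul y h =>
        rw [collect_tmul, rightTwistMul_tmul, LinearMap.rTensor_tmul, AlgHom.toLinearMap_apply]
        generalize rho k H A y = w
        induction w with
        | zero => simp
        | add x y hx hy => simp only [map_add, TensorProduct.tmul_add, TensorProduct.add_tmul, hx, hy]
        | tmul y h => simp [collect_tmul, mul_assoc]
    have h2 : ∀ (x : A) (g : H) (w : A ⊗[k] H), (TensorProduct.map (TwoSided.tmul k A ∘ₗ
          TensorProduct.mk k A A x) (LinearMap.mulLeft k g ∘ₗ LinearMap.mul' k H ∘ₗ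
          (HopfAlgebra.antipode k : H →ₗ[k] H).lTensor H ∘ₗ (TensorProduct.comm k H H).toLinearMap))
          ((Coalgebra.comul : H →ₗ[k] H ⊗[k] H).lTensor A w) =
        TensorProduct.map (TwoSided.tmul k A ∘ₗ TensorProduct.mk k A A x)
          (LinearMap.mulLeft k g ∘ₗ Algebra.linearMap k H)
          ((Coalgebra.counit : H →ₗ[k] k).lTensor A w) := by
      intro x g w
      induction w with
      | zero => simp
      | add x y hx hy => simp only [map_add, hx, hy]
      | tmul y h =>
        simp only [LinearMap.comp_apply, LinearEquiv.coe_coe,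
          LinearMap.lTensor_tmul, TensorProduct.map_tmul, Coalgebra.comm_comul,
          HopfAlgebra.mul_antipode_lTensor_comul_apply, Algebra.linearMap_apply]
    rw [codiag_tmul, leftCoact_tmul]
    generalize rho k H A a = z
    induction z with
    | zero => simp
    | add x y hx hy => simp only [map_add, TensorProduct.add_tmul, hx, hy]
    | tmul x g =>
      rw [h1, RightComoduleAlgebra.coassoc, h2, RightComoduleAlgebra.counit]
      simp

variable (k H A) in
/-- The inclusion `A^{□e} → A ⊗ Aᵒᵖ`. -/
def boxTwoSided : BoxE k H A →ₐ[k] TwoSided k A := boxVal k H A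

variable (k H A) in
omit [Coalgebra.IsCocomm k H] in
theorem boxTwoSided_injective : Function.Injective (boxTwoSided k H A) := boxVal_injective k H A

/-- Twisting by `h ↦ h a'₁` carries the cotensor condition `a₀ ⊗ a' ⊗ a₁ = a ⊗ a'₀ ⊗ S(a'₁)` to `a₀
⊗ a'₀ ⊗ a₁ a'₁ = a ⊗ a' ⊗ 1`; twisting by `h ↦ h S(a'₁)` carries it back. -/
theorem codiag_eq_iff (q : TwoSided k A) :
    codiag k H A q = q ⊗ₜ 1 ↔ ∃ y, boxTwoSided k H A y = q := by
  constructor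
  · intro h
    refine ⟨⟨q, ?_⟩, rfl⟩
    change leftCoact k H A q = coactRight A (rhoOp k H A) q
    rw [← rightTwistMul_codiag, h, rightTwistMul_one, coactRight_eq_rightTwist]
  · rintro ⟨y, rfl⟩
    have hy : leftCoact k H A (boxTwoSided k H A y) =
        coactRight A (rhoOp k H A) (boxTwoSided k H A y) := y.2
    rw [← rightTwistMul_leftCoact, hy, coactRight_eq_rightTwist, rightTwistMul_rightTwist]

end Box

/-! ### The isomorphism `A^{□e} ⊗_B A ≅ A ⊗ Aᵒᵖ` -/

section BoxMul

variable {k : Type*} {H : Type*} {A : Type v} [Field k] [Ring H] [HopfAlgebra k H]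
  [Ring A] [Algebra k A] [RightComoduleAlgebra k H A]

variable (k H A) in
/-- The map `Bᵒᵖ → A^{□e}`, `b ↦ 1 ⊗ b`. -/
def envRight : (coinv k H A)ᵐᵒᵖ →ₐ[k] BoxE k H A :=
  (envIncl k H A).comp
    (Algebra.TensorProduct.includeRight : (coinv k H A)ᵐᵒᵖ →ₐ[k]
      coinv k H A ⊗[k] (coinv k H A)ᵐᵒᵖ)

theorem envRight_op (b : coinv k H A) : envRight k H A (op b) = envIncl k H A (Env.tmul 1 b) := rfl

/-- Left multiplication by `1 ⊗ b` sends `a ⊗ a'` to `a ⊗ a' b`, hence is a right action of `B`. It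
commutes with the right multiplication by `B^e`, so it survives on `A^{□e} ⊗_{B^e} A^{□e}`. -/
instance : Module (coinv k H A)ᵐᵒᵖ (BoxE k H A) :=
  Module.compHom (BoxE k H A) (envRight k H A).toRingHom

theorem op_coinv_smul_box (b : coinv k H A) (y : BoxE k H A) :
    op b • y = envRight k H A (op b) * y := rfl

instance : IsScalarTower k (coinv k H A)ᵐᵒᵖ (BoxE k H A) where
  smul_assoc c b x := by
    change envRight k H A (c • b) * x = c • (envRight k H A b * x)
    rw [map_smul, smul_mul_assoc]

theorem boxTwoSided_op_smul (b : coinv k H A) (y : BoxE k H A) :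
    (boxTwoSided k H A).toLinearMap (op b • y) = op b • (boxTwoSided k H A).toLinearMap y :=
  map_mul (boxTwoSided k H A) _ _

variable (k H A) in
/-- The map `A^{□e} ⊗_B A → A ⊗ Aᵒᵖ`, `(a ⊗ a') ⊗ c ↦ a ⊗ a' c`. -/
def boxMul : BTensor k (coinv k H A) (BoxE k H A) A →ₗ[k] TwoSided k A :=
  coinvMul (outerAct k A) (outerAct_op_coinv k A) (boxTwoSided k H A).toLinearMap
    boxTwoSided_op_smul

theorem boxMul_bijective [Coalgebra.IsCocomm k H] (hA : IsFaithfullyFlatGalois k H A) :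
    Function.Bijective (boxMul k H A) :=
  coinvMul_bijective (outerAct_op_coinv k A) (boxTwoSided k H A).toLinearMap
    boxTwoSided_op_smul hA (isHopfCoaction_codiag k H A) (boxTwoSided_injective k H A) codiag_eq_iff

end BoxMul

/-! ### Faithfully flat descent of bijectivity -/

section Reflect

variable {k : Type*} [CommRing k] {R : Type v} [Ring R] [Algebra k R]
variable {Y : Type*} [AddCommGroup Y] [Module k Y] [Module R Y]

/-- A faithfully flat module reflects isomorphisms. -/
theorem IsFaithfullyFlatLeft.bijective_of_rTensor (hY : IsFaithfullyFlatLeft k R Y)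
    {X X' : Type*} [AddCommGroup X] [Module k X]
    [Module Rᵐᵒᵖ X] [IsScalarTower k Rᵐᵒᵖ X] [AddCommGroup X'] [Module k X'] [Module Rᵐᵒᵖ X']
    [IsScalarTower k Rᵐᵒᵖ X'] [Small.{v} X] [Small.{v} X']
    (f : X →ₗ[k] X') (hf : ∀ (r : R) (x : X), f (op r • x) = op r • f x)
    (h : Function.Bijective (BTensor.rTensor f hf : BTensor k R X Y →ₗ[k] BTensor k R X' Y)) :
    Function.Bijective f := by
  let fR : X →ₗ[Rᵐᵒᵖ] X' := { f with map_smul' := fun r x => hf (unop r) x }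
  constructor
  -- The kernel tensored with `Y` embeds by flatness into `X ⊗_R Y`, where it is killed by an
  -- injective map. Hence it vanishes, and so does the kernel by faithfulness.
  · let N : Submodule Rᵐᵒᵖ X := LinearMap.ker fR
    let i : N →ₗ[k] X := N.subtype.restrictScalars k
    have hi : ∀ (r : R) (x : N), i (op r • x) = op r • i x := fun r x => rfl
    have hsm : Small.{v} N := small_of_injective (f := i) Subtype.val_injective
    refine (injective_iff_map_eq_zero f).2 fun x hx => ?_
    have h1 := hY.subsingleton N (fun z => hY.rTensor_injective i hi Subtype.val_injective (h.1 (by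
      rw [BTensor.rTensor_rTensor, map_zero, map_zero]
      refine LinearMap.congr_fun (g := 0) (BTensor.hom_ext fun x y => ?_) z
      have h2 : (f ∘ₗ i) x = 0 := x.2
      rw [BTensor.rTensor_tmul, h2]
      simp [BTensor.tmul]))) ⟨x, hx⟩
    exact congrArg Subtype.val h1
  -- The same for the cokernel, which needs only that the map becomes surjective after tensoring.
  · let N : Submodule Rᵐᵒᵖ X' := LinearMap.range fR
    let q : X' →ₗ[k] X' ⧸ N := N.mkQ.restrictScalars k
    have hq : ∀ (r : R) (x : X'), q (op r • x) = op r • q x := fun r x => rfl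
    have hsm : Small.{v} (X' ⧸ N) := small_of_surjective N.mkQ_surjective
    have h1 : ∀ z : BTensor k R X' Y, BTensor.rTensor q hq z = 0 := by
      intro z
      obtain ⟨z, rfl⟩ := h.2 z
      rw [BTensor.rTensor_rTensor]
      refine LinearMap.congr_fun (g := 0) (BTensor.hom_ext fun x y => ?_) z
      have h2 : (q ∘ₗ f) x = 0 := (Submodule.Quotient.mk_eq_zero N).2 ⟨x, rfl⟩
      rw [BTensor.rTensor_tmul, h2]
      simp [BTensor.tmul]
    have h3 : ∀ z : BTensor k R (X' ⧸ N) Y, z = 0 := by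
      intro z
      refine LinearMap.congr_fun (f := LinearMap.id) (g := 0) (BTensor.hom_ext fun x y => ?_) z
      obtain ⟨x, rfl⟩ := N.mkQ_surjective x
      exact h1 (BTensor.tmul k R x y)
    intro x
    exact (Submodule.Quotient.mk_eq_zero N).1 (hY.subsingleton (X' ⧸ N) h3 (N.mkQ x))

end Reflect

/-! ### `A^{□e}` is a Galois extension of `B^e` -/

section CanBox

variable {k : Type*} {H : Type*} {A : Type v} [Field k] [Ring H] [HopfAlgebra k H]
  [Ring A] [Algebra k A] [RightComoduleAlgebra k H A]

instance : Module (Env k H A) (BoxE k H A) :=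
  Module.compHom (BoxE k H A) (envIncl k H A).toRingHom

theorem env_smul_box (e : Env k H A) (y : BoxE k H A) : e • y = envIncl k H A e * y := rfl

variable (k H A) in
/-- The tensor product `A^{□e} ⊗_{B^e} A^{□e}`. -/
abbrev BoxSq : Type _ := BTensor k (Env k H A) (BoxE k H A) (BoxE k H A)

instance : Module (coinv k H A)ᵐᵒᵖ (BoxSq k H A) :=
  Module.compHom (BoxSq k H A) (envRight k H A).toRingHom

instance : IsScalarTower k (coinv k H A)ᵐᵒᵖ (BoxSq k H A) where
  smul_assoc c b x := by
    change envRight k H A (c • b) • x = c • (envRight k H A b • x)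
    rw [map_smul, smul_assoc]

variable (k A) in
/-- The element `1 ⊗ c` of `A ⊗ Aᵒᵖ`. -/
def rightEmb : A →ₗ[k] TwoSided k A := TwoSided.tmul k A ∘ₗ TensorProduct.mk k A A 1

variable (k A) in
/-- The element `a ⊗ 1` of `A ⊗ Aᵒᵖ`. -/
def leftEmb : A →ₗ[k] TwoSided k A := TwoSided.tmul k A ∘ₗ (TensorProduct.mk k A A).flip 1

theorem rightEmb_apply (a : A) : rightEmb k A a = TwoSided.tmul k A (1 ⊗ₜ a) := rfl

theorem leftEmb_apply (a : A) : leftEmb k A a = TwoSided.tmul k A (a ⊗ₜ 1) := rfl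

theorem rightEmb_mul_leftEmb (a a' : A) :
    rightEmb k A a' * leftEmb k A a = TwoSided.tmul k A (a ⊗ₜ a') := by
  rw [rightEmb_apply, leftEmb_apply, TwoSided.tmul_mul_tmul, one_mul, one_mul]

theorem leftEmb_mul_rightEmb (a a' : A) :
    leftEmb k A a * rightEmb k A a' = TwoSided.tmul k A (a ⊗ₜ a') := by
  rw [rightEmb_apply, leftEmb_apply, TwoSided.tmul_mul_tmul, mul_one, mul_one]

theorem rightEmb_mul (a a' : A) : rightEmb k A (a * a') = rightEmb k A a' * rightEmb k A a := by
  rw [rightEmb_apply, rightEmb_apply, rightEmb_apply, TwoSided.tmul_mul_tmul, one_mul]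

theorem leftEmb_mul (a a' : A) : leftEmb k A (a * a') = leftEmb k A a * leftEmb k A a' := by
  rw [leftEmb_apply, leftEmb_apply, leftEmb_apply, TwoSided.tmul_mul_tmul, one_mul]

theorem leftEmb_one : leftEmb k A 1 = 1 := rfl

theorem rightEmb_one : rightEmb k A 1 = 1 := rfl

theorem boxTwoSided_envIncl (b b' : coinv k H A) :
    boxTwoSided k H A (envIncl k H A (Env.tmul b b')) = TwoSided.tmul k A ((b : A) ⊗ₜ (b' : A)) :=
  rfl

theorem boxTwoSided_envRight (b : coinv k H A) :
    boxTwoSided k H A (envRight k H A (op b)) = rightEmb k A (b : A) := rfl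

theorem leftCoact_mul (p q : TwoSided k A) :
    leftCoact k H A (p * q) = leftCoact k H A p * leftCoact k H A q :=
  map_mul (coactLeft k H A Aᵐᵒᵖ) p q

/-- The coaction touches only the first tensor factor, so it is linear over `Aᵒᵖ`. -/
theorem leftCoact_rightEmb_mul (a : A) (q : TwoSided k A) :
    leftCoact k H A (rightEmb k A a * q) = (rightEmb k A a ⊗ₜ 1) * leftCoact k H A q := by
  rw [leftCoact_mul, rightEmb_apply, leftCoact_tmul, map_one, Algebra.TensorProduct.one_def]
  rfl

variable [Coalgebra.IsCocomm k H]

theorem rTensor_boxTwoSided_rho (z : BoxE k H A) :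
    (boxTwoSided k H A).toLinearMap.rTensor H (rho k H (BoxE k H A) z) =
      leftCoact k H A (boxTwoSided k H A z) := inclTensor_rho k H A z

theorem rho_envIncl (e : Env k H A) :
    rho k H (BoxE k H A) (envIncl k H A e) = envIncl k H A e ⊗ₜ 1 := by
  have h := IsCoinvAction.rho_smul_one (k := k) (H := H) (S := BoxE k H A) e
  rwa [op_env_smul, one_mul] at h

variable (k H A) in
/-- The canonical map `A^{□e} ⊗_{B^e} A^{□e} → A^{□e} ⊗ H`. -/
def canBox : BoxSq k H A →ₗ[k] BoxE k H A ⊗[k] H :=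
  BTensor.lift
    (LinearMap.mul' k (BoxE k H A ⊗[k] H) ∘ₗ TensorProduct.map
      (Algebra.TensorProduct.includeLeft : BoxE k H A →ₐ[k] BoxE k H A ⊗[k] H).toLinearMap
      (rho k H (BoxE k H A)).toLinearMap) (by
    intro y e z
    simp only [LinearMap.comp_apply, TensorProduct.map_tmul, LinearMap.mul'_apply,
      AlgHom.toLinearMap_apply, op_env_smul, env_smul_box, map_mul,
      rho_envIncl, Algebra.TensorProduct.includeLeft_apply, mul_assoc])

theorem canBox_tmul (y z : BoxE k H A) :
    canBox k H A (BTensor.tmul k (Env k H A) y z) = (y ⊗ₜ[k] 1) * rho k H (BoxE k H A) z := rfl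

theorem canBox_op_smul (b : coinv k H A) (p : BoxSq k H A) :
    canBox k H A (op b • p) = op b • canBox k H A p := by
  have h1 : ∀ w : BoxE k H A ⊗[k] H, op b • w = (envRight k H A (op b) ⊗ₜ[k] 1) * w := by
    intro w
    induction w with
    | zero => rw [smul_zero, mul_zero]
    | add x y hx hy => rw [smul_add, mul_add, hx, hy]
    | tmul y h =>
      rw [TensorProduct.smul_tmul', Algebra.TensorProduct.tmul_mul_tmul, one_mul,
        op_coinv_smul_box]
  have h2 : ∀ s : BoxE k H A, canBox k H A ∘ₗ indMul s =
      LinearMap.mulLeft k (s ⊗ₜ[k] (1 : H)) ∘ₗ canBox k H A := by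
    intro s
    refine BTensor.hom_ext fun y z => ?_
    rw [LinearMap.comp_apply, LinearMap.comp_apply, indMul_tmul, canBox_tmul, canBox_tmul,
      LinearMap.mulLeft_apply, ← mul_assoc, Algebra.TensorProduct.tmul_mul_tmul, one_mul]
  rw [h1]
  exact LinearMap.congr_fun (h2 _) p

variable (hA : IsFaithfullyFlatGalois k H A)

/-- The isomorphism `A^{□e} ⊗_B A ≃ A ⊗ Aᵒᵖ`. -/
def boxMulEquiv (hA : IsFaithfullyFlatGalois k H A) :
    BTensor k (coinv k H A) (BoxE k H A) A ≃ₗ[k] TwoSided k A :=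
  LinearEquiv.ofBijective (boxMul k H A) (boxMul_bijective hA)

theorem boxMulEquiv_tmul (y : BoxE k H A) (a : A) :
    boxMulEquiv hA (BTensor.tmul k (coinv k H A) y a) =
      rightEmb k A a * boxTwoSided k H A y := rfl

theorem boxMulEquiv_symm_mul (y : BoxE k H A) (a : A) :
    (boxMulEquiv hA).symm (rightEmb k A a * boxTwoSided k H A y) =
      BTensor.tmul k (coinv k H A) y a := by
  rw [← boxMulEquiv_tmul hA, LinearEquiv.symm_apply_apply]

/-- By `boxMul_bijective`, `A ⊗ Aᵒᵖ` is spanned by the elements `y c` with `y ∈ A^{□e}` and `c ∈ A`;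
such an element is written `rightEmb k A c * y`. -/
theorem mul_boxTwoSided_induction (hA : IsFaithfullyFlatGalois k H A) {p : TwoSided k A → Prop}
    (q : TwoSided k A) (zero : p 0)
    (add : ∀ x y, p x → p y → p (x + y))
    (mul : ∀ (a : A) (y : BoxE k H A), p (rightEmb k A a * boxTwoSided k H A y)) : p q := by
  obtain ⟨w, rfl⟩ := (boxMulEquiv hA).surjective q
  obtain ⟨w, rfl⟩ := BTensor.mk_surjective w
  induction w with
  | zero => rw [map_zero, map_zero]; exact zero
  | add x y hx hy => rw [map_add, map_add]; exact add _ _ hx hy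
  | tmul y a => exact mul a y

variable (k H A) in
/-- The map `(A^{□e} ⊗ H) ⊗_B A → (A ⊗ Aᵒᵖ) ⊗ H`, `(y ⊗ h) ⊗ c ↦ y c ⊗ h`. -/
def boxTensorMul : BTensor k (coinv k H A) (BoxE k H A ⊗[k] H) A →ₗ[k] TwoSided k A ⊗[k] H :=
  BTensor.lift (TensorProduct.lift
    ((LinearMap.mul k (TwoSided k A ⊗[k] H) ∘ₗ
      (TensorProduct.mk k (TwoSided k A) H).flip 1 ∘ₗ rightEmb k A).flip ∘ₗ
        (boxTwoSided k H A).toLinearMap.rTensor H)) (by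
    intro w b a
    simp only [TensorProduct.lift.tmul, LinearMap.comp_apply, LinearMap.flip_apply,
      TensorProduct.mk_apply, LinearMap.mul_apply', Subalgebra.smul_def, smul_eq_mul]
    induction w with
    | zero => simp
    | add x y hx hy => simp only [smul_add, map_add, mul_add, hx, hy]
    | tmul y h =>
      rw [TensorProduct.smul_tmul', LinearMap.rTensor_tmul, LinearMap.rTensor_tmul,
        Algebra.TensorProduct.tmul_mul_tmul, Algebra.TensorProduct.tmul_mul_tmul, rightEmb_mul,
        AlgHom.toLinearMap_apply, AlgHom.toLinearMap_apply, op_coinv_smul_box, map_mul,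
        boxTwoSided_envRight, mul_assoc])

omit [Coalgebra.IsCocomm k H] in
theorem boxTensorMul_tmul (w : BoxE k H A ⊗[k] H) (a : A) :
    boxTensorMul k H A (BTensor.tmul k (coinv k H A) w a) =
      (rightEmb k A a ⊗ₜ 1) * (boxTwoSided k H A).toLinearMap.rTensor H w := rfl

/-- A left inverse is obtained from `A ⊗ Aᵒᵖ ≅ A^{□e} ⊗_B A` by carrying `h` along. It serves to
transfer statements about the base-changed canonical map to the concrete space `(A ⊗ Aᵒᵖ) ⊗ H`. -/
theorem boxTensorMul_injective (hA : IsFaithfullyFlatGalois k H A) :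
    Function.Injective (boxTensorMul k H A) := by
  let j : H → BoxE k H A →ₗ[k] BoxE k H A ⊗[k] H := fun h => (TensorProduct.mk k _ H).flip h
  have hj : ∀ (h : H) (b : coinv k H A) (y : BoxE k H A), j h (op b • y) = op b • j h y :=
    fun h b y => rfl
  let G : TwoSided k A ⊗[k] H →ₗ[k] BTensor k (coinv k H A) (BoxE k H A ⊗[k] H) A :=
    TensorProduct.lift (LinearMap.mk₂ k
      (fun q h => BTensor.rTensor (j h) (hj h) ((boxMulEquiv hA).symm q))
      (fun q q' h => by simp only [map_add])
      (fun c q h => by simp only [map_smul])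
      (fun q h h' => by
        generalize (boxMulEquiv hA).symm q = w
        refine LinearMap.congr_fun (g := BTensor.rTensor (j h) (hj h) +
          BTensor.rTensor (j h') (hj h')) (BTensor.hom_ext fun y a => ?_) w
        rw [LinearMap.add_apply]
        simp only [BTensor.rTensor_tmul, j, map_add, LinearMap.add_apply, BTensor.add_tmul])
      (fun c q h => by
        generalize (boxMulEquiv hA).symm q = w
        refine LinearMap.congr_fun (g := c • BTensor.rTensor (j h) (hj h))
          (BTensor.hom_ext fun y a => ?_) w
        rw [LinearMap.smul_apply]
        simp only [BTensor.rTensor_tmul, j, map_smul, LinearMap.smul_apply, BTensor.smul_tmul']))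
  refine Function.LeftInverse.injective (g := G) fun z => ?_
  refine LinearMap.congr_fun (f := G ∘ₗ boxTensorMul k H A) (g := LinearMap.id)
    (BTensor.hom_ext fun w a => ?_) z
  rw [LinearMap.comp_apply, LinearMap.id_apply, boxTensorMul_tmul]
  induction w with
  | zero => simp [BTensor.tmul]
  | add x y hx hy => rw [map_add, mul_add, map_add, hx, hy, BTensor.add_tmul]
  | tmul y h =>
    rw [LinearMap.rTensor_tmul, Algebra.TensorProduct.tmul_mul_tmul, one_mul]
    change BTensor.rTensor (j h) (hj h) ((boxMulEquiv hA).symm _) = _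
    rw [AlgHom.toLinearMap_apply, boxMulEquiv_symm_mul]
    rfl

/-- The base change of the canonical map of `A^{□e}` along `B → A` on the right is surjective. -/
theorem boxTensorMul_canBox_surjective (hA : IsFaithfullyFlatGalois k H A) (w : TwoSided k A ⊗[k] H) :
    ∃ z, boxTensorMul k H A (BTensor.rTensor (canBox k H A) canBox_op_smul z) = w := by
  let P : Submodule k (TwoSided k A ⊗[k] H) := LinearMap.range
    (boxTensorMul k H A ∘ₗ BTensor.rTensor (canBox k H A) canBox_op_smul)
  -- For `q = y c` the element `(q ⊗ 1) ρ(z)` is the image of `(y ⊗ z) ⊗ c`.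
  have h1 : ∀ (q : TwoSided k A) (z : BoxE k H A),
      (q ⊗ₜ[k] 1) * leftCoact k H A (boxTwoSided k H A z) ∈ P := by
    intro q z
    induction q using mul_boxTwoSided_induction hA with
    | zero => rw [TensorProduct.zero_tmul, zero_mul]; exact P.zero_mem
    | add x y hx hy => rw [TensorProduct.add_tmul, add_mul]; exact P.add_mem hx hy
    | mul a y =>
      refine ⟨BTensor.tmul k _ (BTensor.tmul k _ y z) a, ?_⟩
      rw [LinearMap.comp_apply, BTensor.rTensor_tmul, boxTensorMul_tmul, canBox_tmul]
      have h2 : ∀ v : BoxE k H A ⊗[k] H, (boxTwoSided k H A).toLinearMap.rTensor H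
          ((y ⊗ₜ[k] 1) * v) =
          (boxTwoSided k H A y ⊗ₜ[k] 1) * (boxTwoSided k H A).toLinearMap.rTensor H v := by
        intro v
        induction v with
        | zero => simp
        | add x y hx hy => simp only [map_add, mul_add, hx, hy]
        | tmul x h => simp
      rw [h2, rTensor_boxTwoSided_rho, ← mul_assoc, Algebra.TensorProduct.tmul_mul_tmul, one_mul]
  -- Now `ρ` may be applied to all of `A ⊗ Aᵒᵖ`: for `p = y c` the factor `c` leaves the coaction
  -- and is absorbed into `q`.
  have h2 : ∀ (e : A) (p : TwoSided k A), (leftEmb k A e ⊗ₜ[k] 1) * leftCoact k H A p ∈ P := by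
    intro e p
    induction p using mul_boxTwoSided_induction hA with
    | zero => rw [map_zero, mul_zero]; exact P.zero_mem
    | add x y hx hy => rw [map_add, mul_add]; exact P.add_mem hx hy
    | mul a y =>
      rw [leftCoact_rightEmb_mul, ← mul_assoc, Algebra.TensorProduct.tmul_mul_tmul, one_mul]
      exact h1 _ y
  induction w with
  | zero => exact P.zero_mem
  | add x y hx hy => exact P.add_mem hx hy
  | tmul q h =>
  induction q using TwoSided.induction with
  | zero => rw [TensorProduct.zero_tmul]; exact P.zero_mem
  | add x y hx hy => rw [TensorProduct.add_tmul]; exact P.add_mem hx hy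
  | tmul e e' =>
    let J : A ⊗[k] H →ₗ[k] TwoSided k A ⊗[k] H :=
      (TwoSided.tmul k A ∘ₗ (TensorProduct.mk k A A).flip e').rTensor H
    -- An arbitrary `(e ⊗ e') ⊗ h` is reached by writing `e ⊗ h` as `can(w)`, since `a a'₀ ⊗ e' ⊗
    -- a'₁` is `a ⊗ 1` times the coaction of `a' ⊗ e'`.
    have h3 : ∀ w : BTensor k (coinv k H A) A A, J (can k H A w) ∈ P := by
      intro w
      obtain ⟨w, rfl⟩ := BTensor.mk_surjective w
      induction w with
      | zero => rw [map_zero, map_zero, map_zero]; exact P.zero_mem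
      | add x y hx hy => rw [map_add, map_add, map_add]; exact P.add_mem hx hy
      | tmul a a' =>
        have h4 : J (can k H A (BTensor.mk k _ A A (a ⊗ₜ a'))) =
            (leftEmb k A a ⊗ₜ[k] 1) * leftCoact k H A (TwoSided.tmul k A (a' ⊗ₜ e')) := by
          change J (can k H A (BTensor.tmul k _ a a')) = _
          rw [can_tmul, leftCoact_tmul]
          generalize rho k H A a' = v
          induction v with
          | zero => simp
          | add x y hx hy => simp only [map_add, TensorProduct.add_tmul, mul_add, hx, hy]
          | tmul x h =>
            simp [J, leftEmb_apply, TwoSided.tmul_mul_tmul]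
        rw [h4]
        exact h2 _ _
    obtain ⟨w, hw⟩ := hA.can_bijective.2 (e ⊗ₜ h)
    have := h3 w
    rw [hw] at this
    exact this

/-- The map `y ⊗ a ↦ (y ⊗ z) ⊗ a`. -/
def boxTmulRight (z : BoxE k H A) : BTensor k (coinv k H A) (BoxE k H A) A →ₗ[k]
    BTensor k (coinv k H A) (BoxSq k H A) A :=
  BTensor.rTensor (LinearMap.flip (LinearMap.compr₂
      (TensorProduct.mk k (BoxE k H A) (BoxE k H A)) (BTensor.mk k (Env k H A) _ _)) z)
      (fun _ _ => rfl)

omit [Coalgebra.IsCocomm k H] in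
theorem boxTmulRight_tmul (z y : BoxE k H A) (a : A) :
    boxTmulRight z (BTensor.tmul k (coinv k H A) y a) =
      BTensor.tmul k (coinv k H A) (BTensor.tmul k (Env k H A) y z) a := rfl

/-- The pairing `(q, z) ↦ ∑ (yᵢ ⊗ z) ⊗ aᵢ`, where `q = ∑ yᵢ aᵢ`. -/
def boxPair (hA : IsFaithfullyFlatGalois k H A) :
    TwoSided k A →ₗ[k] BoxE k H A →ₗ[k] BTensor k (coinv k H A) (BoxSq k H A) A :=
  LinearMap.mk₂ k (fun q z => boxTmulRight z ((boxMulEquiv hA).symm q))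
    (fun q q' h => by simp only [map_add])
    (fun c q h => by simp only [map_smul])
    (fun q z z' => by
      generalize (boxMulEquiv hA).symm q = w
      rw [← LinearMap.add_apply]
      refine LinearMap.congr_fun (BTensor.hom_ext fun y a => ?_) w
      rw [LinearMap.add_apply]
      simp only [boxTmulRight_tmul, BTensor.tmul_add, BTensor.add_tmul])
    (fun c q z => by
      generalize (boxMulEquiv hA).symm q = w
      rw [← LinearMap.smul_apply]
      refine LinearMap.congr_fun (BTensor.hom_ext fun y a => ?_) w
      rw [LinearMap.smul_apply]
      simp only [boxTmulRight_tmul, BTensor.tmul_smul, BTensor.smul_tmul'])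

theorem boxPair_mul (hA : IsFaithfullyFlatGalois k H A) (a : A) (y z : BoxE k H A) :
    boxPair hA (rightEmb k A a * boxTwoSided k H A y) z =
      BTensor.tmul k (coinv k H A) (BTensor.tmul k (Env k H A) y z) a := by
  change boxTmulRight z ((boxMulEquiv hA).symm _) = _
  rw [boxMulEquiv_symm_mul]
  rfl

/-- One of three balance properties behind the identification of `(A^{□e} ⊗_{B^e} A^{□e}) ⊗_B A`
with `(A ⊗ Aᵒᵖ) ⊗_{B ⊗ Aᵒᵖ} (A ⊗ Aᵒᵖ)`, that is with `(A ⊗_B A) ⊗ Aᵒᵖ`, where `can` can be inverted.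
Here `B^e` moves past because it acts on `A^{□e}` on the right, while `q = y c` involves a left
multiplication. -/
theorem boxPair_balanced (q : TwoSided k A) (e : Env k H A) (z : BoxE k H A) :
    boxPair hA (q * boxTwoSided k H A (envIncl k H A e)) z =
      boxPair hA q (envIncl k H A e * z) := by
  induction q using mul_boxTwoSided_induction hA with
  | zero => rw [zero_mul, map_zero]; rfl
  | add x y hx hy => rw [add_mul, map_add, map_add, LinearMap.add_apply, LinearMap.add_apply, hx, hy]
  | mul a y =>
    rw [mul_assoc, ← map_mul, boxPair_mul, boxPair_mul, ← op_env_smul, BTensor.tmul_balanced,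
      env_smul_box]

/-- The map `z ⊗ a ↦ (q a, z)`. -/
def boxPairLift (hA : IsFaithfullyFlatGalois k H A) (q : TwoSided k A) :
    BTensor k (coinv k H A) (BoxE k H A) A →ₗ[k] BTensor k (coinv k H A) (BoxSq k H A) A :=
  BTensor.lift (TensorProduct.lift (LinearMap.flip
      (boxPair hA ∘ₗ LinearMap.mulLeft k q ∘ₗ rightEmb k A))) (by
        intro z b a
        change boxPair hA (q * rightEmb k A a) (op b • z) =
          boxPair hA (q * rightEmb k A ((b : A) * a)) z
        rw [op_coinv_smul_box, envRight_op, ← boxPair_balanced, ← envRight_op,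
          boxTwoSided_envRight, rightEmb_mul, mul_assoc])

theorem boxPairLift_tmul (hA : IsFaithfullyFlatGalois k H A) (q : TwoSided k A) (z : BoxE k H A)
    (a : A) : boxPairLift hA q (BTensor.tmul k (coinv k H A) z a) =
      boxPair hA (q * rightEmb k A a) z := rfl

/-- The pairing `(q, p) ↦ ∑ (q cᵢ, zᵢ)`, where `p = ∑ zᵢ cᵢ`. -/
def twoSidedPair (hA : IsFaithfullyFlatGalois k H A) :
    TwoSided k A →ₗ[k] TwoSided k A →ₗ[k] BTensor k (coinv k H A) (BoxSq k H A) A :=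
  LinearMap.mk₂ k (fun q p => boxPairLift hA q ((boxMulEquiv hA).symm p))
    (fun q q' p => by
      generalize (boxMulEquiv hA).symm p = w
      rw [← LinearMap.add_apply]
      refine LinearMap.congr_fun (BTensor.hom_ext fun y a => ?_) w
      rw [LinearMap.add_apply]
      simp only [boxPairLift_tmul, add_mul, map_add, LinearMap.add_apply])
    (fun c q p => by
      generalize (boxMulEquiv hA).symm p = w
      rw [← LinearMap.smul_apply]
      refine LinearMap.congr_fun (BTensor.hom_ext fun y a => ?_) w
      rw [LinearMap.smul_apply]
      simp only [boxPairLift_tmul, smul_mul_assoc, map_smul, LinearMap.smul_apply])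
    (fun q p p' => by simp only [map_add])
    (fun c q p => by simp only [map_smul])

theorem twoSidedPair_mul (q : TwoSided k A) (a : A) (z : BoxE k H A) :
    twoSidedPair hA q (rightEmb k A a * boxTwoSided k H A z) =
      boxPair hA (q * rightEmb k A a) z := by
  change boxPairLift hA q ((boxMulEquiv hA).symm _) = _
  rw [boxMulEquiv_symm_mul]
  rfl

theorem twoSidedPair_rightEmb (q p : TwoSided k A) (c : A) :
    twoSidedPair hA (q * rightEmb k A c) p = twoSidedPair hA q (rightEmb k A c * p) := by
  induction p using mul_boxTwoSided_induction hA with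
  | zero => rw [mul_zero, map_zero, map_zero]
  | add x y hx hy => rw [mul_add, map_add, map_add, hx, hy]
  | mul a y =>
    rw [← mul_assoc, ← rightEmb_mul, twoSidedPair_mul, twoSidedPair_mul, rightEmb_mul, mul_assoc]

/-- The element `b ⊗ 1` comes from `B^e` and commutes with `1 ⊗ a`, so the statement reduces to
`boxPair_balanced`. Balance over `B` on the left is what makes `galoisPair` well defined on `A ⊗_B
A`. -/
theorem twoSidedPair_leftEmb (q p : TwoSided k A) (b : coinv k H A) :
    twoSidedPair hA (q * leftEmb k A (b : A)) p = twoSidedPair hA q (leftEmb k A (b : A) * p) := by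
  induction p using mul_boxTwoSided_induction hA with
  | zero => rw [mul_zero, map_zero, map_zero]
  | add x y hx hy => rw [mul_add, map_add, map_add, hx, hy]
  | mul a y =>
    have h1 : leftEmb k A (b : A) = boxTwoSided k H A (envIncl k H A (Env.tmul b 1)) := by
      rw [boxTwoSided_envIncl, leftEmb_apply]
      rfl
    rw [← mul_assoc, leftEmb_mul_rightEmb, ← rightEmb_mul_leftEmb, mul_assoc, h1, ← map_mul,
      twoSidedPair_mul, twoSidedPair_mul, ← boxPair_balanced, ← h1, mul_assoc, mul_assoc,
      leftEmb_mul_rightEmb, rightEmb_mul_leftEmb]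

/-- The map `l ⊗ r ↦ (q l, r)` on `A ⊗_B A`. -/
def galoisPair (hA : IsFaithfullyFlatGalois k H A) (q : TwoSided k A) :
    BTensor k (coinv k H A) A A →ₗ[k] BTensor k (coinv k H A) (BoxSq k H A) A :=
  BTensor.lift (TensorProduct.lift (LinearMap.compl₁₂ (twoSidedPair hA)
      (LinearMap.mulLeft k q ∘ₗ leftEmb k A) (leftEmb k A))) (by
    intro l b r
    change twoSidedPair hA (q * leftEmb k A (l * (b : A))) (leftEmb k A r) =
      twoSidedPair hA (q * leftEmb k A l) (leftEmb k A ((b : A) * r))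
    rw [leftEmb_mul, leftEmb_mul, ← twoSidedPair_leftEmb, mul_assoc])

theorem galoisPair_tmul (q : TwoSided k A) (l r : A) :
    galoisPair hA q (BTensor.tmul k (coinv k H A) l r) =
      twoSidedPair hA (q * leftEmb k A l) (leftEmb k A r) := rfl

theorem galoisPair_mul_leftEmb (q : TwoSided k A) (a : A) (w : BTensor k (coinv k H A) A A) :
    galoisPair hA (q * leftEmb k A a) w = galoisPair hA q ((canEquiv hA).symm
      ((a ⊗ₜ 1) * canEquiv hA w)) := by
  obtain ⟨w, rfl⟩ := BTensor.mk_surjective w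
  induction w with
  | zero => simp
  | add x y hx hy => simp only [map_add, mul_add, hx, hy]
  | tmul l r =>
    have h1 : (a ⊗ₜ 1) * canEquiv hA (BTensor.mk k (coinv k H A) A A (l ⊗ₜ r)) =
        canEquiv hA (BTensor.tmul k (coinv k H A) (a * l) r) := by
      change (a ⊗ₜ 1) * canEquiv hA (BTensor.tmul k (coinv k H A) l r) = _
      rw [canEquiv_tmul, canEquiv_tmul, ← mul_assoc, Algebra.TensorProduct.tmul_mul_tmul, one_mul]
    rw [h1, LinearEquiv.symm_apply_apply, galoisPair_tmul, leftEmb_mul, ← mul_assoc]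
    rfl

/-- The base change of the canonical map of `A^{□e}` along `B → A` on the right is injective. -/
theorem boxTensorMul_canBox_injective (hA : IsFaithfullyFlatGalois k H A) :
    Function.Injective
      (boxTensorMul k H A ∘ₗ BTensor.rTensor (canBox k H A) canBox_op_smul) := by
  -- The left inverse is `q ⊗ h ↦ (q (l(h) ⊗ 1), r(h) ⊗ 1)`, paired by `twoSidedPair`.
  let G : TwoSided k A ⊗[k] H →ₗ[k] BTensor k (coinv k H A) (BoxSq k H A) A :=
    TensorProduct.lift (LinearMap.mk₂ k
      (fun q h => galoisPair hA q ((canEquiv hA).symm (1 ⊗ₜ h)))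
      (fun q q' h => by
        generalize (canEquiv hA).symm (1 ⊗ₜ h) = w
        rw [← LinearMap.add_apply]
        refine LinearMap.congr_fun (BTensor.hom_ext fun y a => ?_) w
        rw [LinearMap.add_apply]
        simp only [galoisPair_tmul, add_mul, map_add, LinearMap.add_apply])
      (fun c q h => by
        generalize (canEquiv hA).symm (1 ⊗ₜ h) = w
        rw [← LinearMap.smul_apply]
        refine LinearMap.congr_fun (BTensor.hom_ext fun y a => ?_) w
        rw [LinearMap.smul_apply]
        simp only [galoisPair_tmul, smul_mul_assoc, map_smul, LinearMap.smul_apply])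
      (fun q h h' => by simp only [TensorProduct.tmul_add, map_add])
      (fun c q h => by simp only [TensorProduct.tmul_smul, map_smul]))
  have hG : ∀ (q : TwoSided k A) (h : H),
    G (q ⊗ₜ h) = galoisPair hA q ((canEquiv hA).symm (1 ⊗ₜ h)) := fun q h => rfl
  -- For `p = x ⊗ x'` this is `x₀ l(x₁) ⊗ r(x₁) = 1 ⊗ x`; the factor `x'` is then moved back to the
  -- right-hand argument.
  have h1 : ∀ q p : TwoSided k A, G ((q ⊗ₜ 1) * leftCoact k H A p) = twoSidedPair hA q p := by
    intro q p
    induction p using TwoSided.induction with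
    | zero => simp
    | add x y hx hy => simp only [map_add, mul_add, hx, hy]
    | tmul x x' =>
      have h2 : ∀ z : A ⊗[k] H, G ((q ⊗ₜ 1) * (TensorProduct.map (TwoSided.tmul k A) LinearMap.id
          (TensorProduct.rightComm k A H A (z ⊗ₜ x')))) =
          galoisPair hA (q * rightEmb k A x') ((canEquiv hA).symm z) := by
        intro z
        induction z with
        | zero => simp
        | add x y hx hy => simp only [map_add, TensorProduct.add_tmul, mul_add, hx, hy]
        | tmul x h =>
          rw [TensorProduct.rightComm_tmul, TensorProduct.map_tmul, LinearMap.id_apply,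
            Algebra.TensorProduct.tmul_mul_tmul, one_mul, hG, ← rightEmb_mul_leftEmb, ← mul_assoc,
            galoisPair_mul_leftEmb, LinearEquiv.apply_symm_apply,
            Algebra.TensorProduct.tmul_mul_tmul, mul_one, one_mul]
      rw [leftCoact_tmul, h2, ← one_mul (rho k H A x), Algebra.TensorProduct.one_def,
        ← canEquiv_tmul hA, LinearEquiv.symm_apply_apply, galoisPair_tmul, leftEmb_one, mul_one,
        twoSidedPair_rightEmb, rightEmb_mul_leftEmb]
  refine Function.LeftInverse.injective (g := G) fun t => ?_
  refine LinearMap.congr_fun (f := G ∘ₗ boxTensorMul k H A ∘ₗ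
    BTensor.rTensor (canBox k H A) canBox_op_smul) (g := LinearMap.id)
    (BTensor.hom_ext fun w a => ?_) t
  rw [LinearMap.comp_apply, LinearMap.comp_apply, LinearMap.id_apply, BTensor.rTensor_tmul,
    boxTensorMul_tmul]
  obtain ⟨w, rfl⟩ := BTensor.mk_surjective w
  induction w with
  | zero => simp [BTensor.tmul]
  | add x y hx hy => simp only [map_add, mul_add, BTensor.add_tmul, hx, hy]
  | tmul y z =>
    change G (_ * LinearMap.rTensor H _ (canBox k H A (BTensor.tmul k _ y z))) =
      BTensor.tmul k _ (BTensor.tmul k _ y z) a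
    have h2 : ∀ v : BoxE k H A ⊗[k] H, (boxTwoSided k H A).toLinearMap.rTensor H
        ((y ⊗ₜ[k] 1) * v) =
        (boxTwoSided k H A y ⊗ₜ[k] 1) * (boxTwoSided k H A).toLinearMap.rTensor H v := by
      intro v
      induction v with
      | zero => simp
      | add x y hx hy => simp only [map_add, mul_add, hx, hy]
      | tmul x h => simp
    rw [canBox_tmul, h2, rTensor_boxTwoSided_rho, ← mul_assoc,
      Algebra.TensorProduct.tmul_mul_tmul, one_mul, h1, ← one_mul (boxTwoSided k H A z),
      ← rightEmb_one, twoSidedPair_mul, rightEmb_one, mul_one, boxPair_mul]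

/-- `A^{□e}` is an `H`-Galois extension of `B^e`. -/
theorem canBox_bijective (hA : IsFaithfullyFlatGalois k H A) :
    Function.Bijective (canBox k H A) := by
  -- The universe condition for descent: by the Galois isomorphism this space is `(A ⊗ Aᵒᵖ) ⊗_B A`,
  -- and `A^{□e} ⊗ H` embeds into it.
  have hsm : Small.{v} (TwoSided k A ⊗[k] H) :=
    small_map (LinearEquiv.ofBijective _
      (galMap_bijective (outerAct k A) (outerAct_op_coinv k A) hA)).symm.toEquiv
  have hsm' : Small.{v} (BoxE k H A ⊗[k] H) :=
    small_of_injective (f := (boxTwoSided k H A).toLinearMap.rTensor H)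
      (Module.Flat.rTensor_preserves_injective_linearMap _ (boxTwoSided_injective k H A))
  refine hA.faithfullyFlat.bijective_of_rTensor (canBox k H A) canBox_op_smul ⟨?_, fun w => ?_⟩
  · exact Function.Injective.of_comp (f := boxTensorMul k H A) (boxTensorMul_canBox_injective hA)
  · obtain ⟨z, hz⟩ := boxTensorMul_canBox_surjective hA (boxTensorMul k H A w)
    exact ⟨z, boxTensorMul_injective hA hz⟩

end CanBox

/-! ### Actions on spaces of linear maps -/

section HomAct

variable {k S Q : Type*} (M : Type*) [Field k] [Ring S] [Algebra k S] [AddCommGroup Q] [Module k Q]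
  [AddCommGroup M] [Module k M]

/-- The action of `S` on `Hom(M, Q)` induced by an action on `Q`. -/
def homAct (π : S →ₐ[k] Module.End k Q) : S →ₐ[k] Module.End k (M →ₗ[k] Q) :=
  (Algebra.lsmul (A := Module.End k Q) k k (M →ₗ[k] Q)).comp π

theorem homAct_apply (π : S →ₐ[k] Module.End k Q) (s : S) (g : M →ₗ[k] Q) (m : M) :
    homAct M π s g m = π s (g m) := rfl

variable {M} {H : Type*} [Ring H] [HopfAlgebra k H]

theorem convAct_homAct_apply (π : S →ₐ[k] Module.End k Q) (f : H →ₗ[k] M →ₗ[k] Q)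
    (z : S ⊗[k] H) (m : M) : convAct (homAct M π) f z m = convAct π (f.flip m) z := by
  induction z with
  | zero => simp
  | add x y hx hy => simp only [map_add, LinearMap.add_apply, hx, hy]
  | tmul s h => rfl

end HomAct

/-! ### Endomorphism-valued maps and their convolution -/

section TensorAct

variable (k H S P : Type*) [Field k] [Ring H] [HopfAlgebra k H] [Ring S] [Algebra k S]
  [AddCommGroup P] [Module k P] [Module S P] [IsScalarTower k S P] [SMulCommClass S k P]

/-- The action of `S ⊗ H` on `P ⊗ H`. -/
def tensorLeftAct : S ⊗[k] H →ₐ[k] Module.End k (P ⊗[k] H) :=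
  (Module.endTensorEndAlgHom (R := k) (S := k) (A := k) (M := P) (N := H)).comp
    (Algebra.TensorProduct.map (Algebra.lsmul k k P) (Algebra.lsmul k k H))

variable {k H S P}

theorem tensorLeftAct_tmul (s : S) (g : H) (p : P) (h : H) :
    tensorLeftAct k H S P (s ⊗ₜ g) (p ⊗ₜ h) = (s • p) ⊗ₜ (g * h) := rfl

/-- Endomorphisms are `S`-linear, and on `H` one action multiplies on the right and the other on the
left. -/
theorem endTensor_tensorLeftAct (w : (Module.End S P)ᵐᵒᵖ ⊗[k] H) (z : S ⊗[k] H) (x : P ⊗[k] H) :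
    endTensor k H S P w (tensorLeftAct k H S P z x) =
      tensorLeftAct k H S P z (endTensor k H S P w x) := by
  induction w with
  | zero => simp
  | add a b ha hb => simp only [map_add, LinearMap.add_apply, ha, hb]
  | tmul f g =>
    induction z with
    | zero => simp
    | add a b ha hb => simp only [map_add, LinearMap.add_apply, ha, hb]
    | tmul s h =>
      induction x with
      | zero => simp
      | add a b ha hb => simp only [map_add, ha, hb]
      | tmul p h' =>
        rw [tensorLeftAct_tmul, endTensor_tmul, endTensor_tmul, tensorLeftAct_tmul, map_smul,
          mul_assoc]

/-- The pairing `p ⊗ h ↦ f(h)(p)`. -/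
def evalPair (f : H →ₗ[k] (Module.End S P)ᵐᵒᵖ) : P ⊗[k] H →ₗ[k] P :=
  TensorProduct.lift (LinearMap.flip
    (LinearMap.restrictScalarsₗ k S P P k ∘ₗ (opLinearEquiv k).symm.toLinearMap ∘ₗ f))

theorem evalPair_tmul (f : H →ₗ[k] (Module.End S P)ᵐᵒᵖ) (p : P) (h : H) :
    evalPair f (p ⊗ₜ h) = unop (f h) p := rfl

/-- The map `h ↦ f(h)(p)`. -/
def evalAt (f : H →ₗ[k] (Module.End S P)ᵐᵒᵖ) (p : P) : H →ₗ[k] P :=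
  evalPair f ∘ₗ TensorProduct.mk k P H p

theorem evalAt_apply (f : H →ₗ[k] (Module.End S P)ᵐᵒᵖ) (p : P) (h : H) :
    evalAt f p h = unop (f h) p := rfl

/-- The product is opposite to composition, so `f(h₁)` is applied before `g(h₂)`. -/
theorem unop_convMul (f g : H →ₗ[k] (Module.End S P)ᵐᵒᵖ) (h : H) (p : P) :
    unop ((WithConv.toConv f * WithConv.toConv g).ofConv h) p =
      evalPair g ((evalAt f p).rTensor H (Coalgebra.comul h)) := by
  change unop (LinearMap.mul' k _ (TensorProduct.map f g (Coalgebra.comul h))) p = _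
  generalize (Coalgebra.comul h : H ⊗[k] H) = w
  induction w with
  | zero => simp
  | add x y hx hy => simp only [map_add, unop_add, LinearMap.add_apply, hx, hy]
  | tmul a b => rfl

theorem endTensor_comul (f : H →ₗ[k] (Module.End S P)ᵐᵒᵖ) (w : H ⊗[k] H) (p : P) :
    endTensor k H S P (f.rTensor H w) (p ⊗ₜ 1) = (evalAt f p).rTensor H w := by
  induction w with
  | zero => simp
  | add x y hx hy => simp only [map_add, LinearMap.add_apply, hx, hy]
  | tmul a b => rw [LinearMap.rTensor_tmul, endTensor_tmul, one_mul]; rfl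

end TensorAct

/-! ### Induced modules and their endomorphisms -/

section Ind

variable {k H R S M : Type*} [Field k] [Ring H] [HopfAlgebra k H] [Ring S] [Algebra k S]
  [RightComoduleAlgebra k H S] [Ring R] [Module Rᵐᵒᵖ S] [SMulCommClass S Rᵐᵒᵖ S]
  [AddCommGroup M] [Module k M] [Module R M]

theorem smul_one_tmul (s : S) (m : M) :
    s • BTensor.tmul k R (1 : S) m = BTensor.tmul k R s m := by
  rw [ind_smul_tmul, mul_one]

theorem op_smul_eq_mul (r : R) (s : S) : op r • s = s * (op r • (1 : S)) := by
  rw [← smul_eq_mul s, smul_comm, smul_eq_mul, mul_one]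

theorem op_smul_one_smul (r : R) (m : M) :
    (op r • (1 : S)) • BTensor.tmul k R (1 : S) m = BTensor.tmul k R 1 (r • m) := by
  rw [smul_one_tmul, BTensor.tmul_balanced]

variable (k R S M) in
/-- The map `m ↦ 1 ⊗ m`. -/
def unitInd : M →ₗ[k] BTensor k R S M := BTensor.mk k R S M ∘ₗ TensorProduct.mk k S M 1

omit [SMulCommClass S Rᵐᵒᵖ S] in
theorem unitInd_apply (m : M) : unitInd k R S M m = BTensor.tmul k R 1 m := rfl

theorem ind_induction {p : BTensor k R S M → Prop} (x : BTensor k R S M) (zero : p 0)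
    (add : ∀ x y, p x → p y → p (x + y)) 
    (smul : ∀ (s : S) m, p (s • unitInd k R S M m)) : p x := by
  obtain ⟨x, rfl⟩ := BTensor.mk_surjective x
  induction x with
  | zero => rw [map_zero]; exact zero
  | add x y hx hy => rw [map_add]; exact add _ _ hx hy
  | tmul s m =>
    have := smul s m
    rwa [unitInd_apply, smul_one_tmul] at this

theorem end_ind_ext {f g : Module.End S (BTensor k R S M)}
    (h : ∀ m, f (unitInd k R S M m) = g (unitInd k R S M m)) : f = g := by
  refine LinearMap.ext fun x => ?_
  induction x using ind_induction with
  | zero => rw [map_zero, map_zero]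
  | add x y hx hy => rw [map_add, map_add, hx, hy]
  | smul s m => rw [map_smul, map_smul, h]

/-- The `S`-linear endomorphism `s ⊗ m ↦ s g(m)` of `S ⊗_R M`. -/
def indLift (g : M →ₗ[k] BTensor k R S M)
    (hg : ∀ (r : R) (m : M), g (r • m) = (op r • (1 : S)) • g m) :
    Module.End S (BTensor k R S M) :=
  let F : BTensor k R S M →ₗ[k] BTensor k R S M :=
    BTensor.lift (TensorProduct.lift
      ((Algebra.lsmul k k (BTensor k R S M)).toLinearMap.compl₂ g)) (by
        intro s r m
        change (op r • s) • g m = s • g (r • m)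
        rw [hg, op_smul_eq_mul, mul_smul])
  { F with
    map_smul' := fun s x => by
      have hF : ∀ s m, F (BTensor.tmul k R s m) = s • g m := fun s m => rfl
      refine LinearMap.congr_fun (f := F ∘ₗ indMul s) (g := indMul s ∘ₗ F)
        (BTensor.hom_ext fun a m => ?_) x
      rw [LinearMap.comp_apply, LinearMap.comp_apply, indMul_tmul, hF, hF]
      exact mul_smul s a (g m) }

theorem indLift_tmul (g : M →ₗ[k] BTensor k R S M)
    (hg : ∀ (r : R) (m : M), g (r • m) = (op r • (1 : S)) • g m) (s : S) (m : M) :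
    indLift g hg (BTensor.tmul k R s m) = s • g m := rfl

theorem indLift_unitInd (g : M →ₗ[k] BTensor k R S M)
    (hg : ∀ (r : R) (m : M), g (r • m) = (op r • (1 : S)) • g m) (m : M) :
    indLift g hg (unitInd k R S M m) = g m := by
  rw [unitInd_apply, indLift_tmul, one_smul]

/-- The map `h ↦ (s ⊗ m ↦ s G(h)(m))`. -/
def indEnd {V : Type*} [AddCommGroup V] [Module k V] (G : V →ₗ[k] M →ₗ[k] BTensor k R S M)
    (hG : ∀ (h : V) (r : R) (m : M), G h (r • m) = (op r • (1 : S)) • G h m) :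
    V →ₗ[k] (Module.End S (BTensor k R S M))ᵐᵒᵖ where
  toFun h := op (indLift (G h) (hG h))
  map_add' h h' := by
    rw [← op_add]
    refine congrArg op (end_ind_ext fun m => ?_)
    rw [LinearMap.add_apply, indLift_unitInd, indLift_unitInd, indLift_unitInd, map_add,
      LinearMap.add_apply]
  map_smul' c h := by
    rw [RingHom.id_apply, ← op_smul]
    refine congrArg op (end_ind_ext fun m => ?_)
    rw [LinearMap.smul_apply, indLift_unitInd, indLift_unitInd, map_smul, LinearMap.smul_apply]

theorem unop_indEnd_unitInd {V : Type*} [AddCommGroup V] [Module k V]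
    (G : V →ₗ[k] M →ₗ[k] BTensor k R S M)
    (hG : ∀ (h : V) (r : R) (m : M), G h (r • m) = (op r • (1 : S)) • G h m) (h : V)
    (m : M) : unop (indEnd G hG h) (unitInd k R S M m) = G h m := indLift_unitInd _ (hG h) m

variable [IsCoinvAction k H R S]

theorem indCoact_smul (s : S) (p : BTensor k R S M) :
    indCoact k H R S M (s • p) =
      tensorLeftAct k H S (BTensor k R S M) (rho k H S s) (indCoact k H R S M p) := by
  refine LinearMap.congr_fun (f := indCoact k H R S M ∘ₗ indMul s)
    (g := tensorLeftAct k H S (BTensor k R S M) (rho k H S s) ∘ₗ indCoact k H R S M)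
    (BTensor.hom_ext fun a m => ?_) p
  rw [LinearMap.comp_apply, LinearMap.comp_apply, indMul_tmul, indCoact_tmul, indCoact_tmul,
    map_mul]
  generalize rho k H S s = z
  generalize rho k H S a = w
  induction z with
  | zero => simp
  | add x y hx hy =>
    simp only [add_mul, map_add, TensorProduct.add_tmul, LinearMap.add_apply, hx, hy]
  | tmul s g =>
    induction w with
    | zero => simp
    | add x y hx hy => simp only [mul_add, map_add, TensorProduct.add_tmul, hx, hy]
    | tmul a h =>
      rw [Algebra.TensorProduct.tmul_mul_tmul, TensorProduct.rightComm_tmul,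
        TensorProduct.rightComm_tmul, LinearMap.rTensor_tmul, LinearMap.rTensor_tmul,
        tensorLeftAct_tmul]
      rfl

theorem indCoact_unitInd (m : M) :
    indCoact k H R S M (unitInd k R S M m) = unitInd k R S M m ⊗ₜ 1 := by
  rw [unitInd_apply, indCoact_tmul, map_one]
  rfl

theorem indCoact_smul_unitInd (s : S) (m : M) :
    indCoact k H R S M (s • unitInd k R S M m) =
      tensorLeftAct k H S (BTensor k R S M) (rho k H S s) (unitInd k R S M m ⊗ₜ 1) := by
  rw [indCoact_smul, indCoact_unitInd]

/-- It is enough to test on `1 ⊗ m`: these elements generate over `S`, and both sides are semilinear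
with respect to the coaction of `S`. -/
theorem isCoactionOf_ind {f : (Module.End S (BTensor k R S M))ᵐᵒᵖ}
    {w : (Module.End S (BTensor k R S M))ᵐᵒᵖ ⊗[k] H}
    (h : ∀ m, indCoact k H R S M (unop f (unitInd k R S M m)) =
      endTensor k H S _ w (unitInd k R S M m ⊗ₜ 1)) :
    IsCoactionOf (indCoact k H R S M) f w := by
  intro p
  induction p using ind_induction with
  | zero => simp
  | add x y hx hy => simp only [map_add, hx, hy]
  | smul s m =>
    rw [map_smul, indCoact_smul, h, indCoact_smul_unitInd, endTensor_tensorLeftAct]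

/-- For `p = s (1 ⊗ m)` the expression `f(p₁)(p₀)` takes the form `s₀ f(s₁)(1 ⊗ m)`. Uniqueness for
Galois extensions then applies to it. -/
theorem evalPair_indCoact (f : H →ₗ[k] (Module.End S (BTensor k R S M))ᵐᵒᵖ) (s : S) (m : M) :
    evalPair f (indCoact k H R S M (s • unitInd k R S M m)) =
      convAct (Algebra.lsmul k k (BTensor k R S M)) (evalAt f (unitInd k R S M m))
        (rho k H S s) := by
  rw [indCoact_smul_unitInd]
  generalize rho k H S s = z
  induction z with
  | zero => simp
  | add x y hx hy => simp only [map_add, LinearMap.add_apply, hx, hy]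
  | tmul a h =>
    rw [tensorLeftAct_tmul, evalPair_tmul, map_smul, mul_one]
    rfl

end Ind

/-! ### An antipode identity -/

section Antipode

variable {k H : Type*} [Field k] [Ring H] [HopfAlgebra k H]

/-- `h₁ S(h₂) ⊗ h₃ = 1 ⊗ h`. -/
theorem mul_antipode_comul_comul (h : H) :
    (LinearMap.mul' k H ∘ₗ (HopfAlgebra.antipode k : H →ₗ[k] H).lTensor H).rTensor H
      ((TensorProduct.assoc k H H H).symm
        ((Coalgebra.comul : H →ₗ[k] H ⊗[k] H).lTensor H (Coalgebra.comul h))) = 1 ⊗ₜ[k] h := by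
  rw [Coalgebra.coassoc_symm_apply, ← LinearMap.rTensor_comp_apply, LinearMap.comp_assoc,
    HopfAlgebra.mul_antipode_lTensor_comul, LinearMap.rTensor_comp_apply,
    Coalgebra.rTensor_counit_comul]
  simp

end Antipode

/-! ### The cleaving map and its convolution inverse -/

section Cleaving

variable {k H R S M : Type*} [Field k] [Ring H] [HopfAlgebra k H] [Ring S] [Algebra k S]
  [RightComoduleAlgebra k H S] [Ring R] [Module Rᵐᵒᵖ S] [SMulCommClass S Rᵐᵒᵖ S]
  [AddCommGroup M] [Module k M] [Module R M] [IsCoinvAction k H R S]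

/-- `φ : S ⊗_R M → M ⊗ H` is an isomorphism of left `R`-modules and right `H`-comodules. -/
structure IsIndStable (φ : BTensor k R S M ≃ₗ[k] M ⊗[k] H) : Prop where
  symm_smul : ∀ (r : R) (m : M) (h : H),
    φ.symm ((r • m) ⊗ₜ h) = (op r • (1 : S)) • φ.symm (m ⊗ₜ h)
  coact_symm : ∀ (m : M) (h : H), indCoact k H R S M (φ.symm (m ⊗ₜ h)) =
    (φ.symm.toLinearMap ∘ₗ TensorProduct.mk k M H m).rTensor H (Coalgebra.comul h)

variable {φ : BTensor k R S M ≃ₗ[k] M ⊗[k] H} (hφ : IsIndStable φ)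

/-- The map `t(h)(s ⊗ m) = s φ⁻¹(m ⊗ h)`. -/
def cleaving : H →ₗ[k] (Module.End S (BTensor k R S M))ᵐᵒᵖ :=
  indEnd ((TensorProduct.mk k M H).flip.compr₂ φ.symm.toLinearMap)
    (fun h r m => hφ.symm_smul r m h)

theorem unop_cleaving_tmul (h : H) (s : S) (m : M) :
    unop (cleaving hφ h) (BTensor.tmul k R s m) = s • φ.symm (m ⊗ₜ h) := rfl

theorem unop_cleaving_unitInd (h : H) (m : M) :
    unop (cleaving hφ h) (unitInd k R S M m) = φ.symm (m ⊗ₜ h) := unop_indEnd_unitInd _ _ _ _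

theorem evalAt_cleaving (m : M) : evalAt (cleaving hφ) (unitInd k R S M m) =
    φ.symm.toLinearMap ∘ₗ TensorProduct.mk k M H m :=
  LinearMap.ext fun h => unop_cleaving_unitInd hφ h m

theorem isCoactionOf_cleaving (h : H) : IsCoactionOf (indCoact k H R S M) (cleaving hφ h)
    ((cleaving hφ).rTensor H (Coalgebra.comul h)) := by
  refine isCoactionOf_ind fun m => ?_
  rw [endTensor_comul, evalAt_cleaving, unop_cleaving_unitInd, hφ.coact_symm]

/-- Convolution with `t` on the left. -/
theorem cleaving_convMul (f : H →ₗ[k] (Module.End S (BTensor k R S M))ᵐᵒᵖ) (h : H) (m : M) :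
    unop ((WithConv.toConv (cleaving hφ) * WithConv.toConv f).ofConv h) (unitInd k R S M m) =
      evalPair f (indCoact k H R S M (φ.symm (m ⊗ₜ h))) := by
  rw [unop_convMul, evalAt_cleaving, hφ.coact_symm]

/-- The map `(M ⊗ ε) φ : S ⊗_R M → M`. -/
def counitInd (φ : BTensor k R S M ≃ₗ[k] M ⊗[k] H) : BTensor k R S M →ₗ[k] M :=
  (TensorProduct.rid k M).toLinearMap ∘ₗ (Coalgebra.counit : H →ₗ[k] k).lTensor M ∘ₗ
    φ.toLinearMap

omit [RightComoduleAlgebra k H S] [SMulCommClass S Rᵐᵒᵖ S] [IsCoinvAction k H R S] in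
theorem counitInd_symm (m : M) (h : H) :
    counitInd φ (φ.symm (m ⊗ₜ h)) = (Coalgebra.counit h : k) • m := by
  simp [counitInd]

include hφ in
theorem counitInd_smul [SMulCommClass R k M] (r : R) (p : BTensor k R S M) :
    counitInd φ ((op r • (1 : S)) • p) = r • counitInd φ p := by
  obtain ⟨z, rfl⟩ := φ.symm.surjective p
  induction z with
  | zero => simp
  | add x y hx hy => simp only [map_add, smul_add, hx, hy]
  | tmul m h => rw [← hφ.symm_smul, counitInd_symm, counitInd_symm, smul_comm r]

variable [Module R S] (hRS : ∀ (r : R) (s : S), r • s = (op r • (1 : S)) * s)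
  (e : BTensor k R S S ≃ₗ[k] S ⊗[k] H)
  (he : ∀ s s', e (BTensor.tmul k R s s') = (s ⊗ₜ[k] 1) * rho k H S s')

variable (φ) in
/-- The map `s ↦ (m ↦ 1 ⊗ (M ⊗ ε)φ(s ⊗ m))`. -/
def counitUnit : S →ₗ[k] M →ₗ[k] BTensor k R S M :=
  (TensorProduct.mk k S M).compr₂ (unitInd k R S M ∘ₗ counitInd φ ∘ₗ BTensor.mk k R S M)

omit [Module R S] [RightComoduleAlgebra k H S] [SMulCommClass S Rᵐᵒᵖ S] [IsCoinvAction k H R S] in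
theorem counitUnit_apply (s : S) (m : M) :
    counitUnit φ s m = unitInd k R S M (counitInd φ (BTensor.tmul k R s m)) := rfl

include hφ hRS in
theorem counitUnit_smul [SMulCommClass R k M] (r : R) (s : S) (m : M) :
    counitUnit φ (r • s) m = (op r • (1 : S)) • counitUnit φ s m := by
  rw [counitUnit_apply, counitUnit_apply, unitInd_apply, unitInd_apply, op_smul_one_smul,
    ← counitInd_smul hφ, ind_smul_tmul, hRS]

variable [SMulCommClass R k M]

/-- The map `s ⊗ s' ↦ (m ↦ s ⊗ (M ⊗ ε)φ(s' ⊗ m))`. -/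
def counitSq : BTensor k R S S →ₗ[k] M →ₗ[k] BTensor k R S M :=
  BTensor.lift (TensorProduct.lift
    ((homAct M (Algebra.lsmul k k (BTensor k R S M))).toLinearMap.compl₂ (counitUnit φ))) (by
      intro s r s'
      refine LinearMap.ext fun m => ?_
      change (op r • s) • counitUnit φ s' m = s • counitUnit φ (r • s') m
      rw [counitUnit_smul hφ hRS, op_smul_eq_mul, mul_smul])

theorem counitSq_tmul (s s' : S) (m : M) :
    counitSq hφ hRS (BTensor.tmul k R s s') m = s • counitUnit φ s' m := rfl

/-- The map `u(h)(m) = ∑ lᵢ ⊗ (M ⊗ ε)φ(rᵢ ⊗ m)`, where `∑ lᵢ ⊗ rᵢ = can⁻¹(1 ⊗ h)`. -/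
def cocleaving : H →ₗ[k] M →ₗ[k] BTensor k R S M :=
  counitSq hφ hRS ∘ₗ e.symm.toLinearMap ∘ₗ TensorProduct.mk k S H 1

-- The property for which `u` is made: `s₀ u(s₁)(1 ⊗ m) = 1 ⊗ (M ⊗ ε)φ(s ⊗ m)`. As in the case of
-- `mu`, all that follows about `u` rests on it.
include he in
theorem convAct_cocleaving (s : S) :
    convAct (homAct M (Algebra.lsmul k k (BTensor k R S M))) (cocleaving hφ hRS e) (rho k H S s) =
      counitUnit φ s := by
  rw [cocleaving, convAct_rho_of_equiv e he]
  · refine LinearMap.ext fun m => ?_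
    rw [counitSq_tmul, one_smul]
  · intro s s' s''
    refine LinearMap.ext fun m => ?_
    rw [counitSq_tmul, homAct_apply, counitSq_tmul, mul_smul]
    rfl

-- Paired with `ρ(s)`, both sides become `1 ⊗ (M ⊗ ε)φ(s r ⊗ m)`: on the left by balancedness, on
-- the right because `r` acts through coinvariants. Hence `u(h)` extends to `S ⊗_R M`.
include he in
theorem cocleaving_smul (h : H) (r : R) (m : M) :
    cocleaving hφ hRS e h (r • m) = (op r • (1 : S)) • cocleaving hφ hRS e h m := by
  have h1 : (cocleaving hφ hRS e).flip (r • m) =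
      (Algebra.lsmul k k (BTensor k R S M) (op r • (1 : S)) : Module.End k _) ∘ₗ
        (cocleaving hφ hRS e).flip m := by
    refine eq_of_convAct_rho e.toLinearMap he e.surjective
      (Algebra.lsmul k k (BTensor k R S M)) fun s => ?_
    have h2 : ∀ z : S ⊗[k] H, convAct (Algebra.lsmul k k (BTensor k R S M))
        ((Algebra.lsmul k k (BTensor k R S M) (op r • (1 : S)) : Module.End k _) ∘ₗ
          (cocleaving hφ hRS e).flip m) z =
        convAct (Algebra.lsmul k k (BTensor k R S M)) ((cocleaving hφ hRS e).flip m)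
          (z * ((op r • (1 : S)) ⊗ₜ 1)) := by
      intro z
      induction z with
      | zero => simp
      | add x y hx hy => simp only [map_add, add_mul, hx, hy]
      | tmul a g =>
        rw [Algebra.TensorProduct.tmul_mul_tmul, convAct_tmul, convAct_tmul, map_mul, mul_one]
        rfl
    rw [h2, ← IsCoinvAction.rho_smul_one, ← map_mul, ← op_smul_eq_mul, ← convAct_homAct_apply,
      ← convAct_homAct_apply, convAct_cocleaving hφ hRS e he, convAct_cocleaving hφ hRS e he,
      counitUnit_apply, counitUnit_apply, BTensor.tmul_balanced]
  exact LinearMap.congr_fun h1 h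

-- The coaction of `u(h)` has to be `u(h₂) ⊗ S(h₁)`. Paired with `ρ(s)`, this gives `s₀ u(s₃)(1 ⊗ m)
-- ⊗ s₁ S(s₂) = s₀ u(s₁)(1 ⊗ m) ⊗ 1`, and the coaction of `s₀ u(s₁)(1 ⊗ m)` is the same because that
-- element lies in `1 ⊗ M`.
include he in
theorem coact_cocleaving [Coalgebra.IsCocomm k H] (h : H) (m : M) :
    indCoact k H R S M (cocleaving hφ hRS e h m) =
      TensorProduct.map ((cocleaving hφ hRS e).flip m) (HopfAlgebra.antipode k)
        (TensorProduct.comm k H H (Coalgebra.comul h)) := by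
  let π : S →ₐ[k] Module.End k (BTensor k R S M ⊗[k] H) :=
    (tensorLeftAct k H S (BTensor k R S M)).comp (rho k H S)
  let f : H →ₗ[k] BTensor k R S M := (cocleaving hφ hRS e).flip m
  let G : H ⊗[k] H →ₗ[k] BTensor k R S M ⊗[k] H :=
    TensorProduct.map f (HopfAlgebra.antipode k) ∘ₗ (TensorProduct.comm k H H).toLinearMap
  have h1 : indCoact k H R S M ∘ₗ f = G ∘ₗ Coalgebra.comul := by
    refine eq_of_convAct_rho e.toLinearMap he e.surjective π fun s => ?_
    have h2 : ∀ z : S ⊗[k] H, convAct π (indCoact k H R S M ∘ₗ f) z =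
        indCoact k H R S M (convAct (Algebra.lsmul k k (BTensor k R S M)) f z) := by
      intro z
      induction z with
      | zero => simp
      | add x y hx hy => simp only [map_add, hx, hy]
      | tmul a g => exact (indCoact_smul a (f g)).symm
    let J : (S ⊗[k] H) ⊗[k] H →ₗ[k] BTensor k R S M ⊗[k] H :=
      TensorProduct.lift (LinearMap.compl₂ (tensorLeftAct k H S (BTensor k R S M)).toLinearMap
        (G ∘ₗ Coalgebra.comul))
    have h3 : ∀ z : S ⊗[k] H, convAct π (G ∘ₗ Coalgebra.comul) z =
        J ((rho k H S).toLinearMap.rTensor H z) := by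
      intro z
      induction z with
      | zero => simp
      | add x y hx hy => simp only [map_add, hx, hy]
      | tmul a g => rfl
    have h4 : ∀ z : S ⊗[k] H, J ((TensorProduct.assoc k S H H).symm
        ((Coalgebra.comul : H →ₗ[k] H ⊗[k] H).lTensor S z)) =
        convAct (Algebra.lsmul k k (BTensor k R S M)) f z ⊗ₜ 1 := by
      intro z
      induction z with
      | zero => simp
      | add x y hx hy => simp only [map_add, TensorProduct.add_tmul, hx, hy]
      | tmul a g =>
        let N : H ⊗[k] H →ₗ[k] BTensor k R S M ⊗[k] H :=
          (TensorProduct.map ((Algebra.lsmul k k (BTensor k R S M) a : Module.End k _) ∘ₗ f)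
            LinearMap.id) ∘ₗ (TensorProduct.comm k H H).toLinearMap
        have h5 : ∀ x : H ⊗[k] H, J ((TensorProduct.assoc k S H H).symm (a ⊗ₜ x)) =
            N ((LinearMap.mul' k H ∘ₗ (HopfAlgebra.antipode k : H →ₗ[k] H).lTensor H).rTensor H
              ((TensorProduct.assoc k H H H).symm
                ((Coalgebra.comul : H →ₗ[k] H ⊗[k] H).lTensor H x))) := by
          intro x
          induction x with
          | zero => simp
          | add x y hx hy => simp only [map_add, TensorProduct.tmul_add, hx, hy]
          | tmul x y =>
            rw [TensorProduct.assoc_symm_tmul, LinearMap.lTensor_tmul]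
            change tensorLeftAct k H S (BTensor k R S M) (a ⊗ₜ x) (G (Coalgebra.comul y)) = _
            generalize (Coalgebra.comul y : H ⊗[k] H) = w
            induction w with
            | zero => simp
            | add x y hx hy => simp only [map_add, TensorProduct.tmul_add, hx, hy]
            | tmul y z => rfl
        rw [LinearMap.lTensor_tmul, h5, mul_antipode_comul_comul]
        rfl
    have h6 : convAct (Algebra.lsmul k k (BTensor k R S M)) f (rho k H S s) = counitUnit φ s m := by
      rw [← convAct_homAct_apply, convAct_cocleaving hφ hRS e he]
    rw [h2, h3, rho_rho, h4, h6, counitUnit_apply, indCoact_unitInd]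
  exact LinearMap.congr_fun h1 h

/-- The convolution inverse of the cleaving map. -/
def cleavingInv : H →ₗ[k] (Module.End S (BTensor k R S M))ᵐᵒᵖ :=
  indEnd (cocleaving hφ hRS e) (cocleaving_smul hφ hRS e he)

theorem evalAt_cleavingInv (m : M) : evalAt (cleavingInv hφ hRS e he) (unitInd k R S M m) =
    (cocleaving hφ hRS e).flip m :=
  LinearMap.ext fun h => unop_indEnd_unitInd _ (cocleaving_smul hφ hRS e he) h m

theorem isCoactionOf_cleavingInv [Coalgebra.IsCocomm k H] (h : H) :
    IsCoactionOf (indCoact k H R S M) (cleavingInv hφ hRS e he h)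
      (TensorProduct.map (cleavingInv hφ hRS e he) (HopfAlgebra.antipode k)
        (TensorProduct.comm k H H (Coalgebra.comul h))) := by
  refine isCoactionOf_ind fun m => ?_
  rw [cleavingInv, unop_indEnd_unitInd, coact_cocleaving hφ hRS e he, ← evalAt_cleavingInv hφ hRS e he]
  generalize TensorProduct.comm k H H (Coalgebra.comul h) = w
  induction w with
  | zero => simp
  | add x y hx hy => simp only [map_add, LinearMap.add_apply, hx, hy]
  | tmul x y =>
    rw [TensorProduct.map_tmul, TensorProduct.map_tmul, endTensor_tmul, one_mul]
    rfl

theorem evalPair_cleavingInv (p : BTensor k R S M) :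
    evalPair (cleavingInv hφ hRS e he) (indCoact k H R S M p) =
      unitInd k R S M (counitInd φ p) := by
  induction p using ind_induction with
  | zero => simp
  | add x y hx hy => simp only [map_add, hx, hy]
  | smul s m =>
    rw [evalPair_indCoact, evalAt_cleavingInv, ← convAct_homAct_apply,
      convAct_cocleaving hφ hRS e he, counitUnit_apply, unitInd_apply m, smul_one_tmul]

/-- With `p = φ⁻¹(m ⊗ h)`, the value on `1 ⊗ m` is `u(p₁)(p₀) = 1 ⊗ (M ⊗ ε)φ(p) = ε(h) (1 ⊗ m)`. -/
theorem cleaving_mul_cleavingInv :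
    WithConv.toConv (cleaving hφ) * WithConv.toConv (cleavingInv hφ hRS e he) = 1 := by
  apply WithConv.ofConv_injective
  refine LinearMap.ext fun h => unop_injective (end_ind_ext fun m => ?_)
  rw [cleaving_convMul, evalPair_cleavingInv, counitInd_symm, map_smul]
  rfl

-- Left convolution by `t` is injective. As every `p` is a sum of elements `φ⁻¹(m ⊗ h)`, `t * f = 0`
-- means `f(p₁)(p₀) = 0` for all `p`. Taking `p = s (1 ⊗ m)`, the Galois property gives `f = 0`.
omit [SMulCommClass R k M] in
include hφ e he in
theorem eq_zero_of_evalPair {f : H →ₗ[k] (Module.End S (BTensor k R S M))ᵐᵒᵖ}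
    (hf : WithConv.toConv (cleaving hφ) * WithConv.toConv f = 0) : f = 0 := by
  have h1 : ∀ p : BTensor k R S M, evalPair f (indCoact k H R S M p) = 0 := by
    intro p
    obtain ⟨z, rfl⟩ := φ.symm.surjective p
    induction z with
    | zero => simp
    | add x y hx hy => simp only [map_add, hx, hy, add_zero]
    | tmul m h =>
      rw [← cleaving_convMul hφ, hf]
      rfl
  refine LinearMap.ext fun h => unop_injective (end_ind_ext fun m => ?_)
  have h2 : evalAt f (unitInd k R S M m) = 0 := by
    refine eq_of_convAct_rho e.toLinearMap he e.surjective
      (Algebra.lsmul k k (BTensor k R S M)) fun s => ?_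
    rw [← evalPair_indCoact, h1]
    generalize rho k H S s = z
    induction z with
    | zero => simp
    | add x y hx hy => rw [map_add, ← hx, ← hy, add_zero]
    | tmul a h => rw [convAct_tmul, LinearMap.zero_apply, map_zero]
  exact LinearMap.congr_fun h2 h

/-- A right inverse of a left cancellable element is two-sided: `t * (u * t - 1) = (t * u) * t - t =
0`. -/
theorem cleavingInv_mul_cleaving :
    WithConv.toConv (cleavingInv hφ hRS e he) * WithConv.toConv (cleaving hφ) = 1 := by
  have h1 := cleaving_mul_cleavingInv hφ hRS e he
  have h2 : WithConv.toConv (cleaving hφ) *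
      (WithConv.toConv (cleavingInv hφ hRS e he) * WithConv.toConv (cleaving hφ) - 1) = 0 := by
    rw [mul_sub, ← mul_assoc, h1, one_mul, mul_one, sub_self]
  have h3 := eq_zero_of_evalPair hφ e he
    (f := (WithConv.toConv (cleavingInv hφ hRS e he) * WithConv.toConv (cleaving hφ) - 1).ofConv) h2
  rw [← sub_eq_zero]
  exact WithConv.ofConv_injective h3

end Cleaving

/-! ### Bimodule endomorphisms of an invertible bimodule -/

section Morita

variable {k R M N : Type*} [CommRing k] [Ring R] [Algebra k R]
  [AddCommGroup M] [Module k M] [Module R M] [Module Rᵐᵒᵖ M]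
  [AddCommGroup N] [Module k N] [Module R N] [Module Rᵐᵒᵖ N]

/-- An endomorphism `g` of the bimodule `M` is left multiplication by `∑ α(g(mᵢ) ⊗ nᵢ)`, where
`∑ α(mᵢ ⊗ nᵢ) = 1`. -/
theorem StrictMoritaContext.α_rTensor_smul (C : StrictMoritaContext k R M N) (g : M →ₗ[k] M)
    (hg : ∀ (r : R) (m : M), g (op r • m) = op r • g m) (z : BTensor k R M N) (m : M) :
    C.α (BTensor.rTensor g hg z) • m = g (C.α z • m) := by
  obtain ⟨z, rfl⟩ := BTensor.mk_surjective z
  induction z with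
  | zero => simp
  | add x y hx hy => simp only [map_add, add_smul, hx, hy]
  | tmul m' n =>
    change C.α (BTensor.tmul k R (g m') n) • m = g (C.α (BTensor.tmul k R m' n) • m)
    rw [C.α_smul, C.α_smul, hg]

/-- `1` is in the image of `α`, and `r α(m ⊗ n) = α(r m ⊗ n) = 0`. -/
theorem StrictMoritaContext.eq_zero_of_smul (C : StrictMoritaContext k R M N) {r : R}
    (hr : ∀ m : M, r • m = 0) : r = 0 := by
  have h1 : ∀ z : BTensor k R M N, r * C.α z = 0 := by
    intro z
    obtain ⟨z, rfl⟩ := BTensor.mk_surjective z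
    induction z with
    | zero => simp
    | add x y hx hy => rw [map_add, map_add, mul_add, hx, hy, add_zero]
    | tmul m n =>
      change r * C.α (BTensor.tmul k R m n) = 0
      rw [← C.α_left, hr]
      simp [BTensor.tmul]
  rw [← h1 (C.α.symm 1), C.α.apply_symm_apply, mul_one]

/-- Right linearity makes `g` a left multiplication; left linearity makes the multiplier commute
with `R` on `M`, hence in `R`, since `M` is faithful. -/
theorem StrictMoritaContext.exists_center_smul (C : StrictMoritaContext k R M N) (g : M →ₗ[k] M)
    (hl : ∀ (r : R) (m : M), g (r • m) = r • g m)
    (hg : ∀ (r : R) (m : M), g (op r • m) = op r • g m) :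
    ∃ x : Subalgebra.center k R, ∀ m, g m = (x : R) • m := by
  have h1 : ∀ m, g m = C.α (BTensor.rTensor g hg (C.α.symm 1)) • m := by
    intro m
    rw [C.α_rTensor_smul, C.α.apply_symm_apply, one_smul]
  refine ⟨⟨_, Subalgebra.mem_center_iff.2 fun b => ?_⟩, h1⟩
  refine sub_eq_zero.1 (C.eq_zero_of_smul fun m => ?_)
  rw [sub_smul, mul_smul, mul_smul, ← h1, ← h1, hl, sub_self]

end Morita

/-! ### Convolution of maps into the rational endomorphisms -/

section Rational

variable {k H S P : Type*} [Field k] [Ring H] [HopfAlgebra k H] [Ring S] [Algebra k S]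
  [AddCommGroup P] [Module k P] [Module S P] [IsScalarTower k S P] [SMulCommClass S k P]
  {ρ : P →ₗ[k] P ⊗[k] H}

theorem val_convMul (f g : H →ₗ[k] rationalEnd S ρ) :
    WithConv.toConv ((rationalEnd S ρ).val.toLinearMap ∘ₗ f) *
        WithConv.toConv ((rationalEnd S ρ).val.toLinearMap ∘ₗ g) =
      WithConv.toConv ((rationalEnd S ρ).val.toLinearMap ∘ₗ
        (WithConv.toConv f * WithConv.toConv g).ofConv) := by
  apply WithConv.ofConv_injective
  refine LinearMap.ext fun h => ?_
  change LinearMap.mul' k _ (TensorProduct.map ((rationalEnd S ρ).val.toLinearMap ∘ₗ f)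
    ((rationalEnd S ρ).val.toLinearMap ∘ₗ g) (Coalgebra.comul h)) =
      (rationalEnd S ρ).val (LinearMap.mul' k _ (TensorProduct.map f g (Coalgebra.comul h)))
  generalize (Coalgebra.comul h : H ⊗[k] H) = w
  induction w with
  | zero => simp
  | add x y hx hy => simp only [map_add, hx, hy]
  | tmul a b => rfl

theorem val_comp_injective {f g : H →ₗ[k] rationalEnd S ρ}
    (h : (rationalEnd S ρ).val.toLinearMap ∘ₗ f = (rationalEnd S ρ).val.toLinearMap ∘ₗ g) :
    f = g :=
  LinearMap.ext fun x => Subtype.ext (LinearMap.congr_fun h x)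

theorem convMul_eq_one_of_val {f g : H →ₗ[k] rationalEnd S ρ}
    (h : WithConv.toConv ((rationalEnd S ρ).val.toLinearMap ∘ₗ f) *
        WithConv.toConv ((rationalEnd S ρ).val.toLinearMap ∘ₗ g) = 1) :
    WithConv.toConv f * WithConv.toConv g = 1 := by
  rw [val_convMul] at h
  exact WithConv.ofConv_injective (val_comp_injective (congrArg WithConv.ofConv h))

end Rational

/-! ### Convolution inverses and the induced action -/

section Convolution

variable {k H E : Type*} [Field k] [Ring H] [HopfAlgebra k H] [Ring E] [Algebra k E]

theorem IsConvInverse.mul_one {t u : H →ₗ[k] E} (h : IsConvInverse t u) : t 1 * u 1 = 1 := by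
  have h1 := LinearMap.congr_fun (congrArg WithConv.ofConv h.1) 1
  have h2 : (WithConv.toConv t * WithConv.toConv u).ofConv 1 =
    LinearMap.mul' k E (TensorProduct.map t u (Coalgebra.comul 1)) := rfl
  rw [h2, Bialgebra.comul_one, Algebra.TensorProduct.one_def, TensorProduct.map_tmul,
    LinearMap.mul'_apply] at h1
  rw [h1]
  change algebraMap k E (Coalgebra.counit (1 : H)) = 1
  rw [Bialgebra.counit_one, map_one]

theorem IsConvInverse.symm {t u : H →ₗ[k] E} (h : IsConvInverse t u) : IsConvInverse u t :=
  ⟨h.2, h.1⟩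

/-- Replacing `t` by `u(1) t` makes its value at `1` equal to `u(1) t(1) = 1`. The left factor
`u(1)` is the one that keeps `t` colinear when `u(1)` is coinvariant. -/
theorem IsConvInverse.normalize {t u : H →ₗ[k] E} (h : IsConvInverse t u) :
    IsConvInverse (LinearMap.mulLeft k (u 1) ∘ₗ t) (LinearMap.mulRight k (t 1) ∘ₗ u) := by
  constructor
  · apply WithConv.ofConv_injective
    refine LinearMap.ext fun x => ?_
    have h2 := LinearMap.congr_fun (congrArg WithConv.ofConv h.1) x
    change LinearMap.mul' k E (TensorProduct.map t u (Coalgebra.comul x)) =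
      algebraMap k E (Coalgebra.counit x) at h2
    have h3 : ∀ w : H ⊗[k] H, LinearMap.mul' k E (TensorProduct.map
        (LinearMap.mulLeft k (u 1) ∘ₗ t) (LinearMap.mulRight k (t 1) ∘ₗ u) w) =
        u 1 * LinearMap.mul' k E (TensorProduct.map t u w) * t 1 := by
      intro w
      induction w with
      | zero => simp
      | add x y hx hy => simp only [map_add, mul_add, add_mul, hx, hy]
      | tmul a b => simp [mul_assoc]
    refine (h3 _).trans ?_
    rw [h2, ← Algebra.commutes, mul_assoc, h.symm.mul_one, _root_.mul_one]
    rfl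
  · apply WithConv.ofConv_injective
    refine LinearMap.ext fun x => ?_
    have h2 := LinearMap.congr_fun (congrArg WithConv.ofConv h.2) x
    change LinearMap.mul' k E (TensorProduct.map u t (Coalgebra.comul x)) =
      algebraMap k E (Coalgebra.counit x) at h2
    have h3 : ∀ w : H ⊗[k] H, LinearMap.mul' k E (TensorProduct.map
        (LinearMap.mulRight k (t 1) ∘ₗ u) (LinearMap.mulLeft k (u 1) ∘ₗ t) w) =
        LinearMap.mul' k E (TensorProduct.map u t w) := by
      intro w
      induction w with
      | zero => simp
      | add x y hx hy => simp only [map_add, hx, hy]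
      | tmul a b =>
        simp only [TensorProduct.map_tmul, LinearMap.mul'_apply, LinearMap.comp_apply,
          LinearMap.mulRight_apply, LinearMap.mulLeft_apply]
        rw [mul_assoc, ← mul_assoc (t 1), h.mul_one, one_mul]
    exact (h3 _).trans h2

/-- If `t(h) e = Λ(h₁) t(h₂)`, then `t(h₁) e u(h₂) = Λ(h)`. -/
theorem IsConvInverse.cleftAction_eq {t u : H →ₗ[k] E} (h : IsConvInverse t u) {e : E}
    {Λ : H →ₗ[k] E} (hΛ : WithConv.toConv (LinearMap.mulRight k e ∘ₗ t) =
      WithConv.toConv Λ * WithConv.toConv t) (x : H) : cleftAction t u x e = Λ x := by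
  have h1 : WithConv.toConv (LinearMap.mulRight k e ∘ₗ t) * WithConv.toConv u =
      WithConv.toConv Λ := by
    rw [hΛ, mul_assoc, h.1, _root_.mul_one]
  exact LinearMap.congr_fun (congrArg WithConv.ofConv h1) x

end Convolution

/-! ### Coinvariants of an induced module -/

section Ind

variable {k H R S M : Type*} [Field k] [Ring H] [HopfAlgebra k H] [Ring S] [Algebra k S]
  [RightComoduleAlgebra k H S] [Ring R] [Module Rᵐᵒᵖ S] [SMulCommClass S Rᵐᵒᵖ S]
  [AddCommGroup M] [Module k M] [Module R M] [IsCoinvAction k H R S]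
  {φ : BTensor k R S M ≃ₗ[k] M ⊗[k] H} (hφ : IsIndStable φ)

-- A colinear map into a cofree comodule `M ⊗ H` is recovered from its composite with `M ⊗ ε`.
include hφ in
theorem rTensor_counitInd_indCoact (p : BTensor k R S M) :
    (counitInd φ).rTensor H (indCoact k H R S M p) = φ p := by
  obtain ⟨z, rfl⟩ := φ.symm.surjective p
  induction z with
  | zero => simp
  | add x y hx hy => simp only [map_add, hx, hy]
  | tmul m h =>
    have h1 : ∀ w : H ⊗[k] H, (counitInd φ).rTensor H
        ((φ.symm.toLinearMap ∘ₗ TensorProduct.mk k M H m).rTensor H w) =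
        m ⊗ₜ TensorProduct.lid k H ((Coalgebra.counit : H →ₗ[k] k).rTensor H w) := by
      intro w
      induction w with
      | zero => simp
      | add x y hx hy => simp only [map_add, TensorProduct.tmul_add, hx, hy]
      | tmul a b =>
        have h2 := counitInd_symm (φ := φ) m a
        simp only [LinearMap.rTensor_tmul, LinearMap.comp_apply, TensorProduct.mk_apply,
          LinearEquiv.coe_coe, h2, TensorProduct.lid_tmul, TensorProduct.smul_tmul]
    rw [hφ.coact_symm, h1, Coalgebra.rTensor_counit_comul, TensorProduct.lid_tmul, one_smul,
      φ.apply_symm_apply]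

include hφ in
/-- If `t(1)` is injective, then `M` is the space of coinvariants of `S ⊗_R M`. -/
theorem exists_unitInd_eq (hinj : Function.Injective fun p => unop (cleaving hφ 1) p)
    {p : BTensor k R S M} (hp : indCoact k H R S M p = p ⊗ₜ 1) :
    ∃ m, unitInd k R S M m = p := by
  -- `t(1)` is a coinvariant endomorphism, so it preserves coinvariants. For coinvariant `q =
  -- t(1)(p)` the previous lemma gives `φ(q) = m ⊗ 1`, whence `q = φ⁻¹(m ⊗ 1) = t(1)(1 ⊗ m)`.
  have h1 : indCoact k H R S M (unop (cleaving hφ 1) p) = unop (cleaving hφ 1) p ⊗ₜ 1 := by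
    rw [isCoactionOf_cleaving hφ 1, hp, endTensor_comul, Bialgebra.comul_one,
      Algebra.TensorProduct.one_def, LinearMap.rTensor_tmul, evalAt_apply]
  have h2 := rTensor_counitInd_indCoact hφ (unop (cleaving hφ 1) p)
  rw [h1, LinearMap.rTensor_tmul] at h2
  refine ⟨counitInd φ (unop (cleaving hφ 1) p), hinj ?_⟩
  beta_reduce
  rw [unop_cleaving_unitInd, h2, φ.symm_apply_apply]

include hφ in
theorem unitInd_injective : Function.Injective (unitInd k R S M) := by
  intro m m' h
  have h1 : φ.symm (m ⊗ₜ[k] (1 : H)) = φ.symm (m' ⊗ₜ[k] (1 : H)) := by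
    rw [← unop_cleaving_unitInd hφ, h, unop_cleaving_unitInd]
  have h2 := congrArg (counitInd φ) h1
  rwa [counitInd_symm, counitInd_symm, Bialgebra.counit_one, one_smul, one_smul] at h2

end Ind

/-! ### Commuting central elements past `A^{□e}` -/

section Center

variable {k : Type*} {H : Type*} {A : Type v} [Field k] [Ring H] [HopfAlgebra k H]
  [Ring A] [Algebra k A] [RightComoduleAlgebra k H A]

variable (k H A) in
/-- The inclusion `Z(B) → A^{□e}`, `x ↦ x ⊗ 1`. -/
def centerIncl : Subalgebra.center k (coinv k H A) →ₗ[k] BoxE k H A :=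
  (envIncl k H A).toLinearMap ∘ₗ
    (Algebra.TensorProduct.includeLeft :
      coinv k H A →ₐ[k] coinv k H A ⊗[k] (coinv k H A)ᵐᵒᵖ).toLinearMap ∘ₗ
    (Subalgebra.center k (coinv k H A)).val.toLinearMap

theorem centerIncl_apply (x : Subalgebra.center k (coinv k H A)) :
    centerIncl k H A x = envIncl k H A (Env.tmul (x : coinv k H A) 1) := rfl

theorem boxTwoSided_centerIncl (x : Subalgebra.center k (coinv k H A)) :
    boxTwoSided k H A (centerIncl k H A x) = leftEmb k A ((x : coinv k H A) : A) := by
  rw [centerIncl_apply, boxTwoSided_envIncl, leftEmb_apply]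
  rfl

variable [Coalgebra.IsCocomm k H]

/-- `y (x ⊗ 1) = ((y₁ · x) ⊗ 1) y₀` in `A^{□e}`. -/
theorem box_mul_centerIncl (hA : IsFaithfullyFlatGalois k H A)
    (x : Subalgebra.center k (coinv k H A)) (y : BoxE k H A) :
    LinearMap.mul' k (BoxE k H A) (TensorProduct.comm k (BoxE k H A) (BoxE k H A)
      ((centerIncl k H A ∘ₗ (muAct hA).flip x).lTensor (BoxE k H A) (rho k H (BoxE k H A) y))) =
    y * centerIncl k H A x := by
  let K : TwoSided k A ⊗[k] H →ₗ[k] TwoSided k A :=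
    LinearMap.mul' k (TwoSided k A) ∘ₗ
      (TensorProduct.comm k (TwoSided k A) (TwoSided k A)).toLinearMap ∘ₗ
      (leftEmb k A ∘ₗ mu hA x ∘ₗ HopfAlgebra.antipode k).lTensor (TwoSided k A)
  have hK : ∀ (q : TwoSided k A) (h : H),
      K (q ⊗ₜ h) = leftEmb k A (mu hA x (HopfAlgebra.antipode k h)) * q := fun _ _ => rfl
  have h1 : ∀ z : BoxE k H A ⊗[k] H, boxTwoSided k H A
      (LinearMap.mul' k (BoxE k H A) (TensorProduct.comm k (BoxE k H A) (BoxE k H A)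
        ((centerIncl k H A ∘ₗ (muAct hA).flip x).lTensor (BoxE k H A) z))) =
      K ((boxTwoSided k H A).toLinearMap.rTensor H z) := by
    intro z
    induction z with
    | zero => simp
    | add x y hx hy => simp only [map_add, hx, hy]
    | tmul y h =>
      rw [LinearMap.lTensor_tmul, TensorProduct.comm_tmul, LinearMap.mul'_apply, map_mul,
        LinearMap.comp_apply, boxTwoSided_centerIncl, LinearMap.rTensor_tmul, hK]
      rfl
  -- The coaction and multiplication by `x ⊗ 1` involve only the first tensor factor, so this is
  -- `mul_center_eq` with `a'` carried along.
  have h2 : ∀ q : TwoSided k A, K (leftCoact k H A q) = q * leftEmb k A ((x : coinv k H A) : A) := by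
    intro q
    induction q using TwoSided.induction with
    | zero => simp
    | add x y hx hy => simp only [map_add, add_mul, hx, hy]
    | tmul a a' =>
      have h3 : ∀ z : A ⊗[k] H, K (TensorProduct.map (TwoSided.tmul k A) LinearMap.id
          (TensorProduct.rightComm k A H A (z ⊗ₜ a'))) =
          TwoSided.tmul k A (LinearMap.mul' k A (TensorProduct.comm k A A
            ((mu hA x ∘ₗ HopfAlgebra.antipode k).lTensor A z)) ⊗ₜ a') := by
        intro z
        induction z with
        | zero => simp
        | add x y hx hy => simp only [map_add, TensorProduct.add_tmul, hx, hy]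
        | tmul a h =>
          rw [TensorProduct.rightComm_tmul, TensorProduct.map_tmul, LinearMap.id_apply, hK,
            leftEmb_apply, TwoSided.tmul_mul_tmul, mul_one]
          rfl
      rw [leftCoact_tmul, h3, mul_center_eq, leftEmb_apply, TwoSided.tmul_mul_tmul, one_mul]
  apply boxTwoSided_injective k H A
  rw [h1, rTensor_boxTwoSided_rho, h2, map_mul, boxTwoSided_centerIncl]

end Center

/-! ### The endomorphisms `λ_x` and their commutation with colinear maps -/

section Bimodule

variable {k : Type*} {H : Type*} {A : Type v} [Field k] [Ring H] [HopfAlgebra k H]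
  [Ring A] [Algebra k A] [RightComoduleAlgebra k H A]
variable {M : Type*} [AddCommGroup M] [Module k M]
  [Module (coinv k H A) M] [Module (coinv k H A)ᵐᵒᵖ M]
  [IsScalarTower k (coinv k H A) M] [IsScalarTower k (coinv k H A)ᵐᵒᵖ M]
  [SMulCommClass (coinv k H A) (coinv k H A)ᵐᵒᵖ M]

theorem Env.tmul_smul (b b' : coinv k H A) (m : M) : Env.tmul b b' • m = b • op b' • m := rfl

theorem Env.induction {p : Env k H A → Prop} (e : Env k H A) (zero : p 0)
    (add : ∀ x y, p x → p y → p (x + y)) (tmul : ∀ b b', p (Env.tmul b b')) : p e :=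
  TensorProduct.induction_on (motive := p) e zero (fun b b' => tmul b (unop b')) add

instance : SMulCommClass (Env k H A) k M where
  smul_comm e c m := by
    induction e using Env.induction with
    | zero => rw [zero_smul, zero_smul, smul_zero]
    | add x y hx hy => rw [add_smul, add_smul, hx, hy, smul_add]
    | tmul b b' =>
      rw [Env.tmul_smul, Env.tmul_smul, smul_comm (op b'), smul_comm b c]

theorem center_smul_env_smul (x : Subalgebra.center k (coinv k H A)) (e : Env k H A) (m : M) :
    (x : coinv k H A) • e • m = e • (x : coinv k H A) • m := by
  induction e using Env.induction with
  | zero => rw [zero_smul, zero_smul, smul_zero]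
  | add y z hy hz => rw [add_smul, add_smul, smul_add, hy, hz]
  | tmul b b' =>
    rw [Env.tmul_smul, Env.tmul_smul, ← smul_comm (x : coinv k H A) (op b'), ← mul_smul, ← mul_smul,
      Subalgebra.mem_center_iff.1 x.2]

theorem op_env_smul_one (e : Env k H A) : op e • (1 : BoxE k H A) = envIncl k H A e := by
  rw [op_env_smul, one_mul]

theorem centerIncl_smul_unitInd (x : Subalgebra.center k (coinv k H A)) (m : M) :
    centerIncl k H A x • unitInd k (Env k H A) (BoxE k H A) M m =
      unitInd k (Env k H A) (BoxE k H A) M ((x : coinv k H A) • m) := by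
  rw [centerIncl_apply, ← op_env_smul_one, unitInd_apply, op_smul_one_smul, Env.tmul_smul, op_one,
    one_smul, unitInd_apply]

variable [Coalgebra.IsCocomm k H]

/-- A bimodule is a left `B^e`-module, so stability is an instance of the one-sided notion used for
the cleaving; colinearity is rewritten for `φ⁻¹`. -/
theorem IsStabilityIso.isIndStable {φ : BoxInd k H A M ≃ₗ[k] M ⊗[k] H} (hφ : IsStabilityIso φ) :
    IsIndStable φ where
  symm_smul e m h := by
    rw [op_env_smul_one]
    induction e using Env.induction with
    | zero => rw [zero_smul, map_zero, zero_smul, TensorProduct.zero_tmul, map_zero]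
    | add x y hx hy => rw [add_smul, map_add, add_smul, TensorProduct.add_tmul, map_add, hx, hy]
    | tmul b b' =>
      apply φ.injective
      rw [φ.apply_symm_apply, hφ.bilinear, φ.apply_symm_apply]
      rfl
  coact_symm m h := by
    have h1 := hφ.colinear (φ.symm (m ⊗ₜ h))
    rw [φ.apply_symm_apply, LinearMap.lTensor_tmul, ← LinearEquiv.eq_symm_apply] at h1
    have h2 := congrArg (φ.symm.toLinearMap.rTensor H) h1
    rw [← LinearMap.rTensor_comp_apply, LinearEquiv.symm_comp, LinearMap.rTensor_id,
      LinearMap.id_apply] at h2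
    refine h2.trans ?_
    generalize (Coalgebra.comul h : H ⊗[k] H) = w
    induction w with
    | zero => simp
    | add x y hx hy => simp only [map_add, TensorProduct.tmul_add, hx, hy]
    | tmul a b => rfl

variable (k H A M) in
/-- The endomorphisms `λ_x(y ⊗ m) = y ⊗ xm` of `A^{□e} ⊗_{B^e} M`. -/
def centerEnd : Subalgebra.center k (coinv k H A) →ₗ[k]
    (Module.End (BoxE k H A) (BoxInd k H A M))ᵐᵒᵖ :=
  indEnd (((Algebra.lsmul k k M).toLinearMap ∘ₗ
    (Subalgebra.center k (coinv k H A)).val.toLinearMap).compr₂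
      (unitInd k (Env k H A) (BoxE k H A) M)) (by
    intro x e m
    change unitInd k (Env k H A) (BoxE k H A) M ((x : coinv k H A) • e • m) =
      _ • unitInd k (Env k H A) (BoxE k H A) M ((x : coinv k H A) • m)
    rw [unitInd_apply, unitInd_apply, op_smul_one_smul, center_smul_env_smul])

omit [Coalgebra.IsCocomm k H] in
theorem unop_centerEnd_tmul (x : Subalgebra.center k (coinv k H A)) (y : BoxE k H A) (m : M) :
    unop (centerEnd k H A M x) (BTensor.tmul k (Env k H A) y m) =
      BTensor.tmul k (Env k H A) y ((x : coinv k H A) • m) := by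
  refine Eq.trans ?_ (smul_one_tmul (k := k) (R := Env k H A) y ((x : coinv k H A) • m))
  rfl

omit [Coalgebra.IsCocomm k H] in
theorem unop_centerEnd_unitInd (x : Subalgebra.center k (coinv k H A)) (m : M) :
    unop (centerEnd k H A M x) (unitInd k (Env k H A) (BoxE k H A) M m) =
      unitInd k (Env k H A) (BoxE k H A) M ((x : coinv k H A) • m) := by
  rw [unitInd_apply, unop_centerEnd_tmul, unitInd_apply]

theorem isCoactionOf_centerEnd (x : Subalgebra.center k (coinv k H A)) :
    IsCoactionOf (boxIndCoact k H A M) (centerEnd k H A M x) (centerEnd k H A M x ⊗ₜ 1) := by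
  refine isCoactionOf_ind fun m => ?_
  rw [endTensor_tmul, unop_centerEnd_unitInd, indCoact_unitInd, one_mul]

variable (k H A M) in
/-- The algebra map `λ : Z(B) → E^{co H}`. -/
def centerEndAlgHom : Subalgebra.center k (coinv k H A) →ₐ[k] EndBoxCoinv k H A M :=
  AlgHom.codRestrict (AlgHom.codRestrict (AlgHom.ofLinearMap (centerEnd k H A M)
    (unop_injective (end_ind_ext fun m => by
      rw [unop_centerEnd_unitInd]
      exact congrArg _ (one_smul (coinv k H A) m)))
    (fun x y => unop_injective (end_ind_ext fun m => by
      rw [unop_mul, Module.End.mul_apply, unop_centerEnd_unitInd, unop_centerEnd_unitInd,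
        unop_centerEnd_unitInd, mul_comm x y, ← mul_smul]
      rfl)))
    (EndBox k H A M) fun x => ⟨_, isCoactionOf_centerEnd x⟩)
    (EndBoxCoinv k H A M) isCoactionOf_centerEnd

theorem coe_centerEndAlgHom (x : Subalgebra.center k (coinv k H A)) :
    ((centerEndAlgHom k H A M x : EndBox k H A M) :
      (Module.End (BoxE k H A) (BoxInd k H A M))ᵐᵒᵖ) = centerEnd k H A M x := rfl

/-- The map `p ⊗ h ↦ (h · x) p`. -/
def centerPair (hA : IsFaithfullyFlatGalois k H A) (M : Type*) [AddCommGroup M] [Module k M]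
    [Module (coinv k H A) M] [Module (coinv k H A)ᵐᵒᵖ M]
    [IsScalarTower k (coinv k H A) M] [IsScalarTower k (coinv k H A)ᵐᵒᵖ M]
    [SMulCommClass (coinv k H A) (coinv k H A)ᵐᵒᵖ M]
    (x : Subalgebra.center k (coinv k H A)) :
    BoxInd k H A M ⊗[k] H →ₗ[k] BoxInd k H A M :=
  TensorProduct.lift (LinearMap.flip ((Algebra.lsmul k k (BoxInd k H A M)).toLinearMap ∘ₗ
    centerIncl k H A ∘ₗ (muAct hA).flip x))

theorem centerPair_tmul (hA : IsFaithfullyFlatGalois k H A)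
    (x : Subalgebra.center k (coinv k H A)) (p : BoxInd k H A M) (h : H) :
    centerPair hA M x (p ⊗ₜ h) = centerIncl k H A (muAct hA h x) • p := rfl

/-- `λ_x(p) = (p₁ · x) p₀`. -/
theorem unop_centerEnd (hA : IsFaithfullyFlatGalois k H A)
    (x : Subalgebra.center k (coinv k H A)) (p : BoxInd k H A M) :
    unop (centerEnd k H A M x) p = centerPair hA M x (boxIndCoact k H A M p) := by
  induction p using ind_induction with
  | zero => rw [map_zero, map_zero, map_zero]
  | add x y hx hy => rw [map_add, map_add, map_add, hx, hy]
  | smul s m =>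
    rw [map_smul, unop_centerEnd_unitInd, ← centerIncl_smul_unitInd, ← mul_smul,
      ← box_mul_centerIncl hA, indCoact_smul_unitInd]
    generalize rho k H (BoxE k H A) s = z
    induction z with
    | zero => simp
    | add x y hx hy => simp only [map_add, add_smul, LinearMap.add_apply, hx, hy]
    | tmul a h =>
      rw [tensorLeftAct_tmul, centerPair_tmul, mul_one, ← mul_smul]
      rfl

/-- `t(h) λ_x = λ_{h₁ · x} t(h₂)` for a colinear map `t`. -/
theorem mulRight_centerEnd_comp (hA : IsFaithfullyFlatGalois k H A)
    {t : H →ₗ[k] EndBox k H A M} (ht : IsColinear t) (x : Subalgebra.center k (coinv k H A)) :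
    WithConv.toConv (LinearMap.mulRight k (centerEndAlgHom k H A M x : EndBox k H A M) ∘ₗ t) =
      WithConv.toConv ((EndBoxCoinv k H A M).val.toLinearMap ∘ₗ
        (centerEndAlgHom k H A M).toLinearMap ∘ₗ (muAct hA).flip x) * WithConv.toConv t := by
  let f : H →ₗ[k] (Module.End (BoxE k H A) (BoxInd k H A M))ᵐᵒᵖ :=
    (EndBox k H A M).val.toLinearMap ∘ₗ t
  let g : H →ₗ[k] (Module.End (BoxE k H A) (BoxInd k H A M))ᵐᵒᵖ :=
    centerEnd k H A M ∘ₗ (muAct hA).flip x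
  -- For `w = a ⊗ b` this is `(p₁ b · x) t(a)(p₀) = t(a)((p₁ · (b · x)) p₀) = t(a)(λ_{b · x}(p))`.
  -- It uses that `t(a)` is linear over `A^{□e}` and that `(h h') · x = h · (h' · x)`. The flip of
  -- `w` is absorbed at the end by cocommutativity.
  have h1 : ∀ (w : H ⊗[k] H) (p : BoxInd k H A M),
      centerPair hA M x (endTensor k H (BoxE k H A) _ (f.rTensor H w) (boxIndCoact k H A M p)) =
        evalPair f ((evalAt g p).rTensor H (TensorProduct.comm k H H w)) := by
    intro w p
    induction w with
    | zero => simp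
    | add x y hx hy => simp only [map_add, LinearMap.add_apply, hx, hy]
    | tmul a b =>
      rw [TensorProduct.comm_tmul, LinearMap.rTensor_tmul, LinearMap.rTensor_tmul, evalPair_tmul,
        evalAt_apply]
      change _ = unop (f a) (unop (centerEnd k H A M (muAct hA b x)) p)
      rw [unop_centerEnd hA]
      generalize boxIndCoact k H A M p = z
      induction z with
      | zero => simp
      | add x y hx hy => simp only [map_add, hx, hy]
      | tmul p h =>
        rw [endTensor_tmul, centerPair_tmul, centerPair_tmul, map_smul,
          (isModuleAlgebra_muAct hA).mul_act]
  apply WithConv.ofConv_injective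
  refine val_comp_injective (LinearMap.ext fun h => unop_injective (LinearMap.ext fun p => ?_))
  have h2 := congrArg (fun e : WithConv (H →ₗ[k] (Module.End (BoxE k H A) (BoxInd k H A M))ᵐᵒᵖ) =>
    unop (e.ofConv h) p) (val_convMul
    ((EndBoxCoinv k H A M).val.toLinearMap ∘ₗ
        (centerEndAlgHom k H A M).toLinearMap ∘ₗ (muAct hA).flip x) t)
  refine Eq.trans ?_ h2
  change unop (centerEnd k H A M x) (unop (f h) p) =
    unop ((WithConv.toConv g * WithConv.toConv f).ofConv h) p
  have h3 : IsCoactionOf (boxIndCoact k H A M) (f h) (f.rTensor H (Coalgebra.comul h)) := ht h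
  rw [unop_convMul, unop_centerEnd hA, h3, h1, Coalgebra.comm_comul]

end Bimodule

/-! ### Cleftness of `E` and its coinvariants -/

section Stable

variable {k : Type*} {H : Type*} {A : Type v} [Field k] [Ring H] [HopfAlgebra k H]
  [Coalgebra.IsCocomm k H] [Ring A] [Algebra k A] [RightComoduleAlgebra k H A]
variable {M : Type*} [AddCommGroup M] [Module k M]
  [Module (coinv k H A) M] [Module (coinv k H A)ᵐᵒᵖ M]
  [IsScalarTower k (coinv k H A) M] [IsScalarTower k (coinv k H A)ᵐᵒᵖ M]
  [SMulCommClass (coinv k H A) (coinv k H A)ᵐᵒᵖ M]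

omit [Coalgebra.IsCocomm k H] in
theorem env_smul_box_eq (e : Env k H A) (y : BoxE k H A) :
    e • y = (op e • (1 : BoxE k H A)) * y := by
  rw [env_smul_box, op_env_smul_one]

/-- The canonical isomorphism `A^{□e} ⊗_{B^e} A^{□e} ≅ A^{□e} ⊗ H`. -/
def canBoxEquiv (hA : IsFaithfullyFlatGalois k H A) : BoxSq k H A ≃ₗ[k] BoxE k H A ⊗[k] H :=
  LinearEquiv.ofBijective (canBox k H A) (canBox_bijective hA)

theorem canBoxEquiv_tmul (hA : IsFaithfullyFlatGalois k H A) (y z : BoxE k H A) :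
    canBoxEquiv hA (BTensor.tmul k (Env k H A) y z) = (y ⊗ₜ 1) * rho k H (BoxE k H A) z := rfl

variable (hA : IsFaithfullyFlatGalois k H A) {φ : BoxInd k H A M ≃ₗ[k] M ⊗[k] H}
  (hφ : IsIndStable φ)

include hA hφ in
/-- A stable bimodule gives a cleaving `t` with convolution inverse `u`, such that `u(1)` is
coinvariant. -/
theorem exists_isColinear_isConvInverse :
    ∃ t u : H →ₗ[k] EndBox k H A M, (EndBox k H A M).val.toLinearMap ∘ₗ t = cleaving hφ ∧
      IsColinear t ∧ IsConvInverse t u ∧ u 1 ∈ EndBoxCoinv k H A M := by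
  let u₀ := cleavingInv hφ env_smul_box_eq (canBoxEquiv hA) (canBoxEquiv_tmul hA)
  refine ⟨(cleaving hφ).codRestrict (Subalgebra.toSubmodule (EndBox k H A M))
      fun h => ⟨_, isCoactionOf_cleaving hφ h⟩,
    u₀.codRestrict (Subalgebra.toSubmodule (EndBox k H A M))
      fun h => ⟨_, isCoactionOf_cleavingInv hφ env_smul_box_eq _ (canBoxEquiv_tmul hA) h⟩, rfl,
    isCoactionOf_cleaving hφ, ⟨convMul_eq_one_of_val ?_, convMul_eq_one_of_val ?_⟩, ?_⟩
  · exact cleaving_mul_cleavingInv hφ env_smul_box_eq _ (canBoxEquiv_tmul hA)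
  · exact cleavingInv_mul_cleaving hφ env_smul_box_eq _ (canBoxEquiv_tmul hA)
  · have h1 := isCoactionOf_cleavingInv hφ env_smul_box_eq (canBoxEquiv hA) (canBoxEquiv_tmul hA) 1
    rwa [Bialgebra.comul_one, Algebra.TensorProduct.one_def, TensorProduct.comm_tmul,
      TensorProduct.map_tmul, HopfAlgebra.antipode_one] at h1

/-- The coaction of a product is the product of the coactions, and that of `e` is `e ⊗ 1`. -/
theorem IsColinear.mulLeft {t : H →ₗ[k] EndBox k H A M} (ht : IsColinear t) {e : EndBox k H A M}
    (he : e ∈ EndBoxCoinv k H A M) : IsColinear (LinearMap.mulLeft k e ∘ₗ t) := by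
  intro h
  have h1 := IsCoactionOf.mul he (ht h)
  have h2 : ∀ w : H ⊗[k] H,
      ((EndBox k H A M).val.toLinearMap ∘ₗ LinearMap.mulLeft k e ∘ₗ t).rTensor H w =
      ((e : (Module.End (BoxE k H A) (BoxInd k H A M))ᵐᵒᵖ) ⊗ₜ 1) *
        ((EndBox k H A M).val.toLinearMap ∘ₗ t).rTensor H w := by
    intro w
    induction w with
    | zero => simp
    | add x y hx hy => simp only [map_add, mul_add, hx, hy]
    | tmul a b =>
      rw [LinearMap.rTensor_tmul, LinearMap.rTensor_tmul, Algebra.TensorProduct.tmul_mul_tmul,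
        one_mul]
      rfl
  rw [h2]
  exact h1

-- The equation `t(1) u(1) = 1` in `E` says that the endomorphism `u(1)` composed after `t(1)` is
-- the identity, as the product is opposite to composition.
include hA hφ in
theorem cleaving_one_injective : Function.Injective fun p => unop (cleaving hφ 1) p := by
  obtain ⟨t, u, ht, -, htu, -⟩ := exists_isColinear_isConvInverse hA hφ
  have h1 : cleaving hφ 1 * ((u 1 : EndBox k H A M) : (Module.End (BoxE k H A) _)ᵐᵒᵖ) = 1 := by
    rw [← ht]
    exact congrArg Subtype.val htu.mul_one
  refine Function.LeftInverse.injective (g := fun p =>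
    unop ((u 1 : EndBox k H A M) : (Module.End (BoxE k H A) (BoxInd k H A M))ᵐᵒᵖ) p)
    fun p => ?_
  exact LinearMap.congr_fun (congrArg unop h1) p

variable {N : Type*} [AddCommGroup N] [Module k N]
  [Module (coinv k H A) N] [Module (coinv k H A)ᵐᵒᵖ N]

include hA hφ in
theorem centerEndAlgHom_bijective (C : StrictMoritaContext k (coinv k H A) M N) :
    Function.Bijective (centerEndAlgHom k H A M) := by
  have hinj : Function.Injective (unitInd k (Env k H A) (BoxE k H A) M) := unitInd_injective hφ
  constructor
  · rw [injective_iff_map_eq_zero]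
    intro x hx
    refine Subtype.ext (C.eq_zero_of_smul fun m => hinj ?_)
    rw [map_zero, ← unop_centerEnd_unitInd, ← coe_centerEndAlgHom, hx]
    rfl
  · intro f
    -- A coinvariant `f` preserves the coinvariants `1 ⊗ M` of `P_M`, hence restricts to a map `g`
    -- of `M`. It is `B^e`-linear because `m ↦ 1 ⊗ m` is injective.
    have h1 : ∀ m : M, ∃ m', unitInd k (Env k H A) (BoxE k H A) M m' =
        unop ((f : EndBox k H A M) : (Module.End (BoxE k H A) (BoxInd k H A M))ᵐᵒᵖ)
          (unitInd k (Env k H A) (BoxE k H A) M m) := by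
      intro m
      refine exists_unitInd_eq hφ (cleaving_one_injective hA hφ) ?_
      rw [f.2, indCoact_unitInd, endTensor_tmul, one_mul]
    choose g hg using h1
    have hsmul : ∀ (e : Env k H A) m, g (e • m) = e • g m := by
      intro e m
      apply hinj
      rw [hg, unitInd_apply, unitInd_apply, ← op_smul_one_smul, map_smul, ← unitInd_apply, ← hg,
        unitInd_apply, op_smul_one_smul]
    let g' : M →ₗ[k] M :=
      { toFun := g
        map_add' := fun m m' => hinj (by rw [hg, map_add, map_add, map_add, hg, hg])
        map_smul' := fun c m => hinj (by
          rw [hg, map_smul, LinearMap.map_smul_of_tower, RingHom.id_apply, map_smul, hg]) }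
    obtain ⟨x, hx⟩ := C.exists_center_smul g'
      (fun b m => by
        have h2 := hsmul (Env.tmul b 1) m
        rwa [Env.tmul_smul, Env.tmul_smul, op_one, one_smul, one_smul] at h2)
      (fun b m => by
        have h2 := hsmul (Env.tmul 1 b) m
        rwa [Env.tmul_smul, Env.tmul_smul, one_smul, one_smul] at h2)
    refine ⟨x, Subtype.ext (Subtype.ext (unop_injective (end_ind_ext fun m => ?_)))⟩
    rw [coe_centerEndAlgHom, unop_centerEnd_unitInd, ← hx, ← hg]
    rfl

end Stable

end

end HopfGalois

theorem proposition6p4 {k H A : Type*} [Field k] [Ring H] [HopfAlgebra k H]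
    [Coalgebra.IsCocomm k H] [Ring A] [Algebra k A] [RightComoduleAlgebra k H A]
    (hA : IsFaithfullyFlatGalois k H A) :
    ∃ act : H →ₗ[k] Module.End k (Subalgebra.center k (coinv k H A)),
      (∀ h x, ((act h x : coinv k H A) : A) = muLeft hA h x) ∧
      IsModuleAlgebra act ∧
      ∀ (M N : Type*) [AddCommGroup M] [Module k M]
        [Module (coinv k H A) M] [Module (coinv k H A)ᵐᵒᵖ M]
        [IsScalarTower k (coinv k H A) M] [IsScalarTower k (coinv k H A)ᵐᵒᵖ M]
        [SMulCommClass (coinv k H A) (coinv k H A)ᵐᵒᵖ M]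
        [AddCommGroup N] [Module k N]
        [Module (coinv k H A) N] [Module (coinv k H A)ᵐᵒᵖ N]
        [IsScalarTower k (coinv k H A) N] [IsScalarTower k (coinv k H A)ᵐᵒᵖ N]
        [SMulCommClass (coinv k H A) (coinv k H A)ᵐᵒᵖ N]
        (_ : StrictMoritaContext k (coinv k H A) M N) (_ : IsHStable k H A M),
        ∃ lam : Subalgebra.center k (coinv k H A) ≃ₐ[k] EndBoxCoinv k H A M,
          (∀ (x : Subalgebra.center k (coinv k H A)) (y : BoxE k H A) (m : M),
            unop ((lam x : EndBox k H A M) :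
                (Module.End (BoxE k H A) (BoxInd k H A M))ᵐᵒᵖ)
              (BTensor.tmul k (Env k H A) y m) =
            BTensor.tmul k (Env k H A) y ((x : coinv k H A) • m)) ∧
          (∀ φ : BoxInd k H A M ≃ₗ[k] M ⊗[k] H, IsStabilityIso φ →
            ∃ t u : H →ₗ[k] EndBox k H A M, IsColinear t ∧ IsConvInverse t u ∧
              ∀ (h : H) (y : BoxE k H A) (m : M),
                unop (t h : (Module.End (BoxE k H A) (BoxInd k H A M))ᵐᵒᵖ)
                  (BTensor.tmul k (Env k H A) y m) = y • φ.symm (m ⊗ₜ[k] h)) ∧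
          (∃ t u : H →ₗ[k] EndBox k H A M, IsColinear t ∧ IsConvInverse t u ∧ t 1 = 1) ∧
          ∀ t u : H →ₗ[k] EndBox k H A M, IsColinear t → IsConvInverse t u →
            ∀ (h : H) (x : Subalgebra.center k (coinv k H A)),
              cleftAction t u h (lam x : EndBox k H A M) = (lam (act h x) : EndBox k H A M) := by

  refine ⟨muAct hA, fun h x => rfl, isModuleAlgebra_muAct hA, ?_⟩
  intro M N _ _ _ _ _ _ _ _ _ _ _ _ _ _ C hM
  obtain ⟨φ₀, hφ₀⟩ := hM
  refine ⟨AlgEquiv.ofBijective (centerEndAlgHom k H A M)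
    (centerEndAlgHom_bijective hA hφ₀.isIndStable C), fun x y m => unop_centerEnd_tmul x y m,
    fun φ hφ => ?_, ?_, fun t u ht htu h x => ?_⟩
  · obtain ⟨t, u, h1, ht, htu, -⟩ := exists_isColinear_isConvInverse hA hφ.isIndStable
    refine ⟨t, u, ht, htu, fun h y m => ?_⟩
    rw [← unop_cleaving_tmul hφ.isIndStable, ← h1]
    rfl
  · obtain ⟨t, u, -, ht, htu, hu⟩ := exists_isColinear_isConvInverse hA hφ₀.isIndStable
    -- The normalised cleaving `u(1) t` is colinear because `u(1)` is coinvariant: its coaction is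
    -- `u(1) ⊗ S(1)`.
    exact ⟨_, _, ht.mulLeft hu, htu.normalize, htu.symm.mul_one⟩
  · exact htu.cleftAction_eq (mulRight_centerEnd_comp hA ht x) h
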